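/- **Setting.** Let $P$ be a probability distribution on a measurable space $\mathcal S$, let $r:\mathbb R^d\to(-\infty,+\infty]$, $f(\cdot;s):\mathbb R^d\to(-\infty,+\infty]$, $F(x)=\mathbb E_{s\sim P}[f(x;s)]$, $\phi=F+r$, $\phi^*=\inf\phi$. For a self-adjoint positive-definite linear map $M$ put $\|x\|_M=\sqrt{\langle x,Mx\rangle}$. A function $p$ is $c$-weakly convex if $p+\frac c2\|\cdot\|_2^2$ is convex, and $e^M_{\alpha p}(x)=\min_y\{p(y)+\frac1{2\alpha}\|y-x\|_M^2\}$ is its Moreau envelope. Assume: 1. (Model) There are $\bar\eta\in\mathbb R$, an open convex set $V\supseteq\mathrm{dom}(r)$ and a measurable real-valued function $(x,y,s)\mapsto f_x(y;s)$ on $V\times V\times\mathcal S$ such that, for $P$-almost all $s$, $f_x(x;s)=f(x;s)$ and $|f_x(y;s)-f(y;s)|\le\frac{\bar\eta}2\|y-x\|_2^2$ for all $x,y\in V$. Put $\varphi_x(y;s)=f_x(y;s)+r(y)$, which is $+\infty$ outside $\mathrm{dom}(r)$. 2. (Regularity) $F$ is well defined, real-valued and locally Lipschitz on $\mathbb R^d$;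 $r$ is proper and closed; for $P$-almost all $s$, $f(\cdot;s)$ is proper and closed with $\mathrm{dom}(f(\cdot;s))\supseteq\mathrm{dom}(r)$, and $\varphi_x(\cdot;s)$ is $\bar\tau$-weakly convex for all $x\in V$, where $\bar\tau\ge0$. 3. (Level sets) $\phi^*>-\infty$ and $\{x:\phi(x)\le t\}$ is bounded for every $t\in\mathbb R$. 4. (Growth) There are a continuous nondecreasing $G_{\rm Lip}:\mathbb R_+\to\mathbb R_+$, a measurable $\bar L_\varphi:\mathcal S\to\mathbb R_+$ and a constant $\bar L_\phi$ with $\sqrt{\mathbb E[\bar L_\varphi(s)^2]}\le\bar L_\phi<\infty$ such that, for $P$-almost all $s$, $$|\varphi_x(y;s)-\varphi_x(z;s)|\le\bar L_\varphi(s)\,G_{\rm Lip}(\max\{\|x\|_2,\|y\|_2\})\,\|y-z\|_2$$ for all $x,y\in V$ and all $z$ in a neighbourhood of $y$. 5. (Sampling and preconditioners) The minibatches $S_k^{1:m}=(S_k^1,\dots,S_k^m)$, $k\ge1$, $m\ge1$, consist of i.i.d. samples from $P$; $\mathcal F_k=\sigma(S_1^{1:m},\dots,S_k^{1:m})$ and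 $\mathbb E_k=\mathbb E[\,\cdot\mid\mathcal F_{k-1}]$. The (possibly random, $\mathcal F_k$-measurable) linear maps $M_k$ are almost surely self-adjoint and positive definite, $M_0=I$, and for constants $\mu_\infty\in(0,1]$, $L_\infty\ge1$, $\mu_k\ge\mu_\infty$, $L_k\in(0,L_\infty]$, $\rho_k\ge1$ with $\rho_0=1$ and $\prod_{k\ge0}\rho_k<\infty$, one has for all $k\ge1$, almost surely, $\mu_k\|v\|_{M_k}\le\|v\|_2\le L_k\|v\|_{M_k}$ for all $v$, and $\rho_k^{-2}\le\mathbb E_k\big[\|v\|_{M_k}^2/\|v\|_{M_{k-1}}^2\big]\le\rho_k^2$ for all $v\ne0$. **Algorithm.** Put $\eta=L_\infty^2\bar\eta$, $\tau=L_\infty^2\bar\tau$, $B_\rho=\sup_{k\ge1}\rho_k^2$. The point $x_1$ is deterministic. For every $k\ge1$, almost surely $x_k\in V$, and the $\mathcal F_k$-measurable point $x_{k+1}$ satisfies, with $$\Phi_k(y)=\frac1m\sum_{i=1}^mf_{x_k}(y;S_k^i)+r(y)+\frac1{2\alpha_k}\|y-x_k\|_{M_k}^2,$$ at least one of: (A)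 $\|x_{k+1}-\arg\min\Phi_k\|_{M_k}\le\epsilon_k$; (B) $\Phi_k(x_{k+1})-\min\Phi_k\le\frac{1-\tau\alpha_k}{2\alpha_k}\epsilon_k^2$; (C) $\mathrm{dist}_{M_k^{-1}}(0,\partial\Phi_k(x_{k+1}))\le\frac{1-\tau\alpha_k}{\alpha_k}\epsilon_k$, where $\partial$ is the regular subdifferential. **Theorem.** Suppose that there are $\gamma\ge0$, $\bar\rho>B_\rho(\eta+2\tau)$ and a deterministic sequence $\bar\alpha_k>0$ such that, for all $k\ge1$, $$\alpha_k=\frac{\bar\alpha_k}{\max\{1,G_{\rm Lip}(\|x_k\|_2)\}},\qquad\epsilon_k=\gamma\alpha_k^2,\qquad\text{where }\ \sup_{k\ge1}\bar\alpha_k<(2\bar\rho)^{-1},\quad\sum_{k\ge1}\bar\alpha_k^2<\infty.$$ Then $\sup_{k\ge1}\|x_k\|_2<\infty$ with probability $1$. If moreover $\sum_{k\ge1}\bar\alpha_k=\infty$, then with probability $1$ the Moreau envelopes $e_k:=e^{M_{k-1}}_{\bar\rho^{-1}\phi}$, $k\ge1$, are finite and differentiable on $\mathbb R^d$ and $\liminf_{k\to\infty}\|\nabla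 e_k(x_k)\|_2=0$. -/

import Mathlib

open MeasureTheory ProbabilityTheory Filter Topology
open scoped NNReal ENNReal RealInnerProductSpace

namespace IspPPA

noncomputable section

/-- The Euclidean space of dimension `d`. -/
abbrev Vec (d : ℕ) := EuclideanSpace ℝ (Fin d)

variable {d : ℕ} {S : Type*} {Ω : Type*}

/-! ### Preconditioned norms and extended-real-valued functions -/

/-- Self-adjoint and positive-definite linear mappings (preconditioners). -/
def IsPrecond (M : Vec d →L[ℝ] Vec d) : Prop :=
  IsSelfAdjoint M ∧ ∀ v : Vec d, v ≠ 0 → 0 < ⟪v, M v⟫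

/-- The norm `‖v‖_M = √⟨v, M v⟩`. -/
def normM (M : Vec d →L[ℝ] Vec d) (v : Vec d) : ℝ := √⟪v, M v⟫

/-- `p : ℝᵈ → (-∞, +∞]` is proper: it never takes the value `-∞` and is somewhere finite. -/
def IsProper (p : Vec d → EReal) : Prop := (∀ y, p y ≠ ⊥) ∧ ∃ y, p y ≠ ⊤

/-- Convexity of an extended-real-valued function (used for functions that never take the
value `-∞`; the convention of `EReal` is `0 * ⊤ = 0`). -/
def IsConvexFn (p : Vec d → EReal) : Prop :=
  ∀ (y z : Vec d) (a b : ℝ), 0 ≤ a → 0 ≤ b → a + b = 1 →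
    p (a • y + b • z) ≤ (a : EReal) * p y + (b : EReal) * p z

/-- `p` is `c`-weakly convex: `p + (c / 2) ‖·‖²` is convex. -/
def IsWeaklyConvex (c : ℝ) (p : Vec d → EReal) : Prop :=
  IsConvexFn fun y => p y + ((c / 2 * ‖y‖ ^ 2 : ℝ) : EReal)

/-- The regular subdifferential of `p` at a point `y` of its domain: all `v` with
`liminf_{z → y, z ≠ y} (p z - p y - ⟨v, z - y⟩) / ‖z - y‖ ≥ 0`, the lower limit being spelled
out. It is empty outside the domain of `p`. -/
def regularSubdiff (p : Vec d → EReal) (y : Vec d) : Set (Vec d) :=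
  {v | p y ≠ ⊤ ∧ ∀ δ : ℝ, 0 < δ → ∀ᶠ z in 𝓝 y,
    p y + ((⟪v, z - y⟫ - δ * ‖z - y‖ : ℝ) : EReal) ≤ p z}

/-- The distance from `0` to the set `A` in the norm `‖·‖_M`; it is `∞` for `A = ∅`. -/
def distZero (M : Vec d →L[ℝ] Vec d) (A : Set (Vec d)) : ℝ≥0∞ :=
  ⨅ v ∈ A, ENNReal.ofReal (normM M v)

/-- The Moreau envelope `e_{α p}^M (x) = inf_y (p y + (1 / (2 α)) ‖y - x‖_M²)`. -/
def moreauEnv (M : Vec d →L[ℝ] Vec d) (α : ℝ) (p : Vec d → EReal) (x : Vec d) : EReal :=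
  ⨅ y, (p y + ((1 / (2 * α) * normM M (y - x) ^ 2 : ℝ) : EReal))

/-! ### The problem data

`f s y` is the component function `f(y; s)`, `g x y s` is the model function `f_x(y; s)` (only its
values for `x, y ∈ V` matter), and `r` is the regularizer. -/

/-- `F(y) = E_{s ∼ P} [f(y; s)]`. -/
def expectedLoss [MeasurableSpace S] (P : Measure S) (f : S → Vec d → EReal) (y : Vec d) : ℝ :=
  ∫ s, (f s y).toReal ∂P

/-- The objective `φ = F + r`. -/
def objective [MeasurableSpace S] (P : Measure S) (f : S → Vec d → EReal) (r : Vec d → EReal)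
    (y : Vec d) : EReal :=
  (expectedLoss P f y : EReal) + r y

/-- The composite model `φ_x(y; s) = f_x(y; s) + r(y)`; it equals `+∞` outside the domain of `r`. -/
def compositeModel (g : Vec d → Vec d → S → ℝ) (r : Vec d → EReal) (x : Vec d) (s : S)
    (y : Vec d) : EReal :=
  (g x y s : EReal) + r y

/-- The minibatch model `(1 / m) ∑ᵢ f_x(y; sᵢ) + r(y)`. -/
def minibatchModel {m : ℕ} (g : Vec d → Vec d → S → ℝ) (r : Vec d → EReal) (x : Vec d)
    (s : Fin m → S) (y : Vec d) : EReal :=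
  (((1 / (m : ℝ)) * ∑ i, g x y (s i) : ℝ) : EReal) + r y

/-- The subproblem objective: minibatch model plus `(1 / (2 α)) ‖y - x‖_M²`. -/
def subproblem {m : ℕ} (g : Vec d → Vec d → S → ℝ) (r : Vec d → EReal)
    (M : Vec d →L[ℝ] Vec d) (α : ℝ) (x : Vec d) (s : Fin m → S) (y : Vec d) : EReal :=
  minibatchModel g r x s y + ((1 / (2 * α) * normM M (y - x) ^ 2 : ℝ) : EReal)

/-! ### Assumptions on the data -/

/-- The stochastic model assumption with constant `ηbar` on the open convex set `V ⊇ dom r`.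
The first half of `model` says in particular that `f(·; s)` is finite on `V`. -/
structure ModelAssumption [MeasurableSpace S] (P : Measure S) (f : S → Vec d → EReal)
    (r : Vec d → EReal) (g : Vec d → Vec d → S → ℝ) (V : Set (Vec d)) (ηbar : ℝ) : Prop where
  isOpen : IsOpen V
  convex : Convex ℝ V
  dom_subset : {y | r y ≠ ⊤} ⊆ V
  measurable : Measurable fun p : V × V × S => g p.1 p.2.1 p.2.2
  model : ∀ᵐ s ∂P, ∀ x ∈ V, f s x = (g x x s : EReal) ∧
    ∀ y ∈ V, |g x y s - (f s y).toReal| ≤ ηbar / 2 * ‖y - x‖ ^ 2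

/-- Regularity of `F`, `r`, `f(·; s)` and `τbar`-weak convexity of the composite models.
The fields `finite` and `integrable` say that `F` is a well-defined real-valued function. -/
structure CompositeAssumption [MeasurableSpace S] (P : Measure S) (f : S → Vec d → EReal)
    (r : Vec d → EReal) (g : Vec d → Vec d → S → ℝ) (V : Set (Vec d)) (τbar : ℝ) : Prop where
  finite : ∀ y, ∀ᵐ s ∂P, f s y ≠ ⊤
  integrable : ∀ y, Integrable (fun s => (f s y).toReal) P
  locallyLipschitz : LocallyLipschitz (expectedLoss P f)
  r_proper : IsProper r
  r_closed : LowerSemicontinuous r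
  f_proper : ∀ᵐ s ∂P, IsProper (f s)
  f_closed : ∀ᵐ s ∂P, LowerSemicontinuous (f s)
  f_dom : ∀ᵐ s ∂P, {y | r y ≠ ⊤} ⊆ {y | f s y ≠ ⊤}
  τbar_nonneg : 0 ≤ τbar
  weaklyConvex : ∀ᵐ s ∂P, ∀ x ∈ V, IsWeaklyConvex τbar (compositeModel g r x s)

/-- `φ` is bounded from below and has bounded sublevel sets. -/
structure SublevelAssumption (φ : Vec d → EReal) : Prop where
  bddBelow : ∃ c : ℝ, ∀ y, (c : EReal) ≤ φ y
  bounded : ∀ t : ℝ, Bornology.IsBounded {y | φ y ≤ (t : EReal)}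

/-- The local Lipschitz condition on the composite models with continuous growth function `G`:
`|φ_x(y; s) - φ_x(z; s)| ≤ L(s) G(max{‖x‖, ‖y‖}) ‖y - z‖` for `z` near `y`, where
`√(E[L(s)²]) ≤ Lφ`. The absolute value is written as two inequalities in `(-∞, +∞]`. -/
structure GrowthAssumption [MeasurableSpace S] (P : Measure S) (r : Vec d → EReal)
    (g : Vec d → Vec d → S → ℝ) (V : Set (Vec d)) (G : ℝ≥0 → ℝ≥0) (L : S → ℝ≥0) (Lφ : ℝ) :
    Prop where
  continuous : Continuous G
  monotone : Monotone G
  measurable : Measurable L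
  integrable : Integrable (fun s => (L s : ℝ) ^ 2) P
  bound : √(∫ s, (L s : ℝ) ^ 2 ∂P) ≤ Lφ
  lipschitz : ∀ᵐ s ∂P, ∀ x ∈ V, ∀ y ∈ V, ∀ᶠ z in 𝓝 y,
    compositeModel g r x s y ≤ compositeModel g r x s z
        + (((L s : ℝ) * (G (max ‖x‖₊ ‖y‖₊) : ℝ) * ‖y - z‖ : ℝ) : EReal) ∧
    compositeModel g r x s z ≤ compositeModel g r x s y
        + (((L s : ℝ) * (G (max ‖x‖₊ ‖y‖₊) : ℝ) * ‖y - z‖ : ℝ) : EReal)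

/-! ### Sampling, preconditioners and the algorithm

Iterations are numbered from `1`; `samp k i` is the `i`-th sample of the `k`-th minibatch. -/

/-- The minibatches `k = 1, 2, …` consist of i.i.d. samples from `P`. -/
structure IIDSampling [MeasurableSpace S] [MeasurableSpace Ω] (P : Measure S) (Pr : Measure Ω)
    {m : ℕ} (samp : ℕ → Fin m → Ω → S) : Prop where
  measurable : ∀ k, 1 ≤ k → ∀ i, Measurable (samp k i)
  law : ∀ k, 1 ≤ k → ∀ i, Pr.map (samp k i) = P
  indep : iIndepFun (fun p : ℕ × Fin m => samp (p.1 + 1) p.2) Pr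

/-- The σ-algebra generated by the minibatches `1, …, k` (trivial for `k = 0`). -/
@[reducible] def sampleSigma [MeasurableSpace S] {m : ℕ} (samp : ℕ → Fin m → Ω → S) (k : ℕ) :
    MeasurableSpace Ω :=
  ⨆ j ∈ Finset.Icc 1 k, ⨆ i : Fin m, MeasurableSpace.comap (samp j i) inferInstance

/-- The assumption on the (possibly random) preconditioners `M₁, M₂, …`, with `M₀ = I`: `Mₖ` may
depend on the first `k` minibatches; `Mₖ`-norms are equivalent to the Euclidean norm with constants
controlled by `μinf` and `Linf`; consecutive norms are comparable in conditional expectation with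
factors `ρₖ ≥ 1` whose infinite product converges. -/
structure PrecondAssumption [MeasurableSpace S] [MeasurableSpace Ω] (Pr : Measure Ω) {m : ℕ}
    (samp : ℕ → Fin m → Ω → S) (M : ℕ → Ω → Vec d →L[ℝ] Vec d)
    (ρ : ℕ → ℝ) (μinf Linf : ℝ) : Prop where
  μinf_mem : μinf ∈ Set.Ioc (0 : ℝ) 1
  Linf_ge : 1 ≤ Linf
  M_zero : ∀ ω, M 0 ω = ContinuousLinearMap.id ℝ (Vec d)
  ρ_zero : ρ 0 = 1
  adapted : ∀ k, 1 ≤ k → ∀ v, Measurable[sampleSigma samp k] fun ω => M k ω v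
  precond : ∀ k, 1 ≤ k → ∀ᵐ ω ∂Pr, IsPrecond (M k ω)
  norm_equiv : ∃ μ L : ℕ → ℝ, ∀ k, 1 ≤ k → μinf ≤ μ k ∧ 0 < L k ∧ L k ≤ Linf ∧
    ∀ᵐ ω ∂Pr, ∀ v, μ k * normM (M k ω) v ≤ ‖v‖ ∧ ‖v‖ ≤ L k * normM (M k ω) v
  ratio : ∀ k (v : Vec d), v ≠ 0 → ∀ᵐ ω ∂Pr,
    ((ρ (k + 1)) ^ 2)⁻¹ ≤
      (Pr[fun ω' => normM (M (k + 1) ω') v ^ 2 / normM (M k ω') v ^ 2 | sampleSigma samp k]) ω ∧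
    (Pr[fun ω' => normM (M (k + 1) ω') v ^ 2 / normM (M k ω') v ^ 2 | sampleSigma samp k]) ω
      ≤ (ρ (k + 1)) ^ 2
  ρ_ge : ∀ k, 1 ≤ ρ k
  prod_tendsto : ∃ νinf : ℝ, Tendsto (fun k => ∏ i ∈ Finset.range k, ρ i) atTop (𝓝 νinf)

/-- `x'` approximately minimizes `Φ` with accuracy `ε` in the sense of the first stopping criterion:
its `M`-distance to a minimizer of `Φ` is at most `ε`. -/
def CriterionA (Φ : Vec d → EReal) (M : Vec d →L[ℝ] Vec d) (ε : ℝ) (x' : Vec d) : Prop :=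
  ∃ xt, IsMinOn Φ Set.univ xt ∧ normM M (x' - xt) ≤ ε

/-- Second stopping criterion, on the gap to the minimal value. -/
def CriterionB (Φ : Vec d → EReal) (τ α ε : ℝ) (x' : Vec d) : Prop :=
  Φ x' ≤ (⨅ y, Φ y) + (((1 - τ * α) / (2 * α) * ε ^ 2 : ℝ) : EReal)

/-- Third stopping criterion, on the distance of `0` to the subdifferential in the `M⁻¹`-norm. -/
def CriterionC (Φ : Vec d → EReal) (M : Vec d →L[ℝ] Vec d) (τ α ε : ℝ) (x' : Vec d) : Prop :=
  distZero M.inverse (regularSubdiff Φ x') ≤ ENNReal.ofReal ((1 - τ * α) / α * ε)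

/-- The iterates `x₁, x₂, …` are generated by the model-based inexact stochastic preconditioned
proximal point algorithm with stepsizes `α` and accuracies `ε`: the initial point is deterministic,
`xₖ₊₁` is determined by the first `k` minibatches, the iterates lie in the set `V` on which the
models are defined, and each step satisfies one of the three stopping criteria. -/
structure IsIspPPA [MeasurableSpace S] [MeasurableSpace Ω] (Pr : Measure Ω) {m : ℕ}
    (samp : ℕ → Fin m → Ω → S) (g : Vec d → Vec d → S → ℝ) (r : Vec d → EReal)
    (V : Set (Vec d)) (M : ℕ → Ω → Vec d →L[ℝ] Vec d) (τ : ℝ) (α ε : ℕ → Ω → ℝ)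
    (x : ℕ → Ω → Vec d) : Prop where
  init : ∃ x₁ : Vec d, ∀ ω, x 1 ω = x₁
  adapted : ∀ k, 1 ≤ k → Measurable[sampleSigma samp k] (x (k + 1))
  mem : ∀ k, 1 ≤ k → ∀ᵐ ω ∂Pr, x k ω ∈ V
  step : ∀ k, 1 ≤ k → ∀ᵐ ω ∂Pr,
    let Φ := subproblem g r (M k ω) (α k ω) (x k ω) (fun i => samp k i ω)
    CriterionA Φ (M k ω) (ε k ω) (x (k + 1) ω) ∨
    CriterionB Φ τ (α k ω) (ε k ω) (x (k + 1) ω) ∨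
    CriterionC Φ (M k ω) τ (α k ω) (ε k ω) (x (k + 1) ω)

end

end IspPPA

namespace IspPPA

set_option linter.unusedSectionVars false

/-! ### The norm of a preconditioner -/

section Geometry

variable {d : ℕ} {M : Vec d →L[ℝ] Vec d}

/-! The Moreau envelope of `φ` with parameter `ρbar⁻¹` is a Lyapunov function for the iteration.
Write `e n` for its value at `x (n + 1)` in the norm of `M n`; both the point and the norm are known
after `n` minibatches.

The growth condition makes finiteness of `r` locally constant on the connected set `V`, so `dom r =
V` (`dom_eq`). Hence `φ` is a finite, continuous, `(ηbar + τbar)`-weakly convex function on the open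
convex set `V`, and the subproblems are strongly convex there. Their minimizers are not needed
inside `V`: a limit of a minimizing sequence already has the quadratic growth of a minimizer
(`exists_minLimit`), and each stopping criterion bounds the distance of the new iterate to it
(`normM_sub_le_of_criterion`).

For fixed samples, quadratic growth around that limit bounds the squared distance of the new iterate
to any `z ∈ V` by the old distance, a multiple of the increment of the model between the old iterate
and `z`, and errors of second order in the step size (`one_step`). Conditional expectation replaces
the increment by `φ z - φ x` up to `ηbar / 2 * ‖z - x‖ ^ 2`, and the new norm by the old one up to
`ρ ^ 2` (`condExp_step`). Choosing `z` almost optimal for the old envelope gives (`condExp_env_le`)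
`E[e (n+1) | n] ≤ e n + β n * (e n - c) - ρbar * a n * (φ (x (n+1)) - e n) + c n`, where `a n` is
the step size, `c` a lower bound of `φ`, and `β n`, `c n` are summable. The lower bound on `ρbar` is
what makes the quadratic terms combine to at most `ρ ^ 2` times the old ones. Since `z` depends on
the outcome, the estimate is proved for all `z` in a countable dense subset of `V` at once, and no
measurable selection is made.

The Robbins–Siegmund theorem then bounds `e n` and makes the weighted gaps summable. A bounded
envelope and bounded sublevel sets of `φ` bound the iterates, hence keep the step sizes above a
multiple of `αbar`. The squared gradient of the envelope is at most a constant times the gap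
(`gradient_sq_le`), so a gradient bounded away from zero would make `αbar` summable. -/

lemma IsPrecond.inner_nonneg (hM : IsPrecond M) (v : Vec d) : 0 ≤ ⟪v, M v⟫ := by
  by_cases h : v = 0
  · simp [h]
  · exact (hM.2 v h).le

lemma IsPrecond.normM_sq (hM : IsPrecond M) (v : Vec d) : normM M v ^ 2 = ⟪v, M v⟫ :=
  Real.sq_sqrt (hM.inner_nonneg v)

lemma normM_nonneg (M : Vec d →L[ℝ] Vec d) (v : Vec d) : 0 ≤ normM M v := Real.sqrt_nonneg _

lemma IsPrecond.inner_symm (hM : IsPrecond M) (u v : Vec d) : ⟪u, M v⟫ = ⟪v, M u⟫ := by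
  have h := ContinuousLinearMap.isSelfAdjoint_iff_isSymmetric.mp hM.1
  rw [real_inner_comm]
  exact h v u

lemma isPrecond_id : IsPrecond (ContinuousLinearMap.id ℝ (Vec d)) := by
  refine ⟨?_, fun v hv => ?_⟩
  · rw [ContinuousLinearMap.isSelfAdjoint_iff_isSymmetric]
    intro u v
    rfl
  · rw [ContinuousLinearMap.id_apply, real_inner_self_eq_norm_sq]
    positivity

lemma normM_id (v : Vec d) : normM (ContinuousLinearMap.id ℝ (Vec d)) v = ‖v‖ := by
  simp [normM]

lemma continuous_normM (M : Vec d →L[ℝ] Vec d) : Continuous (normM M) := by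
  unfold normM
  fun_prop

lemma IsPrecond.normM_sq_add (hM : IsPrecond M) (u v : Vec d) :
    normM M (u + v) ^ 2 = normM M u ^ 2 + 2 * ⟪u, M v⟫ + normM M v ^ 2 := by
  simp only [hM.normM_sq, map_add, inner_add_left, inner_add_right]
  rw [hM.inner_symm v u]
  ring

lemma IsPrecond.normM_sq_sub (hM : IsPrecond M) (u v : Vec d) :
    normM M (u - v) ^ 2 = normM M u ^ 2 - 2 * ⟪u, M v⟫ + normM M v ^ 2 := by
  simp only [hM.normM_sq, map_sub, inner_sub_left, inner_sub_right]
  rw [hM.inner_symm v u]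
  ring

lemma IsPrecond.normM_sq_smul (hM : IsPrecond M) (t : ℝ) (v : Vec d) :
    normM M (t • v) ^ 2 = t ^ 2 * normM M v ^ 2 := by
  simp only [hM.normM_sq, map_smul, inner_smul_left, inner_smul_right]
  simp
  ring

lemma normM_sub_comm (M : Vec d →L[ℝ] Vec d) (u v : Vec d) :
    normM M (u - v) = normM M (v - u) := by
  unfold normM
  rw [← neg_sub v u, map_neg, inner_neg_neg]

/-- The last term is the gain in convexity from a quadratic; it makes a weakly convex function
strongly convex. -/
lemma IsPrecond.normM_sq_convex (hM : IsPrecond M) (x y z : Vec d) {a b : ℝ} (hab : a + b = 1) :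
    normM M (a • y + b • z - x) ^ 2 =
      a * normM M (y - x) ^ 2 + b * normM M (z - x) ^ 2 - a * b * normM M (y - z) ^ 2 := by
  have h1 : a • y + b • z - x = a • (y - x) + b • (z - x) := by
    have : x = (a + b) • x := by rw [hab, one_smul]
    nth_rewrite 1 [this]
    module
  have h2 : y - z = (y - x) - (z - x) := by abel
  rw [h1, h2, hM.normM_sq_add, hM.normM_sq_sub (y - x), hM.normM_sq_smul, hM.normM_sq_smul, map_smul,
    inner_smul_left, inner_smul_right]
  obtain rfl : b = 1 - a := by linarith
  simp
  ring

/-- Cauchy–Schwarz for the form of `M`, by expanding the square of `‖v‖_M² u - ⟪u, M v⟫ v`. -/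
lemma IsPrecond.inner_le (hM : IsPrecond M) (u v : Vec d) :
    ⟪u, M v⟫ ≤ normM M u * normM M v := by
  by_cases hv : v = 0
  · simp only [hv, map_zero, inner_zero_right]
    exact mul_nonneg (normM_nonneg _ _) (normM_nonneg _ _)
  have hpos : 0 < normM M v ^ 2 := by rw [hM.normM_sq]; exact hM.2 v hv
  have h := sq_nonneg (normM M (normM M v ^ 2 • u - ⟪u, M v⟫ • v))
  rw [hM.normM_sq_sub, hM.normM_sq_smul, hM.normM_sq_smul, map_smul, inner_smul_left,
    inner_smul_right] at h
  simp only [conj_trivial] at h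
  have h3 : 0 ≤ normM M v ^ 2 * (normM M v ^ 2 * normM M u ^ 2 - ⟪u, M v⟫ ^ 2) := by
    nlinarith [h]
  have h4 : ⟪u, M v⟫ ^ 2 ≤ (normM M u * normM M v) ^ 2 := by
    have := nonneg_of_mul_nonneg_right h3 hpos
    nlinarith
  exact le_of_sq_le_sq h4 (mul_nonneg (normM_nonneg _ _) (normM_nonneg _ _))
where
  le_of_sq_le_sq {a b : ℝ} (h : a ^ 2 ≤ b ^ 2) (hb : 0 ≤ b) : a ≤ b := abs_le_of_sq_le_sq' h hb |>.2

/-- Young's inequality, from the square of `θ u - v`. It is applied with `θ` equal to the square of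
the step bound, so that `1 + θ` is a summable perturbation of `1`. -/
lemma IsPrecond.normM_sq_add_le (hM : IsPrecond M) (u v : Vec d) {θ : ℝ} (hθ : 0 < θ) :
    normM M (u + v) ^ 2 ≤ (1 + θ) * normM M u ^ 2 + (1 + θ⁻¹) * normM M v ^ 2 := by
  have h := sq_nonneg (normM M (θ • u - v))
  rw [hM.normM_sq_sub, hM.normM_sq_smul, inner_smul_left] at h
  simp only [conj_trivial] at h
  rw [hM.normM_sq_add]
  have h2 : 2 * ⟪u, M v⟫ ≤ θ * normM M u ^ 2 + θ⁻¹ * normM M v ^ 2 := by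
    have h3 := mul_nonneg (inv_nonneg.mpr hθ.le) h
    have h4 : θ⁻¹ * (θ ^ 2 * normM M u ^ 2 - 2 * (θ * ⟪u, M v⟫) + normM M v ^ 2) =
        θ * normM M u ^ 2 - 2 * ⟪u, M v⟫ + θ⁻¹ * normM M v ^ 2 := by
      field_simp
    rw [h4] at h3
    linarith
  linarith

lemma IsPrecond.injective (hM : IsPrecond M) : Function.Injective M := by
  rw [injective_iff_map_eq_zero]
  intro v hv
  by_contra h
  have := hM.2 v h
  simp [hv] at this

/-- Definiteness gives injectivity, and in finite dimension injectivity gives invertibility, so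
`M.inverse` is not the default value here. -/
lemma IsPrecond.apply_inverse (hM : IsPrecond M) (v : Vec d) : M (M.inverse v) = v := by
  let e : Vec d ≃L[ℝ] Vec d :=
    (LinearEquiv.ofInjectiveEndo (M : Vec d →ₗ[ℝ] Vec d) hM.injective).toContinuousLinearEquiv
  have he : (e : Vec d →L[ℝ] Vec d) = M := by ext; rfl
  rw [← he, ContinuousLinearMap.inverse_equiv]
  simp

lemma IsPrecond.inner_le_inverse (hM : IsPrecond M) (v u : Vec d) :
    ⟪v, u⟫ ≤ normM M.inverse v * normM M u := by
  have h1 : ⟪v, u⟫ = ⟪M.inverse v, M u⟫ := by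
    rw [hM.inner_symm, hM.apply_inverse, real_inner_comm]
  have h2 : normM M.inverse v = normM M (M.inverse v) := by
    unfold normM
    rw [hM.apply_inverse, real_inner_comm]
  rw [h1, h2]
  exact hM.inner_le _ _

/-- If `c ‖v‖_M ≤ ‖v‖`, then `‖M v‖ ≤ c⁻¹ ‖v‖_M`. -/
lemma IsPrecond.norm_apply_le (hM : IsPrecond M) {c : ℝ} (hc : 0 < c)
    (h : ∀ v, c * normM M v ≤ ‖v‖) (v : Vec d) : ‖M v‖ ≤ c⁻¹ * normM M v := by
  by_cases h0 : ‖M v‖ = 0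
  · rw [h0]
    exact mul_nonneg (inv_nonneg.mpr hc.le) (normM_nonneg _ _)
  have hpos : 0 < ‖M v‖ := lt_of_le_of_ne (norm_nonneg _) (Ne.symm h0)
  have h1 : ‖M v‖ * ‖M v‖ ≤ normM M (M v) * normM M v := by
    rw [← real_inner_self_eq_norm_mul_norm]
    exact hM.inner_le _ _
  have h2 : normM M (M v) ≤ c⁻¹ * ‖M v‖ := by
    rw [le_inv_mul_iff₀ hc]
    exact h _
  have h3 : ‖M v‖ * ‖M v‖ ≤ ‖M v‖ * (c⁻¹ * normM M v) :=
    calc _ ≤ _ := h1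
      _ ≤ (c⁻¹ * ‖M v‖) * normM M v := by gcongr; exact normM_nonneg _ _
      _ = _ := by ring
  exact le_of_mul_le_mul_left h3 hpos

/-! ### Strongly convex functions on a convex set -/

/-- Weak convexity of a real-valued function on `V`, in the form of an inequality. -/
def WeakOn (V : Set (Vec d)) (c : ℝ) (h : Vec d → ℝ) : Prop :=
  ∀ y ∈ V, ∀ z ∈ V, ∀ a b : ℝ, 0 ≤ a → 0 ≤ b → a + b = 1 →
    h (a • y + b • z) ≤ a * h y + b * h z + c / 2 * (a * b) * ‖y - z‖ ^ 2

/-- Strong convexity of a real-valued function on `V` with respect to the norm of `M`. -/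
def StrongOn (V : Set (Vec d)) (M : Vec d →L[ℝ] Vec d) (κ : ℝ) (h : Vec d → ℝ) : Prop :=
  ∀ y ∈ V, ∀ z ∈ V, ∀ a b : ℝ, 0 ≤ a → 0 ≤ b → a + b = 1 →
    h (a • y + b • z) ≤ a * h y + b * h z - κ / 2 * (a * b) * normM M (y - z) ^ 2

/-- Weak convexity is measured in the Euclidean norm, the added quadratic in that of `M`; passing
from one to the other costs `Λ ^ 2`. -/
lemma WeakOn.add_quad {V : Set (Vec d)} {c : ℝ} {h : Vec d → ℝ} (hh : WeakOn V c h) (hc : 0 ≤ c)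
    (hM : IsPrecond M) {Λ : ℝ} (hΛ : ∀ v, ‖v‖ ≤ Λ * normM M v) (β : ℝ) (x : Vec d) :
    StrongOn V M (β - Λ ^ 2 * c) fun y => h y + β / 2 * normM M (y - x) ^ 2 := by
  intro y hy z hz a b ha hb hab
  have h1 := hh y hy z hz a b ha hb hab
  have h2 : ‖y - z‖ ^ 2 ≤ Λ ^ 2 * normM M (y - z) ^ 2 := by
    rw [← mul_pow]
    exact pow_le_pow_left₀ (norm_nonneg _) (hΛ _) 2
  have h3 := mul_le_mul_of_nonneg_left h2 (by positivity : 0 ≤ c / 2 * (a * b))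
  beta_reduce
  rw [hM.normM_sq_convex x y z hab]
  linarith

/-- Move from `x` by a fraction `t` towards `y`, where the local bound applies, divide by `t` and
let `t → 0`: weak convexity turns a slope bound near `x` into a global minorant. -/
lemma WeakOn.ge_of_local_ge {V : Set (Vec d)} {c : ℝ} {h : Vec d → ℝ} (hh : WeakOn V c h)
    {x y : Vec d} (hx : x ∈ V) (hy : y ∈ V) {K : ℝ}
    (hK : ∀ᶠ z in 𝓝 x, h x ≤ h z + K * ‖x - z‖) :
    h x - K * ‖y - x‖ - c / 2 * ‖y - x‖ ^ 2 ≤ h y := by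
  have ht : Tendsto (fun t : ℝ => (1 - t) • x + t • y) (𝓝[>] 0) (𝓝 x) := by
    have : Continuous fun t : ℝ => (1 - t) • x + t • y := by fun_prop
    have h0 := this.tendsto 0
    simp only [sub_zero, one_smul, zero_smul, add_zero] at h0
    exact h0.mono_left nhdsWithin_le_nhds
  have hev : ∀ᶠ t : ℝ in 𝓝[>] 0,
      h x - K * ‖y - x‖ - c / 2 * (1 - t) * ‖y - x‖ ^ 2 ≤ h y := by
    filter_upwards [ht.eventually hK, self_mem_nhdsWithin,
      nhdsWithin_le_nhds (Iio_mem_nhds (zero_lt_one (α := ℝ)))] with t h1 h2 h3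
    have h2' : 0 < t := h2
    have h3' : t < 1 := h3
    have h4 := hh x hx y hy (1 - t) t (by linarith) h2'.le (by ring)
    have h5 : ‖x - ((1 - t) • x + t • y)‖ = t * ‖y - x‖ := by
      rw [show x - ((1 - t) • x + t • y) = t • (x - y) by module, norm_smul, Real.norm_eq_abs,
        abs_of_pos h2', norm_sub_rev]
    rw [h5] at h1
    rw [norm_sub_rev x y] at h4
    have h6 : t * (h x - K * ‖y - x‖ - c / 2 * (1 - t) * ‖y - x‖ ^ 2) ≤ t * h y := by nlinarith
    exact le_of_mul_le_mul_left h6 h2'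
  have hl : Tendsto (fun t : ℝ => h x - K * ‖y - x‖ - c / 2 * (1 - t) * ‖y - x‖ ^ 2) (𝓝[>] 0)
      (𝓝 (h x - K * ‖y - x‖ - c / 2 * ‖y - x‖ ^ 2)) := by
    have : Continuous fun t : ℝ => h x - K * ‖y - x‖ - c / 2 * (1 - t) * ‖y - x‖ ^ 2 := by
      fun_prop
    have h0 := this.tendsto 0
    simp only [sub_zero, mul_one] at h0
    exact h0.mono_left nhdsWithin_le_nhds
  exact le_of_tendsto hl hev

/-- A limit of a minimizing sequence of a strongly convex function (which need not lie in `V`)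
together with the resulting quadratic growth of the function. -/
structure MinLimit (V : Set (Vec d)) (M : Vec d →L[ℝ] Vec d) (κ : ℝ) (h : Vec d → ℝ)
    (w : ℕ → Vec d) (p : Vec d) (I : ℝ) : Prop where
  mem : ∀ n, w n ∈ V
  tendsto : Tendsto w atTop (𝓝 p)
  tendsto_val : Tendsto (fun n => h (w n)) atTop (𝓝 I)
  growth : ∀ y ∈ V, I + κ / 2 * normM M (y - p) ^ 2 ≤ h y

/-- Strong convexity at midpoints makes every minimizing sequence Cauchy. Its limit may fall outside
`V`, so the growth is not derived at the limit but along the sequence. -/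
theorem exists_minLimit {V : Set (Vec d)} (hV : Convex ℝ V) (hne : V.Nonempty)
    {Λ : ℝ} (hΛ : ∀ v, ‖v‖ ≤ Λ * normM M v) {κ : ℝ} (hκ : 0 < κ)
    {h : Vec d → ℝ} (hh : StrongOn V M κ h) (hb : ∃ c, ∀ y ∈ V, c ≤ h y) :
    ∃ w p, MinLimit V M κ h w p (sInf (h '' V)) := by
  set I := sInf (h '' V) with hI
  have hbdd : BddBelow (h '' V) := by
    obtain ⟨c, hc⟩ := hb
    refine ⟨c, ?_⟩
    rintro _ ⟨y, hy, rfl⟩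
    exact hc y hy
  have hIle : ∀ y ∈ V, I ≤ h y := fun y hy => csInf_le hbdd ⟨y, hy, rfl⟩
  obtain ⟨u, -, hu, hmem⟩ := exists_seq_tendsto_sInf (hne.image h) hbdd
  choose w hwV hwu using hmem
  have hval : Tendsto (fun n => h (w n)) atTop (𝓝 I) := by simpa [hwu] using hu
  have hpair : ∀ m n, κ / 4 * normM M (w m - w n) ^ 2 ≤ (h (w m) - I) + (h (w n) - I) := by
    intro m n
    have h1 := hh _ (hwV m) _ (hwV n) (1 / 2) (1 / 2) (by norm_num) (by norm_num) (by norm_num)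
    have h2 := hIle _ (hV (hwV m) (hwV n) (by norm_num : (0 : ℝ) ≤ 1 / 2)
      (by norm_num : (0 : ℝ) ≤ 1 / 2) (by norm_num))
    linarith
  have hcauchy : CauchySeq w := by
    rw [Metric.cauchySeq_iff']
    intro δ hδ
    have hΛpos : 0 < Λ ^ 2 + 1 := by positivity
    -- Two gaps of size `κ / 8` match the `κ / 4` in `hpair`; the `1` in `Λ ^ 2 + 1` only avoids a
    -- zero denominator.
    have hev : ∀ᶠ n in atTop, h (w n) - I < κ / 8 * (δ ^ 2 / (Λ ^ 2 + 1)) := by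
      have h0 : Tendsto (fun n => h (w n) - I) atTop (𝓝 0) := by
        simpa using hval.sub_const I
      exact h0.eventually (Iio_mem_nhds (by positivity))
    obtain ⟨N, hN⟩ := hev.exists_forall_of_atTop
    refine ⟨N, fun n hn => ?_⟩
    have h1 := hpair n N
    have h2 := hN n hn
    have h3 := hN N le_rfl
    have h4 : normM M (w n - w N) ^ 2 < δ ^ 2 / (Λ ^ 2 + 1) := by nlinarith
    have h5 : ‖w n - w N‖ ^ 2 ≤ Λ ^ 2 * normM M (w n - w N) ^ 2 := by
      rw [← mul_pow]
      exact pow_le_pow_left₀ (norm_nonneg _) (hΛ _) 2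
    have h6 : ‖w n - w N‖ ^ 2 < δ ^ 2 := by
      rw [lt_div_iff₀ hΛpos] at h4
      nlinarith [sq_nonneg (normM M (w n - w N))]
    rw [dist_eq_norm]
    exact lt_of_pow_lt_pow_left₀ 2 hδ.le h6
  obtain ⟨p, hp⟩ := cauchySeq_tendsto_of_complete hcauchy
  refine ⟨w, p, hwV, hp, hval, fun y hy => ?_⟩
  have hnorm : Tendsto (fun n => normM M (y - w n) ^ 2) atTop (𝓝 (normM M (y - p) ^ 2)) :=
    (((continuous_normM M).tendsto _).comp (tendsto_const_nhds.sub hp)).pow 2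
  -- Strong convexity between `y` and `w n`, with `n → ∞` first and `t → 0` afterwards.
  have hpt : ∀ t : ℝ, 0 < t → t < 1 → I + κ / 2 * (1 - t) * normM M (y - p) ^ 2 ≤ h y := by
    intro t ht0 ht1
    have h1 : ∀ n, I ≤ t * h y + (1 - t) * h (w n)
        - κ / 2 * (t * (1 - t)) * normM M (y - w n) ^ 2 := fun n =>
      (hIle _ (hV hy (hwV n) ht0.le (by linarith) (by ring))).trans
        (hh y hy _ (hwV n) t (1 - t) ht0.le (by linarith) (by ring))
    have h2 : Tendsto (fun n => t * h y + (1 - t) * h (w n)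
        - κ / 2 * (t * (1 - t)) * normM M (y - w n) ^ 2) atTop
        (𝓝 (t * h y + (1 - t) * I - κ / 2 * (t * (1 - t)) * normM M (y - p) ^ 2)) :=
      (tendsto_const_nhds.add (hval.const_mul _)).sub (hnorm.const_mul _)
    have h3 := ge_of_tendsto' h2 h1
    have h4 : t * (I + κ / 2 * (1 - t) * normM M (y - p) ^ 2) ≤ t * h y := by nlinarith
    exact le_of_mul_le_mul_left h4 ht0
  have hl : Tendsto (fun t : ℝ => I + κ / 2 * (1 - t) * normM M (y - p) ^ 2) (𝓝[>] 0)
      (𝓝 (I + κ / 2 * normM M (y - p) ^ 2)) := by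
    have : Continuous fun t : ℝ => I + κ / 2 * (1 - t) * normM M (y - p) ^ 2 := by fun_prop
    have h0 := this.tendsto 0
    simp only [sub_zero, mul_one] at h0
    exact h0.mono_left nhdsWithin_le_nhds
  refine le_of_tendsto hl ?_
  filter_upwards [self_mem_nhdsWithin,
    nhdsWithin_le_nhds (Iio_mem_nhds (zero_lt_one (α := ℝ)))] with t h2 h3
  exact hpt t h2 h3

lemma MinLimit.le {V : Set (Vec d)} {κ : ℝ} {h : Vec d → ℝ} {w : ℕ → Vec d} {p : Vec d} {I : ℝ}
    (hw : MinLimit V M κ h w p I) (hκ : 0 ≤ κ) {y : Vec d} (hy : y ∈ V) : I ≤ h y := by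
  have h1 := hw.growth y hy
  have h2 := mul_nonneg (by positivity : 0 ≤ κ / 2) (sq_nonneg (normM M (y - p)))
  linarith

/-- A regular subgradient of a strongly convex function is a global one. -/
lemma StrongOn.subgradient_ineq {V : Set (Vec d)} {κ : ℝ} {h : Vec d → ℝ} (hh : StrongOn V M κ h)
    {x v : Vec d} (hx : x ∈ V)
    (hv : ∀ δ : ℝ, 0 < δ → ∀ᶠ z in 𝓝 x, z ∈ V → h x + (⟪v, z - x⟫ - δ * ‖z - x‖) ≤ h z)
    (hV : Convex ℝ V) {y : Vec d} (hy : y ∈ V) :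
    h x + ⟪v, y - x⟫ + κ / 2 * normM M (x - y) ^ 2 ≤ h y := by
  have ht : Tendsto (fun t : ℝ => (1 - t) • x + t • y) (𝓝[>] 0) (𝓝 x) := by
    have : Continuous fun t : ℝ => (1 - t) • x + t • y := by fun_prop
    have h0 := this.tendsto 0
    simp only [sub_zero, one_smul, zero_smul, add_zero] at h0
    exact h0.mono_left nhdsWithin_le_nhds
  have key : ∀ δ : ℝ, 0 < δ →
      h x + ⟪v, y - x⟫ - δ * ‖y - x‖ + κ / 2 * normM M (x - y) ^ 2 ≤ h y := by
    intro δ hδ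
    have hl : Tendsto (fun t : ℝ => h x + ⟪v, y - x⟫ - δ * ‖y - x‖
        + κ / 2 * (1 - t) * normM M (x - y) ^ 2) (𝓝[>] 0)
        (𝓝 (h x + ⟪v, y - x⟫ - δ * ‖y - x‖ + κ / 2 * normM M (x - y) ^ 2)) := by
      have : Continuous fun t : ℝ => h x + ⟪v, y - x⟫ - δ * ‖y - x‖
        + κ / 2 * (1 - t) * normM M (x - y) ^ 2 := by fun_prop
      have h0 := this.tendsto 0
      simp only [sub_zero, mul_one] at h0
      exact h0.mono_left nhdsWithin_le_nhds
    refine le_of_tendsto hl ?_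
    filter_upwards [ht.eventually (hv δ hδ), self_mem_nhdsWithin,
      nhdsWithin_le_nhds (Iio_mem_nhds (zero_lt_one (α := ℝ)))] with t h1 h2 h3
    have h2' : 0 < t := h2
    have h3' : t < 1 := h3
    have h1' := h1 (hV hx hy (by linarith) h2'.le (by ring))
    have h4 := hh x hx y hy (1 - t) t (by linarith) h2'.le (by ring)
    have h5 : (1 - t) • x + t • y - x = t • (y - x) := by module
    rw [h5, norm_smul, Real.norm_eq_abs, abs_of_pos h2', inner_smul_right] at h1'
    have h6 : t * (h x + ⟪v, y - x⟫ - δ * ‖y - x‖ + κ / 2 * (1 - t) * normM M (x - y) ^ 2)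
        ≤ t * h y := by nlinarith
    exact le_of_mul_le_mul_left h6 h2'
  have hl : Tendsto (fun δ : ℝ => h x + ⟪v, y - x⟫ - δ * ‖y - x‖ + κ / 2 * normM M (x - y) ^ 2)
      (𝓝[>] 0) (𝓝 (h x + ⟪v, y - x⟫ + κ / 2 * normM M (x - y) ^ 2)) := by
    have : Continuous fun δ : ℝ =>
        h x + ⟪v, y - x⟫ - δ * ‖y - x‖ + κ / 2 * normM M (x - y) ^ 2 := by fun_prop
    have h0 := this.tendsto 0
    simp only [sub_zero, zero_mul] at h0
    exact h0.mono_left nhdsWithin_le_nhds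
  refine le_of_tendsto hl ?_
  filter_upwards [self_mem_nhdsWithin] with δ hδ
  exact key δ hδ

end Geometry

/-! ### Extended-real-valued functions given by a real function on their domain -/

section Represents

variable {d : ℕ} {M : Vec d →L[ℝ] Vec d} {V : Set (Vec d)} {p : Vec d → EReal} {h : Vec d → ℝ}

/-- `p` is the real function `h` on `V`, extended by `+∞`. -/
structure Represents (V : Set (Vec d)) (h : Vec d → ℝ) (p : Vec d → EReal) : Prop where
  eq_coe : ∀ y ∈ V, p y = (h y : EReal)
  eq_top : ∀ y ∉ V, p y = ⊤

lemma Represents.add_coe (hp : Represents V h p) (u : Vec d → ℝ) :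
    Represents V (fun y => h y + u y) fun y => p y + (u y : EReal) where
  eq_coe y hy := by rw [hp.eq_coe y hy, EReal.coe_add]
  eq_top y hy := by rw [hp.eq_top y hy, EReal.top_add_coe]

lemma Represents.iInf_eq (hp : Represents V h p) (hne : V.Nonempty)
    (hb : ∃ c, ∀ y ∈ V, c ≤ h y) : ⨅ y, p y = ((sInf (h '' V) : ℝ) : EReal) := by
  have hbdd : BddBelow (h '' V) := by
    obtain ⟨c, hc⟩ := hb
    refine ⟨c, ?_⟩
    rintro _ ⟨y, hy, rfl⟩
    exact hc y hy
  apply le_antisymm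
  · refine EReal.le_of_forall_lt_iff_le.mp fun t ht => ?_
    have ht' : sInf (h '' V) < t := by exact_mod_cast ht
    obtain ⟨_, ⟨y, hy, rfl⟩, hyt⟩ := exists_lt_of_csInf_lt (hne.image h) ht'
    refine (iInf_le _ y).trans ?_
    rw [hp.eq_coe y hy]
    exact_mod_cast hyt.le
  · refine le_iInf fun y => ?_
    by_cases hy : y ∈ V
    · rw [hp.eq_coe y hy]
      exact_mod_cast csInf_le hbdd ⟨y, hy, rfl⟩
    · rw [hp.eq_top y hy]
      exact le_top

/-- Each of the three stopping criteria bounds the distance to the limit of a minimizing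
sequence. -/
theorem normM_sub_le_of_criterion (hV : Convex ℝ V) (hne : V.Nonempty) (hM : IsPrecond M)
    (hp : Represents V h p) {τ α ε : ℝ} (hα : 0 < α) (hτα : τ * α < 1) (hε : 0 ≤ ε)
    (hh : StrongOn V M ((1 - τ * α) / α) h) {w : ℕ → Vec d} {pt : Vec d}
    (hw : MinLimit V M ((1 - τ * α) / α) h w pt (sInf (h '' V))) {x' : Vec d}
    (hcrit : CriterionA p M ε x' ∨ CriterionB p τ α ε x' ∨ CriterionC p M τ α ε x') :
    normM M (x' - pt) ≤ ε := by
  have hκ : 0 < (1 - τ * α) / α := div_pos (by linarith) hα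
  set κ := (1 - τ * α) / α with hκdef
  have hinf := hp.iInf_eq hne ⟨_, fun y hy => hw.le hκ.le hy⟩
  rcases hcrit with ⟨xt, hmin, hxt⟩ | hB | hC
  · have h1 : p xt = ((sInf (h '' V) : ℝ) : EReal) := by
      rw [← hinf]
      exact le_antisymm (le_iInf fun y => hmin (Set.mem_univ y)) (iInf_le _ _)
    have hxtV : xt ∈ V := by
      by_contra hx
      rw [hp.eq_top _ hx] at h1
      exact EReal.coe_ne_top _ h1.symm
    rw [hp.eq_coe _ hxtV] at h1
    have h2 : h xt = sInf (h '' V) := by exact_mod_cast h1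
    -- An exact minimizer attains the infimum, so quadratic growth forces it to equal `pt`.
    have h3 := hw.growth xt hxtV
    have h4 : normM M (xt - pt) ^ 2 ≤ 0 := by
      by_contra h5
      push Not at h5
      have := mul_pos (half_pos hκ) h5
      linarith
    have h5 : xt - pt = 0 := by
      by_contra h6
      rw [hM.normM_sq] at h4
      exact absurd (hM.2 _ h6) (not_lt.mpr h4)
    rwa [← sub_eq_zero.mp h5]
  · unfold CriterionB at hB
    rw [hinf, ← EReal.coe_add] at hB
    have hxV : x' ∈ V := by
      by_contra hx
      rw [hp.eq_top _ hx] at hB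
      exact EReal.coe_ne_top _ (top_le_iff.mp hB)
    rw [hp.eq_coe _ hxV] at hB
    have hB' : h x' ≤ sInf (h '' V) + (1 - τ * α) / (2 * α) * ε ^ 2 := by exact_mod_cast hB
    have h3 := hw.growth x' hxV
    have h4 : (1 - τ * α) / (2 * α) = κ / 2 := by rw [hκdef]; field_simp
    rw [h4] at hB'
    have h5 : normM M (x' - pt) ^ 2 ≤ ε ^ 2 :=
      le_of_mul_le_mul_left (by linarith) (half_pos hκ)
    exact (abs_le_of_sq_le_sq' h5 hε).2
  · unfold CriterionC at hC
    -- The subgradient inequality, passed to the limit along `w n`, and the growth at `x'` each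
    -- contribute `κ / 2`; their sum bounds `κ ‖x' - pt‖_M²` by `⟪v, x' - pt⟫`, and the dual norm
    -- finishes.
    have key : ∀ v ∈ regularSubdiff p x', κ * normM M (x' - pt) ≤ normM M.inverse v := by
      rintro v ⟨hxtop, hv⟩
      have hxV : x' ∈ V := by
        by_contra hx
        exact hxtop (hp.eq_top _ hx)
      have hv' : ∀ δ : ℝ, 0 < δ →
          ∀ᶠ z in 𝓝 x', z ∈ V → h x' + (⟪v, z - x'⟫ - δ * ‖z - x'‖) ≤ h z := by
        intro δ hδ
        filter_upwards [hv δ hδ] with z hz hzV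
        rw [hp.eq_coe _ hxV, hp.eq_coe _ hzV] at hz
        exact_mod_cast hz
      have h1 : ∀ n, h x' + ⟪v, w n - x'⟫ + κ / 2 * normM M (x' - w n) ^ 2 ≤ h (w n) := fun n =>
        hh.subgradient_ineq hxV hv' hV (hw.mem n)
      have hc : Continuous fun u => h x' + ⟪v, u - x'⟫ + κ / 2 * normM M (x' - u) ^ 2 := by
        have := continuous_normM M
        fun_prop
      have h2 := le_of_tendsto_of_tendsto' ((hc.tendsto _).comp hw.tendsto) hw.tendsto_val h1
      have h3 := hw.growth x' hxV
      have h4 : ⟪v, x' - pt⟫ ≤ normM M.inverse v * normM M (x' - pt) := hM.inner_le_inverse _ _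
      have h5 : ⟪v, pt - x'⟫ = - ⟪v, x' - pt⟫ := by rw [← inner_neg_right, neg_sub]
      rw [h5] at h2
      have h6 : κ * normM M (x' - pt) * normM M (x' - pt) ≤
          normM M.inverse v * normM M (x' - pt) := by nlinarith
      rcases (normM_nonneg M (x' - pt)).eq_or_lt with h0 | h0
      · rw [← h0, mul_zero]
        exact normM_nonneg _ _
      · exact le_of_mul_le_mul_right h6 h0
    have h1 : ENNReal.ofReal (κ * normM M (x' - pt)) ≤ ENNReal.ofReal (κ * ε) := by
      refine le_trans ?_ hC
      exact le_iInf₂ fun v hv => ENNReal.ofReal_le_ofReal (key v hv)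
    rw [ENNReal.ofReal_le_ofReal_iff (by positivity)] at h1
    exact le_of_mul_le_mul_left h1 hκ

end Represents

/-! ### The Moreau envelope -/

section Moreau

variable {d : ℕ} {M : Vec d →L[ℝ] Vec d} {V : Set (Vec d)} {p : Vec d → EReal} {h : Vec d → ℝ}

/-- The Moreau envelope of a real function on `V`, with parameter `β⁻¹`. -/
noncomputable def envOn (V : Set (Vec d)) (M : Vec d →L[ℝ] Vec d) (β : ℝ) (h : Vec d → ℝ)
    (z : Vec d) : ℝ :=
  sInf ((fun y => h y + β / 2 * normM M (y - z) ^ 2) '' V)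

lemma moreauEnv_eq_envOn (hp : Represents V h p) (hne : V.Nonempty)
    (hb : ∃ c, ∀ y ∈ V, c ≤ h y) {β : ℝ} (hβ : 0 < β) (z : Vec d) :
    moreauEnv M β⁻¹ p z = (envOn V M β h z : EReal) := by
  have h1 : 1 / (2 * β⁻¹) = β / 2 := by field_simp
  unfold moreauEnv
  rw [h1]
  refine (hp.add_coe fun y => β / 2 * normM M (y - z) ^ 2).iInf_eq hne ?_
  obtain ⟨c, hc⟩ := hb
  refine ⟨c, fun y hy => ?_⟩
  have := hc y hy
  have : 0 ≤ β / 2 * normM M (y - z) ^ 2 := by positivity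
  linarith

lemma bddBelow_envOn (hb : ∃ c, ∀ y ∈ V, c ≤ h y) {β : ℝ} (hβ : 0 < β) (z : Vec d) :
    BddBelow ((fun y => h y + β / 2 * normM M (y - z) ^ 2) '' V) := by
  obtain ⟨c, hc⟩ := hb
  refine ⟨c, ?_⟩
  rintro _ ⟨y, hy, rfl⟩
  have := hc y hy
  have : 0 ≤ β / 2 * normM M (y - z) ^ 2 := by positivity
  beta_reduce
  linarith

lemma envOn_le (hb : ∃ c, ∀ y ∈ V, c ≤ h y) {β : ℝ} (hβ : 0 < β) {y : Vec d} (hy : y ∈ V)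
    (z : Vec d) : envOn V M β h z ≤ h y + β / 2 * normM M (y - z) ^ 2 :=
  csInf_le (bddBelow_envOn hb hβ z) ⟨y, hy, rfl⟩

lemma le_envOn (hne : V.Nonempty) {c : ℝ} (hb : ∀ y ∈ V, c ≤ h y) {β : ℝ} (hβ : 0 < β)
    (z : Vec d) : c ≤ envOn V M β h z := by
  refine le_csInf (hne.image _) ?_
  rintro _ ⟨y, hy, rfl⟩
  have := hb y hy
  have : 0 ≤ β / 2 * normM M (y - z) ^ 2 := by positivity
  beta_reduce
  linarith

lemma exists_minLimit_envOn (hV : Convex ℝ V) (hne : V.Nonempty) (hM : IsPrecond M)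
    {Λ c β : ℝ} (hΛ : ∀ v, ‖v‖ ≤ Λ * normM M v) (hh : WeakOn V c h) (hc : 0 ≤ c) (hβ : 0 < β)
    (hκ : 0 < β - Λ ^ 2 * c) (hb : ∃ c, ∀ y ∈ V, c ≤ h y) (z : Vec d) :
    ∃ w q, MinLimit V M (β - Λ ^ 2 * c) (fun y => h y + β / 2 * normM M (y - z) ^ 2) w q
      (envOn V M β h z) := by
  refine exists_minLimit hV hne hΛ hκ (hh.add_quad hc hM hΛ β z) ?_
  obtain ⟨c, hc⟩ := bddBelow_envOn (M := M) hb hβ z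
  exact ⟨c, fun y hy => hc ⟨y, hy, rfl⟩⟩

/-- Comparison of two values of the envelope through the proximal points. -/
lemma envOn_add_le (hM : IsPrecond M) {κ β : ℝ} {z z' q q' : Vec d} {w w' : ℕ → Vec d}
    (hq : MinLimit V M κ (fun y => h y + β / 2 * normM M (y - z) ^ 2) w q (envOn V M β h z))
    (hq' : MinLimit V M κ (fun y => h y + β / 2 * normM M (y - z') ^ 2) w' q'
      (envOn V M β h z')) :
    envOn V M β h z + κ / 2 * normM M (q' - q) ^ 2 ≤
      envOn V M β h z' + β * ⟪q' - z', M (z' - z)⟫ + β / 2 * normM M (z' - z) ^ 2 := by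
  have h1 : ∀ n, envOn V M β h z + κ / 2 * normM M (w' n - q) ^ 2 ≤
      (h (w' n) + β / 2 * normM M (w' n - z') ^ 2) + (β * ⟪w' n - z', M (z' - z)⟫
        + β / 2 * normM M (z' - z) ^ 2) := by
    intro n
    have h2 := hq.growth _ (hq'.mem n)
    beta_reduce at h2
    have h3 : w' n - z = (w' n - z') + (z' - z) := by abel
    rw [h3, hM.normM_sq_add] at h2
    linarith
  have hn := continuous_normM M
  have hc1 : Continuous fun u => envOn V M β h z + κ / 2 * normM M (u - q) ^ 2 := by fun_prop
  have hc2 : Continuous fun u : Vec d => β * ⟪u - z', M (z' - z)⟫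
      + β / 2 * normM M (z' - z) ^ 2 := by fun_prop
  have := le_of_tendsto_of_tendsto' ((hc1.tendsto _).comp hq'.tendsto)
    (hq'.tendsto_val.add ((hc2.tendsto _).comp hq'.tendsto)) h1
  linarith

/-- The gradient of the Moreau envelope of a weakly convex function. -/
theorem hasGradientAt_envOn (hV : Convex ℝ V) (hne : V.Nonempty) (hM : IsPrecond M)
    {Λ c β μ : ℝ} (hΛ : ∀ v, ‖v‖ ≤ Λ * normM M v) (hμ : 0 < μ)
    (hμv : ∀ v, μ * normM M v ≤ ‖v‖) (hh : WeakOn V c h) (hc : 0 ≤ c) (hβ : 0 < β)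
    (hκ : 0 < β - Λ ^ 2 * c) (hb : ∃ c, ∀ y ∈ V, c ≤ h y) {z q : Vec d} {w : ℕ → Vec d}
    (hq : MinLimit V M (β - Λ ^ 2 * c) (fun y => h y + β / 2 * normM M (y - z) ^ 2) w q
      (envOn V M β h z)) :
    HasGradientAt (envOn V M β h) (β • M (z - q)) z := by
  set κ := β - Λ ^ 2 * c with hκdef
  -- `β / 2` comes from the quadratic, `β / κ` is a Lipschitz constant of the proximal point, and
  -- `μ⁻¹ ^ 2` changes the norm.
  set C := (β / 2 + β * (β / κ)) * μ⁻¹ ^ 2 with hC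
  have hbound : ∀ z', |envOn V M β h z' - envOn V M β h z - ⟪β • M (z - q), z' - z⟫| ≤
      C * ‖z' - z‖ ^ 2 := by
    intro z'
    obtain ⟨w', q', hq'⟩ := exists_minLimit_envOn hV hne hM hΛ hh hc hβ hκ hb z'
    have h1 := envOn_add_le hM hq hq'
    have h2 := envOn_add_le hM hq' hq
    set Δ := z' - z with hΔ
    have hlin : ⟪β • M (z - q), Δ⟫ = β * ⟪z - q, M Δ⟫ := by
      rw [inner_smul_left, hM.inner_symm, real_inner_comm]
      simp
    have e1 : z - z' = -Δ := by rw [hΔ]; abel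
    have e2 : q - z = -(z - q) := by abel
    have e3 : q' - z' = (q' - q) - (z - q) - Δ := by rw [hΔ]; abel
    have e4 : normM M (-Δ) = normM M Δ := by rw [← e1, normM_sub_comm]
    have e5 : ⟪Δ, M Δ⟫ = normM M Δ ^ 2 := (hM.normM_sq _).symm
    rw [e3, inner_sub_left, inner_sub_left, e5] at h1
    rw [normM_sub_comm M q q', e1, e2, map_neg, inner_neg_neg, e4] at h2
    have hcs : ⟪q' - q, M Δ⟫ ≤ normM M (q' - q) * normM M Δ := hM.inner_le _ _
    have hn1 := normM_nonneg M (q' - q)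
    have hn2 := normM_nonneg M Δ
    -- Adding the two comparisons cancels the envelope values and the squares of `Δ`, leaving `κ ‖q'
    -- - q‖_M² ≤ β ⟪q' - q, M Δ⟫`.
    have hlip : κ * normM M (q' - q) ≤ β * normM M Δ := by
      have h3 : κ * normM M (q' - q) * normM M (q' - q) ≤ β * normM M Δ * normM M (q' - q) := by
        nlinarith
      rcases hn1.eq_or_lt with h0 | h0
      · rw [← h0, mul_zero]
        positivity
      · exact le_of_mul_le_mul_right h3 h0
    have hlip' : normM M (q' - q) ≤ β / κ * normM M Δ := by
      rw [div_mul_eq_mul_div, le_div_iff₀ hκ]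
      linarith
    have hsq : normM M Δ ^ 2 ≤ μ⁻¹ ^ 2 * ‖Δ‖ ^ 2 := by
      rw [← mul_pow]
      refine pow_le_pow_left₀ hn2 ?_ 2
      rw [le_inv_mul_iff₀ hμ]
      exact hμv _
    have hmain : |envOn V M β h z' - envOn V M β h z - β * ⟪z - q, M Δ⟫| ≤
        (β / 2 + β * (β / κ)) * normM M Δ ^ 2 := by
      have h5 : β * ⟪q' - q, M Δ⟫ ≤ β * (β / κ) * normM M Δ ^ 2 := by
        have : ⟪q' - q, M Δ⟫ ≤ β / κ * normM M Δ * normM M Δ :=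
          hcs.trans (mul_le_mul_of_nonneg_right hlip' hn2)
        nlinarith
      have h6 : 0 ≤ κ / 2 * normM M (q' - q) ^ 2 := by positivity
      have h7 : 0 ≤ β * (β / κ) * normM M Δ ^ 2 := by positivity
      have h8 : 0 ≤ β / 2 * normM M Δ ^ 2 := by positivity
      rw [abs_le]
      constructor <;> nlinarith
    rw [hlin]
    refine hmain.trans ?_
    rw [hC, mul_assoc]
    exact mul_le_mul_of_nonneg_left hsq (by positivity)
  have hO : (fun z' => envOn V M β h z' - envOn V M β h z - ⟪β • M (z - q), z' - z⟫)
      =O[𝓝 z] fun z' => ‖z' - z‖ ^ 2 :=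
    Asymptotics.IsBigO.of_bound C (Eventually.of_forall fun z' => by
      rw [Real.norm_eq_abs, norm_pow, norm_norm]
      exact hbound z')
  have hd := hO.hasFDerivAt (𝕜 := ℝ) one_lt_two
  rw [hasGradientAt_iff_hasFDerivAt]
  have hl : HasFDerivAt (fun z' => envOn V M β h z + ⟪β • M (z - q), z' - z⟫)
      (InnerProductSpace.toDual ℝ (Vec d) (β • M (z - q))) z := by
    have h1 := ((InnerProductSpace.toDual ℝ (Vec d) (β • M (z - q))).hasFDerivAt
      (x := z)).sub_const ⟪β • M (z - q), z⟫ |>.const_add (envOn V M β h z)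
    refine h1.congr_of_eventuallyEq (Eventually.of_forall fun z' => ?_)
    simp only [InnerProductSpace.toDual_apply_apply, inner_sub_right]
  have := hd.add hl
  rw [zero_add] at this
  refine this.congr_of_eventuallyEq (Eventually.of_forall fun z' => ?_)
  simp

end Moreau

/-! ### Almost supermartingales -/

section RobbinsSiegmund

variable {Ω : Type*} {m0 : MeasurableSpace Ω} {μ : Measure Ω} [IsProbabilityMeasure μ]
  {ℱ : Filtration ℕ m0}

/-- A supermartingale that is bounded below by a constant is almost surely bounded. -/
lemma ae_bounded_of_supermartingale {X : ℕ → Ω → ℝ} (hX : Supermartingale X ℱ μ) {C : ℝ}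
    (hC : ∀ n, ∀ᵐ ω ∂μ, -C ≤ X n ω) : ∀ᵐ ω ∂μ, ∃ B, ∀ n, X n ω ≤ B := by
  have hE : ∀ n, ∫ ω, X n ω ∂μ ≤ ∫ ω, X 0 ω ∂μ := fun n => by
    simpa using hX.setIntegral_le (Nat.zero_le n) MeasurableSet.univ
  -- The lower bound gives `|X| ≤ X + 2 |C|`, so decreasing expectations bound the `L¹` norms, as
  -- martingale convergence requires.
  have habs : ∀ n, ∫ ω, ‖X n ω‖ ∂μ ≤ ∫ ω, X 0 ω ∂μ + 2 * |C| := by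
    intro n
    have h1 : ∫ ω, ‖X n ω‖ ∂μ ≤ ∫ ω, (X n ω + 2 * |C|) ∂μ := by
      refine integral_mono_ae (hX.integrable n).norm
        ((hX.integrable n).add (integrable_const _)) ?_
      filter_upwards [hC n] with ω hω
      have := le_abs_self C
      rw [Real.norm_eq_abs, abs_le]
      constructor <;> linarith [abs_nonneg C]
    rw [integral_add (hX.integrable n) (integrable_const _)] at h1
    simp only [integral_const, probReal_univ, smul_eq_mul, one_mul] at h1
    linarith [hE n]
  have hconv := hX.neg.exists_ae_tendsto_of_bdd
    (R := (∫ ω, X 0 ω ∂μ + 2 * |C|).toNNReal) fun n => by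
      rw [eLpNorm_one_eq_lintegral_enorm, ← ofReal_integral_norm_eq_lintegral_enorm
        (hX.neg.integrable n)]
      refine ENNReal.ofReal_le_ofReal ?_
      simpa using habs n
  filter_upwards [hconv] with ω ⟨c, hc⟩
  obtain ⟨B, hB⟩ := hc.neg.bddAbove_range
  refine ⟨B, fun n => ?_⟩
  simpa using hB ⟨n, rfl⟩

/-- The Robbins–Siegmund theorem: boundedness and summability. -/
theorem robbins_siegmund {A u : ℕ → Ω → ℝ} {β c : ℕ → ℝ} (hAm : StronglyAdapted ℱ A)
    (hum : StronglyAdapted ℱ u) (hAi : ∀ n, Integrable (A n) μ) (hui : ∀ n, Integrable (u n) μ)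
    (hA : ∀ n, ∀ᵐ ω ∂μ, 0 ≤ A n ω) (hu : ∀ n, ∀ᵐ ω ∂μ, 0 ≤ u n ω) (hβ : ∀ n, 0 ≤ β n)
    (hβs : Summable β) (hc : ∀ n, 0 ≤ c n) (hcs : Summable c)
    (h : ∀ n, ∀ᵐ ω ∂μ, (μ[A (n + 1) | ℱ n]) ω ≤ (1 + β n) * A n ω - u n ω + c n) :
    ∀ᵐ ω ∂μ, (∃ C, ∀ n, A n ω ≤ C) ∧ Summable fun n => u n ω := by
  set π : ℕ → ℝ := fun n => ∏ i ∈ Finset.range n, (1 + β i) with hπ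
  have hπ1 : ∀ n, 1 ≤ π n := fun n => by
    calc (1 : ℝ) = ∏ i ∈ Finset.range n, 1 := by simp
      _ ≤ π n := Finset.prod_le_prod (fun _ _ => zero_le_one) fun i _ => by linarith [hβ i]
  have hπ0 : ∀ n, 0 < π n := fun n => zero_lt_one.trans_le (hπ1 n)
  have hπs : ∀ n, π (n + 1) = π n * (1 + β n) := fun n => Finset.prod_range_succ _ _
  set B := Real.exp (∑' i, β i) with hB
  have hπB : ∀ n, π n ≤ B := by
    intro n
    calc π n ≤ ∏ i ∈ Finset.range n, Real.exp (β i) := by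
          refine Finset.prod_le_prod (fun i _ => by linarith [hβ i]) fun i _ => ?_
          rw [add_comm]
          exact Real.add_one_le_exp _
      _ = Real.exp (∑ i ∈ Finset.range n, β i) := (Real.exp_sum _ _).symm
      _ ≤ B := Real.exp_le_exp.mpr (hβs.sum_le_tsum _ fun i _ => hβ i)
  -- Division by `π n` absorbs the factors `1 + β`; adding the past decreases and subtracting the
  -- past errors leaves a supermartingale, bounded below by `-∑ c`.
  set X : ℕ → Ω → ℝ := fun n ω => (π n)⁻¹ * A n ω
    + ∑ i ∈ Finset.range n, (π (i + 1))⁻¹ * u i ω - ∑ i ∈ Finset.range n, (π (i + 1))⁻¹ * c i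
    with hXdef
  have hXm : StronglyAdapted ℱ X := by
    intro n
    refine (((hAm n).const_mul _).add ?_).sub stronglyMeasurable_const
    refine Finset.stronglyMeasurable_fun_sum _ fun i hi => ?_
    exact ((hum i).mono (ℱ.mono (Finset.mem_range.mp hi).le)).const_mul _
  have hSi : ∀ n, Integrable (fun ω => ∑ i ∈ Finset.range n, (π (i + 1))⁻¹ * u i ω) μ := fun n =>
    integrable_finsetSum _ fun i _ => (hui i).const_mul _
  have hXi : ∀ n, Integrable (X n) μ := fun n =>
    (((hAi n).const_mul _).add (hSi n)).sub (integrable_const _)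
  have hsuper : Supermartingale X ℱ μ := by
    refine supermartingale_nat hXm hXi fun n => ?_
    have hsplit : X (n + 1) = (π (n + 1))⁻¹ • A (n + 1) + fun ω =>
        ∑ i ∈ Finset.range (n + 1), (π (i + 1))⁻¹ * u i ω
          - ∑ i ∈ Finset.range (n + 1), (π (i + 1))⁻¹ * c i := by
      ext ω
      simp only [hXdef, Pi.add_apply, Pi.smul_apply, smul_eq_mul]
      ring
    have hRm : StronglyMeasurable[ℱ n] fun ω =>
        ∑ i ∈ Finset.range (n + 1), (π (i + 1))⁻¹ * u i ω
          - ∑ i ∈ Finset.range (n + 1), (π (i + 1))⁻¹ * c i := by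
      refine StronglyMeasurable.sub ?_ stronglyMeasurable_const
      refine Finset.stronglyMeasurable_fun_sum _ fun i hi => ?_
      exact ((hum i).mono (ℱ.mono (Nat.lt_succ_iff.mp (Finset.mem_range.mp hi)))).const_mul _
    have hRi : Integrable (fun ω => ∑ i ∈ Finset.range (n + 1), (π (i + 1))⁻¹ * u i ω
          - ∑ i ∈ Finset.range (n + 1), (π (i + 1))⁻¹ * c i) μ :=
      (hSi _).sub (integrable_const _)
    rw [hsplit]
    have h1 := condExp_add (m := ℱ n) ((hAi (n + 1)).smul (π (n + 1))⁻¹) hRi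
    have h2 := condExp_smul (μ := μ) (π (n + 1))⁻¹ (A (n + 1)) (ℱ n)
    have h3 := condExp_of_stronglyMeasurable (ℱ.le n) hRm hRi
    filter_upwards [h1, h2, h n] with ω h1 h2 h4
    rw [h1, Pi.add_apply, h2, h3, Pi.smul_apply, smul_eq_mul]
    have h5 := mul_le_mul_of_nonneg_left h4 (inv_nonneg.mpr (hπ0 (n + 1)).le)
    have h6 : (π (n + 1))⁻¹ * (1 + β n) = (π n)⁻¹ := by
      have : 0 < 1 + β n := by linarith [hβ n]
      rw [hπs, mul_inv, mul_assoc, inv_mul_cancel₀ this.ne', mul_one]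
    simp only [hXdef, Finset.sum_range_succ]
    have h7 : (π (n + 1))⁻¹ * ((1 + β n) * A n ω - u n ω + c n) =
        (π n)⁻¹ * A n ω - (π (n + 1))⁻¹ * u n ω + (π (n + 1))⁻¹ * c n := by
      rw [← h6]
      ring
    linarith
  have hcsum : ∀ n, ∑ i ∈ Finset.range n, (π (i + 1))⁻¹ * c i ≤ ∑' i, c i := by
    intro n
    refine le_trans (Finset.sum_le_sum fun i _ => ?_) (hcs.sum_le_tsum _ fun i _ => hc i)
    exact mul_le_of_le_one_left (hc i) (inv_le_one_of_one_le₀ (hπ1 _))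
  have hAu : ∀ᵐ ω ∂μ, ∀ n, 0 ≤ A n ω ∧ 0 ≤ u n ω := by
    rw [ae_all_iff]
    exact fun n => (hA n).and (hu n)
  have hlow : ∀ n, ∀ᵐ ω ∂μ, -(∑' i, c i) ≤ X n ω := by
    intro n
    filter_upwards [hAu] with ω hω
    have h1 : 0 ≤ (π n)⁻¹ * A n ω := mul_nonneg (inv_nonneg.mpr (hπ0 n).le) (hω n).1
    have h2 : 0 ≤ ∑ i ∈ Finset.range n, (π (i + 1))⁻¹ * u i ω :=
      Finset.sum_nonneg fun i _ => mul_nonneg (inv_nonneg.mpr (hπ0 _).le) (hω i).2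
    have := hcsum n
    simp only [hXdef]
    linarith
  filter_upwards [ae_bounded_of_supermartingale hsuper hlow, hAu] with ω ⟨D, hD⟩ hω
  have h1 : ∀ n, 0 ≤ (π n)⁻¹ * A n ω := fun n =>
    mul_nonneg (inv_nonneg.mpr (hπ0 n).le) (hω n).1
  have h2 : ∀ n, 0 ≤ ∑ i ∈ Finset.range n, (π (i + 1))⁻¹ * u i ω := fun n =>
    Finset.sum_nonneg fun i _ => mul_nonneg (inv_nonneg.mpr (hπ0 _).le) (hω i).2
  have hXω : ∀ n, (π n)⁻¹ * A n ω + ∑ i ∈ Finset.range n, (π (i + 1))⁻¹ * u i ω ≤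
      D + ∑' i, c i := by
    intro n
    have h3 := hD n
    have h4 := hcsum n
    simp only [hXdef] at h3
    linarith
  have hK : 0 ≤ D + ∑' i, c i := by linarith [hXω 0, h1 0, h2 0]
  constructor
  · refine ⟨B * (D + ∑' i, c i), fun n => ?_⟩
    have h3 : (π n)⁻¹ * A n ω ≤ D + ∑' i, c i := by linarith [hXω n, h2 n]
    rw [inv_mul_le_iff₀ (hπ0 n)] at h3
    exact h3.trans (mul_le_mul_of_nonneg_right (hπB n) hK)
  · refine summable_of_sum_range_le (fun n => (hω n).2) (c := B * (D + ∑' i, c i)) fun n => ?_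
    calc ∑ i ∈ Finset.range n, u i ω
        ≤ ∑ i ∈ Finset.range n, B * ((π (i + 1))⁻¹ * u i ω) := by
          refine Finset.sum_le_sum fun i _ => ?_
          rw [← mul_assoc]
          refine le_mul_of_one_le_left (hω i).2 ?_
          rw [← div_eq_mul_inv, one_le_div (hπ0 _)]
          exact hπB _
      _ = B * ∑ i ∈ Finset.range n, (π (i + 1))⁻¹ * u i ω := (Finset.mul_sum _ _ _).symm
      _ ≤ B * (D + ∑' i, c i) := by
          refine mul_le_mul_of_nonneg_left ?_ (Real.exp_pos _).le
          linarith [hXω n, h1 n]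

end RobbinsSiegmund

/-! ### The objective and the models as real functions on `V` -/

section Data

variable {d : ℕ} {S : Type*} [MeasurableSpace S] {P : Measure S} [IsProbabilityMeasure P]
  {f : S → Vec d → EReal} {r : Vec d → EReal} {g : Vec d → Vec d → S → ℝ} {V : Set (Vec d)}
  {ηbar τbar Lφ : ℝ} {G : ℝ≥0 → ℝ≥0} {L : S → ℝ≥0}

lemma norm_sq_convex (y z : Vec d) {a b : ℝ} (hab : a + b = 1) :
    ‖a • y + b • z‖ ^ 2 = a * ‖y‖ ^ 2 + b * ‖z‖ ^ 2 - a * b * ‖y - z‖ ^ 2 := by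
  simpa [normM_id] using isPrecond_id.normM_sq_convex 0 y z hab

lemma nonempty_of_composite (hmodel : ModelAssumption P f r g V ηbar)
    (hcomp : CompositeAssumption P f r g V τbar) : V.Nonempty := by
  obtain ⟨y, hy⟩ := hcomp.r_proper.2
  exact ⟨y, hmodel.dom_subset hy⟩

/-- The growth assumption forces the domain of the regularizer to be relatively open and closed
in `V`, hence equal to `V`. -/
lemma dom_eq (hmodel : ModelAssumption P f r g V ηbar)
    (hcomp : CompositeAssumption P f r g V τbar) (hgrowth : GrowthAssumption P r g V G L Lφ) :
    {y | r y ≠ ⊤} = V := by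
  refine Set.Subset.antisymm hmodel.dom_subset ?_
  obtain ⟨s, hs⟩ := hgrowth.lipschitz.exists
  obtain ⟨x, hx⟩ := nonempty_of_composite hmodel hcomp
  have hbot : ∀ z, r z ≠ ⊥ := hcomp.r_proper.1
  -- The two halves of the Lipschitz condition carry finiteness in the two directions, since a real
  -- number is not above `⊤`.
  have hloc : ∀ y ∈ V, ∀ᶠ z in 𝓝 y, (r y = ⊤ ↔ r z = ⊤) := by
    intro y hy
    filter_upwards [hs x hx y hy] with z ⟨h1, h2⟩
    constructor
    · intro h
      unfold compositeModel at h1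
      rw [h, EReal.coe_add_top, top_le_iff] at h1
      by_contra hz
      lift r z to ℝ using ⟨hz, hbot z⟩ with t
      rw [← EReal.coe_add, ← EReal.coe_add] at h1
      exact EReal.coe_ne_top _ h1
    · intro h
      unfold compositeModel at h2
      rw [h, EReal.coe_add_top, top_le_iff] at h2
      by_contra hy
      lift r y to ℝ using ⟨hy, hbot y⟩ with t
      rw [← EReal.coe_add, ← EReal.coe_add] at h2
      exact EReal.coe_ne_top _ h2
  have hA : IsOpen (V ∩ {y | r y ≠ ⊤}) := by
    rw [isOpen_iff_mem_nhds]
    rintro y ⟨hy, hyr⟩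
    filter_upwards [hloc y hy, hmodel.isOpen.mem_nhds hy] with z hz hzV
    exact ⟨hzV, fun h => hyr (hz.mpr h)⟩
  have hB : IsOpen (V ∩ {y | r y = ⊤}) := by
    rw [isOpen_iff_mem_nhds]
    rintro y ⟨hy, hyr⟩
    filter_upwards [hloc y hy, hmodel.isOpen.mem_nhds hy] with z hz hzV
    exact ⟨hzV, hz.mp hyr⟩
  have hpre : IsPreconnected V := hmodel.convex.isPreconnected
  have hsub := hpre.subset_left_of_subset_union hA hB
    (Set.disjoint_left.mpr fun y h1 h2 => h1.2 h2.2)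
    (fun y hy => by
      by_cases h : r y = ⊤
      · exact Or.inr ⟨hy, h⟩
      · exact Or.inl ⟨hy, h⟩)
    (by
      obtain ⟨y, hy⟩ := hcomp.r_proper.2
      exact ⟨y, hmodel.dom_subset hy, hmodel.dom_subset hy, hy⟩)
  exact fun y hy => (hsub hy).2

/-- The standing facts on the data that are used below, with the domain of `r` identified. -/
structure Setting (P : Measure S) (f : S → Vec d → EReal) (r : Vec d → EReal)
    (g : Vec d → Vec d → S → ℝ) (V : Set (Vec d)) (ηbar τbar Lφ : ℝ) (G : ℝ≥0 → ℝ≥0)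
    (L : S → ℝ≥0) : Prop where
  model : ModelAssumption P f r g V ηbar
  comp : CompositeAssumption P f r g V τbar
  growth : GrowthAssumption P r g V G L Lφ
  sublevel : SublevelAssumption (objective P f r)

/-- The real part of the objective. -/
noncomputable def objR (P : Measure S) (f : S → Vec d → EReal) (r : Vec d → EReal)
    (y : Vec d) : ℝ :=
  expectedLoss P f y + (r y).toReal

/-! ### Integrability, weak convexity and continuity from the data -/

namespace Setting

variable (hS : Setting P f r g V ηbar τbar Lφ G L)
include hS

lemma nonempty : V.Nonempty := nonempty_of_composite hS.model hS.comp

lemma represents_r : Represents V (fun y => (r y).toReal) r where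
  eq_coe y hy := by
    rw [← dom_eq hS.model hS.comp hS.growth] at hy
    exact (EReal.coe_toReal hy (hS.comp.r_proper.1 y)).symm
  eq_top y hy := by
    rw [← dom_eq hS.model hS.comp hS.growth] at hy
    simpa using hy

lemma represents_coe_add (u : Vec d → ℝ) :
    Represents V (fun y => u y + (r y).toReal) fun y => (u y : EReal) + r y where
  eq_coe y hy := by rw [hS.represents_r.eq_coe y hy, EReal.coe_add, EReal.toReal_coe]
  eq_top y hy := by rw [hS.represents_r.eq_top y hy, EReal.coe_add_top]

lemma represents_objective : Represents V (objR P f r) (objective P f r) :=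
  hS.represents_coe_add _

lemma exists_le_objR : ∃ c, ∀ y ∈ V, c ≤ objR P f r y := by
  obtain ⟨c, hc⟩ := hS.sublevel.bddBelow
  refine ⟨c, fun y hy => ?_⟩
  have := hc y
  rw [hS.represents_objective.eq_coe y hy] at this
  exact_mod_cast this

lemma measurable_model {α : Type*} [MeasurableSpace α] {a b : α → Vec d} {c : α → S}
    (ha : Measurable a) (hb : Measurable b) (hc : Measurable c) (haV : ∀ t, a t ∈ V)
    (hbV : ∀ t, b t ∈ V) : Measurable fun t => g (a t) (b t) (c t) :=
  hS.model.measurable.comp (g := fun p : V × V × S => g p.1 p.2.1 p.2.2)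
    (f := fun t => (⟨a t, haV t⟩, ⟨b t, hbV t⟩, c t))
    ((ha.subtype_mk).prodMk ((hb.subtype_mk).prodMk hc))

/-- The model differs from the integrable `f(y; s)` by a function of `s` bounded by the model error.
-/
lemma integrable_model {x y : Vec d} (hx : x ∈ V) (hy : y ∈ V) :
    Integrable (fun s => g x y s) P := by
  have hm : Measurable fun s => g x y s :=
    hS.measurable_model measurable_const measurable_const measurable_id (fun _ => hx) fun _ => hy
  have h1 : Integrable (fun s => g x y s - (f s y).toReal) P := by
    refine Integrable.of_bound (hm.aestronglyMeasurable.sub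
      (hS.comp.integrable y).aestronglyMeasurable) (ηbar / 2 * ‖y - x‖ ^ 2) ?_
    filter_upwards [hS.model.model] with s hs
    exact (hs x hx).2 y hy
  refine (h1.add (hS.comp.integrable y)).congr (Eventually.of_forall fun s => ?_)
  simp

lemma integral_model_le {x y : Vec d} (hx : x ∈ V) (hy : y ∈ V) :
    ∫ s, g x y s ∂P ≤ expectedLoss P f y + ηbar / 2 * ‖y - x‖ ^ 2 := by
  have h : ∫ s, g x y s ∂P ≤ ∫ s, ((f s y).toReal + ηbar / 2 * ‖y - x‖ ^ 2) ∂P := by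
    refine integral_mono_ae (hS.integrable_model hx hy)
      ((hS.comp.integrable y).add (integrable_const _)) ?_
    filter_upwards [hS.model.model] with s hs
    have := (abs_le.mp ((hs x hx).2 y hy)).2
    linarith
  rw [integral_add (hS.comp.integrable y) (integrable_const _)] at h
  simpa [expectedLoss] using h

lemma integral_model_self {x : Vec d} (hx : x ∈ V) :
    ∫ s, g x x s ∂P = expectedLoss P f x := by
  refine integral_congr_ae ?_
  filter_upwards [hS.model.model] with s hs
  rw [(hs x hx).1, EReal.toReal_coe]

lemma weakOn_model : ∀ᵐ s ∂P, ∀ x ∈ V, WeakOn V τbar fun y => g x y s + (r y).toReal := by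
  filter_upwards [hS.comp.weaklyConvex] with s hs x hx y hy z hz a b ha hb hab
  have hrep := (hS.represents_coe_add fun y => g x y s).add_coe fun y => τbar / 2 * ‖y‖ ^ 2
  have h := hs x hx y z a b ha hb hab
  unfold compositeModel at h
  beta_reduce at h ⊢
  rw [hrep.eq_coe _ (hS.model.convex hy hz ha hb hab), hrep.eq_coe _ hy, hrep.eq_coe _ hz] at h
  have h' : g x (a • y + b • z) s + (r (a • y + b • z)).toReal + τbar / 2 * ‖a • y + b • z‖ ^ 2 ≤
      a * (g x y s + (r y).toReal + τbar / 2 * ‖y‖ ^ 2)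
      + b * (g x z s + (r z).toReal + τbar / 2 * ‖z‖ ^ 2) := by exact_mod_cast h
  rw [norm_sq_convex y z hab] at h'
  linarith

/-- The growth condition, used only at the centre `x` of the model and globalized by weak convexity.
The slope therefore involves `G` at `‖x‖` alone, which is the quantity the step size divides by. -/
lemma model_ge : ∀ᵐ s ∂P, ∀ x ∈ V, ∀ y ∈ V,
    g x x s + (r x).toReal - L s * G ‖x‖₊ * ‖y - x‖ - τbar / 2 * ‖y - x‖ ^ 2 ≤
      g x y s + (r y).toReal := by
  filter_upwards [hS.weakOn_model, hS.growth.lipschitz] with s hw hl x hx y hy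
  refine (hw x hx).ge_of_local_ge hx hy (K := L s * G ‖x‖₊) ?_
  filter_upwards [hl x hx x hx, hS.model.isOpen.mem_nhds hx] with z hz hzV
  have h := hz.1
  have hrep := hS.represents_coe_add fun y => g x y s
  unfold compositeModel at h
  rw [hrep.eq_coe _ hx, hrep.eq_coe _ hzV, max_self] at h
  exact_mod_cast h

/-- Use the model centred at the convex combination `w`: in expectation it is exact at `w` and off
by at most `ηbar / 2 * ‖· - w‖ ^ 2` at `y` and `z`, and these errors average to `ηbar / 2 * (a * b)
* ‖y - z‖ ^ 2`. -/
lemma weakOn_objR : WeakOn V (ηbar + τbar) (objR P f r) := by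
  intro y hy z hz a b ha hb hab
  set w := a • y + b • z with hw
  have hwV : w ∈ V := hS.model.convex hy hz ha hb hab
  have h1 : ∫ s, (g w w s + (r w).toReal) ∂P ≤ ∫ s, (a * g w y s + b * g w z s
      + (a * (r y).toReal + b * (r z).toReal + τbar / 2 * (a * b) * ‖y - z‖ ^ 2)) ∂P := by
    refine integral_mono_ae ((hS.integrable_model hwV hwV).add (integrable_const _))
      ((((hS.integrable_model hwV hy).const_mul a).add
        ((hS.integrable_model hwV hz).const_mul b)).add (integrable_const _)) ?_
    filter_upwards [hS.weakOn_model] with s hs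
    have := hs w hwV y hy z hz a b ha hb hab
    beta_reduce at this
    linarith
  have hi : Integrable (fun s => a * g w y s + b * g w z s) P :=
    ((hS.integrable_model hwV hy).const_mul a).add ((hS.integrable_model hwV hz).const_mul b)
  rw [integral_add (hS.integrable_model hwV hwV) (integrable_const _), integral_add hi
    (integrable_const _), integral_add ((hS.integrable_model hwV hy).const_mul a)
    ((hS.integrable_model hwV hz).const_mul b), integral_const_mul, integral_const_mul,
    hS.integral_model_self hwV] at h1
  simp only [integral_const, probReal_univ, smul_eq_mul, one_mul] at h1
  have h2 := mul_le_mul_of_nonneg_left (hS.integral_model_le hwV hy) ha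
  have h3 := mul_le_mul_of_nonneg_left (hS.integral_model_le hwV hz) hb
  have h4 : a * ‖y - w‖ ^ 2 + b * ‖z - w‖ ^ 2 = a * b * ‖y - z‖ ^ 2 := by
    obtain rfl : b = 1 - a := by linarith
    rw [show y - w = (1 - a) • (y - z) by rw [hw]; module,
      show z - w = (-a) • (y - z) by rw [hw]; module, norm_smul, norm_smul, mul_pow, mul_pow]
    simp only [Real.norm_eq_abs, sq_abs]
    ring
  have h5 := congrArg (fun t => ηbar / 2 * t) h4
  beta_reduce at h5
  unfold objR
  linarith

/-- Adding the quadratic gives a finite convex function on an open set in finite dimension, which is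
continuous. -/
lemma continuousOn_objR : ContinuousOn (objR P f r) V := by
  have hconv : ConvexOn ℝ V fun y => objR P f r y + (ηbar + τbar) / 2 * ‖y‖ ^ 2 := by
    refine ⟨hS.model.convex, fun y hy z hz a b ha hb hab => ?_⟩
    have h := hS.weakOn_objR y hy z hz a b ha hb hab
    beta_reduce
    rw [norm_sq_convex y z hab]
    simp only [smul_eq_mul]
    linarith
  have h1 := hconv.continuousOn hS.model.isOpen
  have h2 : Continuous fun y : Vec d => (ηbar + τbar) / 2 * ‖y‖ ^ 2 := by fun_prop
  refine (h1.sub h2.continuousOn).congr fun y _ => ?_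
  simp

/-- A second point of `V` is needed; in dimension zero the model bound does not restrict the sign of
`ηbar`. -/
lemma ηbar_nonneg (hd : 0 < d) : 0 ≤ ηbar := by
  obtain ⟨x, hx⟩ := hS.nonempty
  have : Nonempty (Fin d) := ⟨⟨0, hd⟩⟩
  have : Nontrivial (Vec d) := inferInstance
  have hne : (V \ {x}).Nonempty := by
    have h1 : ∀ᶠ z in 𝓝[≠] x, z ∈ V := nhdsWithin_le_nhds (hS.model.isOpen.mem_nhds hx)
    obtain ⟨z, hz, hzx⟩ := (h1.and self_mem_nhdsWithin).exists
    exact ⟨z, hz, hzx⟩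
  obtain ⟨z, hz, hzx⟩ := hne
  obtain ⟨s, hs⟩ := hS.model.model.exists
  have h1 := (abs_nonneg _).trans ((hs x hx).2 z hz)
  have h2 : 0 < ‖z - x‖ ^ 2 := by
    have : 0 < ‖z - x‖ := norm_pos_iff.mpr (sub_ne_zero.mpr hzx)
    positivity
  by_contra hneg
  push Not at hneg
  have := mul_neg_of_neg_of_pos (half_neg hneg) h2
  linarith
where
  half_neg {a : ℝ} (h : a < 0) : a / 2 < 0 := by linarith

lemma measurable_r : Measurable fun y => (r y).toReal :=
  hS.comp.r_closed.measurable.ereal_toReal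

lemma measurable_objR : Measurable (objR P f r) :=
  hS.comp.locallyLipschitz.continuous.measurable.add hS.measurable_r

lemma objR_bounded (t : ℝ) : ∃ C, ∀ y ∈ V, objR P f r y ≤ t → ‖y‖ ≤ C := by
  obtain ⟨C, hC⟩ := (hS.sublevel.bounded t).exists_norm_le
  refine ⟨C, fun y hy hyt => hC y ?_⟩
  rw [Set.mem_ofPred_eq, hS.represents_objective.eq_coe y hy]
  exact_mod_cast hyt

end Setting

/-! ### One step of the algorithm, for fixed samples -/

/-- The real part of the minibatch model. -/
noncomputable def batchR {m : ℕ} (g : Vec d → Vec d → S → ℝ) (r : Vec d → EReal) (x : Vec d)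
    (s : Fin m → S) (y : Vec d) : ℝ :=
  (1 / (m : ℝ)) * ∑ i, g x y (s i) + (r y).toReal

/-- The properties of a sample that hold almost surely. -/
structure GoodSample (r : Vec d → EReal) (g : Vec d → Vec d → S → ℝ) (V : Set (Vec d)) (τbar : ℝ)
    (G : ℝ≥0 → ℝ≥0) (L : S → ℝ≥0) (s : S) : Prop where
  weak : ∀ x ∈ V, WeakOn V τbar fun y => g x y s + (r y).toReal
  ge : ∀ x ∈ V, ∀ y ∈ V,
    g x x s + (r x).toReal - L s * G ‖x‖₊ * ‖y - x‖ - τbar / 2 * ‖y - x‖ ^ 2 ≤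
      g x y s + (r y).toReal

lemma batchR_eq {m : ℕ} (hm : 0 < m) (x : Vec d) (s : Fin m → S) (y : Vec d) :
    batchR g r x s y = (1 / (m : ℝ)) * ∑ i, (g x y (s i) + (r y).toReal) := by
  have : (m : ℝ) ≠ 0 := by positivity
  unfold batchR
  rw [Finset.sum_add_distrib, Finset.sum_const, Finset.card_univ, Fintype.card_fin, nsmul_eq_mul]
  field_simp

variable {m : ℕ} {s : Fin m → S}

lemma weakOn_batchR (hm : 0 < m) (hs : ∀ i, GoodSample r g V τbar G L (s i)) {x : Vec d}
    (hx : x ∈ V) : WeakOn V τbar (batchR g r x s) := by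
  intro y hy z hz a b ha hb hab
  have hm' : (0 : ℝ) < m := by positivity
  rw [batchR_eq hm, batchR_eq hm, batchR_eq hm]
  have h1 : ∑ i, (g x (a • y + b • z) (s i) + (r (a • y + b • z)).toReal) ≤
      ∑ i, (a * (g x y (s i) + (r y).toReal) + b * (g x z (s i) + (r z).toReal)
        + τbar / 2 * (a * b) * ‖y - z‖ ^ 2) :=
    Finset.sum_le_sum fun i _ => (hs i).weak x hx y hy z hz a b ha hb hab
  have e : ∀ (u v : Fin m → ℝ) (c : ℝ),
      ∑ i, (a * u i + b * v i + c) = a * ∑ i, u i + b * ∑ i, v i + m * c := by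
    intro u v c
    rw [Finset.sum_add_distrib, Finset.sum_add_distrib, ← Finset.mul_sum, ← Finset.mul_sum,
      Finset.sum_const, Finset.card_univ, Fintype.card_fin, nsmul_eq_mul]
  rw [e] at h1
  have h2 := mul_le_mul_of_nonneg_left h1 (one_div_pos.mpr hm').le
  refine h2.trans (le_of_eq ?_)
  field_simp

lemma batchR_ge (hm : 0 < m) (hs : ∀ i, GoodSample r g V τbar G L (s i)) {x y : Vec d}
    (hx : x ∈ V) (hy : y ∈ V) :
    batchR g r x s x - ((1 / (m : ℝ)) * ∑ i, (L (s i) : ℝ)) * G ‖x‖₊ * ‖y - x‖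
      - τbar / 2 * ‖y - x‖ ^ 2 ≤ batchR g r x s y := by
  have hm' : (0 : ℝ) < m := by positivity
  rw [batchR_eq hm, batchR_eq hm]
  have h1 : ∑ i, (g x x (s i) + (r x).toReal - L (s i) * G ‖x‖₊ * ‖y - x‖
      - τbar / 2 * ‖y - x‖ ^ 2) ≤ ∑ i, (g x y (s i) + (r y).toReal) :=
    Finset.sum_le_sum fun i _ => (hs i).ge x hx y hy
  have e : ∀ (u v : Fin m → ℝ) (b c : ℝ),
      ∑ i, (u i - v i * b - c) = ∑ i, u i - (∑ i, v i) * b - m * c := by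
    intro u v b c
    rw [Finset.sum_sub_distrib, Finset.sum_sub_distrib, ← Finset.sum_mul,
      Finset.sum_const, Finset.card_univ, Fintype.card_fin, nsmul_eq_mul]
  simp only [mul_assoc] at h1 ⊢
  rw [e fun i => g x x (s i) + (r x).toReal] at h1
  have h2 := mul_le_mul_of_nonneg_left h1 (one_div_pos.mpr hm').le
  refine le_trans (le_of_eq ?_) h2
  field_simp

/-- Quadratic growth of the subproblem gives an upper bound for the distance from `z` to the
minimizing limit `p`, once its infimum is bounded below by the linear minorant of the model. The
inexactness is added by Young's inequality. -/
theorem one_step (hS : Setting P f r g V ηbar τbar Lφ G L) (hm : 0 < m)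
    (hs : ∀ i, GoodSample r g V τbar G L (s i)) {M : Vec d →L[ℝ] Vec d} (hM : IsPrecond M)
    {Λ : ℝ} (hΛ : ∀ v, ‖v‖ ≤ Λ * normM M v) {α ε θ : ℝ} (hα : 0 < α)
    (hτα : Λ ^ 2 * τbar * α < 1) (hε : 0 ≤ ε) (hθ : 0 < θ) {x x' z : Vec d} (hx : x ∈ V)
    (hz : z ∈ V)
    (hcrit : CriterionA (subproblem g r M α x s) M ε x' ∨
      CriterionB (subproblem g r M α x s) (Λ ^ 2 * τbar) α ε x' ∨
      CriterionC (subproblem g r M α x s) M (Λ ^ 2 * τbar) α ε x') :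
    normM M (z - x') ^ 2 ≤
      (1 + θ) * ((1 - Λ ^ 2 * τbar * α)⁻¹ * normM M (z - x) ^ 2
        + 2 * (α / (1 - Λ ^ 2 * τbar * α)) * (batchR g r x s z - batchR g r x s x)
        + (α / (1 - Λ ^ 2 * τbar * α)) ^ 2 * (Λ * (((1 / (m : ℝ)) * ∑ i, (L (s i) : ℝ))
          * G ‖x‖₊)) ^ 2) + (1 + θ⁻¹) * ε ^ 2 := by
  set K := ((1 / (m : ℝ)) * ∑ i, (L (s i) : ℝ)) * G ‖x‖₊ with hK
  have hK0 : 0 ≤ K := by positivity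
  set h : Vec d → ℝ := fun y => batchR g r x s y + α⁻¹ / 2 * normM M (y - x) ^ 2 with hh
  set κ := (1 - Λ ^ 2 * τbar * α) / α with hκdef
  have hκ : 0 < κ := div_pos (by linarith) hα
  have hκ' : α⁻¹ - Λ ^ 2 * τbar = κ := by rw [hκdef]; field_simp
  have hrep : Represents V h (subproblem g r M α x s) := by
    have h1 := (hS.represents_coe_add fun y => (1 / (m : ℝ)) * ∑ i, g x y (s i)).add_coe
      fun y => 1 / (2 * α) * normM M (y - x) ^ 2
    have h2 : 1 / (2 * α) = α⁻¹ / 2 := by field_simp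
    rw [h2] at h1
    unfold subproblem
    rw [h2]
    exact h1
  have hstrong : StrongOn V M κ h := by
    have := (weakOn_batchR hm hs hx).add_quad hS.comp.τbar_nonneg hM hΛ α⁻¹ x
    rwa [hκ'] at this
  -- After the weak convexity term has reduced `α⁻¹` to `κ`, completing the square in `κ / 2 * t ^ 2
  -- - Λ * K * t` gives the constant.
  have hlow : ∀ y ∈ V, batchR g r x s x - (Λ * K) ^ 2 / (2 * κ) ≤ h y := by
    intro y hy
    have h1 := batchR_ge hm hs hx hy
    rw [← hK] at h1
    have hτ := hS.comp.τbar_nonneg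
    have h2 : ‖y - x‖ ^ 2 ≤ Λ ^ 2 * normM M (y - x) ^ 2 := by
      rw [← mul_pow]
      exact pow_le_pow_left₀ (norm_nonneg _) (hΛ _) 2
    have h3 := mul_le_mul_of_nonneg_left h2 (half_pos_or hτ)
    have h4 := mul_le_mul_of_nonneg_left (hΛ (y - x)) hK0
    have h5 : 0 ≤ κ / 2 * (normM M (y - x) - Λ * K / κ) ^ 2 := by positivity
    have h6 : κ / 2 * (normM M (y - x) - Λ * K / κ) ^ 2 =
        κ / 2 * normM M (y - x) ^ 2 - Λ * K * normM M (y - x) + (Λ * K) ^ 2 / (2 * κ) := by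
      field_simp
      ring
    rw [h6] at h5
    have h7 : κ / 2 * normM M (y - x) ^ 2 = α⁻¹ / 2 * normM M (y - x) ^ 2
        - τbar / 2 * (Λ ^ 2 * normM M (y - x) ^ 2) := by
      rw [← hκ']
      ring
    simp only [hh]
    linarith
  obtain ⟨w, p, hw⟩ := exists_minLimit hS.model.convex hS.nonempty hΛ hκ hstrong ⟨_, hlow⟩
  have hdist := normM_sub_le_of_criterion hS.model.convex hS.nonempty hM hrep hα hτα hε hstrong hw
    hcrit
  have hI : batchR g r x s x - (Λ * K) ^ 2 / (2 * κ) ≤ sInf (h '' V) := by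
    refine le_csInf (hS.nonempty.image _) ?_
    rintro _ ⟨y, hy, rfl⟩
    exact hlow y hy
  have hzg := hw.growth z hz
  have hmain : normM M (z - p) ^ 2 ≤ (1 - Λ ^ 2 * τbar * α)⁻¹ * normM M (z - x) ^ 2
        + 2 * (α / (1 - Λ ^ 2 * τbar * α)) * (batchR g r x s z - batchR g r x s x)
        + (α / (1 - Λ ^ 2 * τbar * α)) ^ 2 * (Λ * K) ^ 2 := by
    have h1 : κ / 2 * normM M (z - p) ^ 2 ≤ batchR g r x s z + α⁻¹ / 2 * normM M (z - x) ^ 2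
        - batchR g r x s x + (Λ * K) ^ 2 / (2 * κ) := by
      simp only [hh] at hzg hI
      linarith
    have h2 := mul_le_mul_of_nonneg_left h1 (by positivity : 0 ≤ 2 / κ)
    have h3 : 2 / κ * (κ / 2 * normM M (z - p) ^ 2) = normM M (z - p) ^ 2 := by field_simp
    have h4 : 1 - Λ ^ 2 * τbar * α ≠ 0 := by linarith
    rw [h3] at h2
    refine h2.trans (le_of_eq ?_)
    have h5 : α / (1 - Λ ^ 2 * τbar * α) = κ⁻¹ := by rw [hκdef, inv_div]
    have h6 : (1 - Λ ^ 2 * τbar * α)⁻¹ = κ⁻¹ * α⁻¹ := by rw [hκdef]; field_simp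
    rw [h5, h6]
    field_simp
    ring
  have hsplit : z - x' = (z - p) + (p - x') := by abel
  have hε2 : normM M (p - x') ^ 2 ≤ ε ^ 2 := by
    rw [normM_sub_comm]
    exact pow_le_pow_left₀ (normM_nonneg _ _) hdist 2
  rw [hsplit]
  refine (hM.normM_sq_add_le _ _ hθ).trans ?_
  have h1 := mul_le_mul_of_nonneg_left hmain (by linarith : 0 ≤ 1 + θ)
  have h2 := mul_le_mul_of_nonneg_left hε2 (by positivity : 0 ≤ 1 + θ⁻¹)
  linarith
where
  half_pos_or {t : ℝ} (ht : 0 ≤ t) : 0 ≤ t / 2 := by linarith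

end Data

/-! ### Conditional expectations with respect to the sampling filtration -/

section Freezing

variable {Ω S E : Type*} {m' m0 : MeasurableSpace Ω} [MeasurableSpace S] [MeasurableSpace E]
  {Pr : Measure Ω} [IsProbabilityMeasure Pr] {P : Measure S} [IsProbabilityMeasure P]
  {X : Ω → E} {T : Ω → S} {H : E × S → ℝ}

lemma map_prodMk_of_indep (hm : m' ≤ m0) (hX : Measurable[m'] X) (hT : Measurable T)
    (hind : Indep (MeasurableSpace.comap T inferInstance) m' Pr) (hlaw : Pr.map T = P) :
    Pr.map (fun ω => (X ω, T ω)) = (Pr.map X).prod P := by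
  have hXT : IndepFun X T Pr := by
    rw [IndepFun_iff_Indep]
    exact (indep_of_indep_of_le_right hind hX.comap_le).symm
  rw [← hlaw]
  exact (indepFun_iff_map_prod_eq_prod_map_map (hX.mono hm le_rfl).aemeasurable
    hT.aemeasurable).mp hXT

/-- A function of a variable `X` and an independent variable is integrable if its partial
expectations are. -/
lemma integrable_comp_of_indep (hm : m' ≤ m0) (hX : Measurable[m'] X) (hT : Measurable T)
    (hind : Indep (MeasurableSpace.comap T inferInstance) m' Pr) (hlaw : Pr.map T = P)
    (hH : Measurable H) (hs : ∀ x, Integrable (fun s => H (x, s)) P)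
    (hb : Integrable (fun ω => ∫ s, ‖H (X ω, s)‖ ∂P) Pr) :
    Integrable (fun ω => H (X ω, T ω)) Pr := by
  have hX' : Measurable X := hX.mono hm le_rfl
  have h1 : Integrable H ((Pr.map X).prod P) := by
    rw [integrable_prod_iff hH.aestronglyMeasurable]
    refine ⟨Eventually.of_forall hs, ?_⟩
    rw [integrable_map_measure _ hX'.aemeasurable]
    · exact hb
    · exact (hH.norm.stronglyMeasurable.integral_prod_right').aestronglyMeasurable
  rw [← map_prodMk_of_indep hm hX hT hind hlaw] at h1
  exact (integrable_map_measure hH.aestronglyMeasurable (hX'.prodMk hT).aemeasurable).mp h1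

/-- Conditional expectation of a function of a known and an independent variable. -/
theorem condExp_comp_of_indep (hm : m' ≤ m0) (hX : Measurable[m'] X) (hT : Measurable T)
    (hind : Indep (MeasurableSpace.comap T inferInstance) m' Pr) (hlaw : Pr.map T = P)
    (hH : Measurable H) (hint : Integrable (fun ω => H (X ω, T ω)) Pr) :
    Pr[fun ω => H (X ω, T ω) | m'] =ᵐ[Pr] fun ω => ∫ s, H (X ω, s) ∂P := by
  have hX' : Measurable X := hX.mono hm le_rfl
  have hHi : Integrable H ((Pr.map X).prod P) := by
    rw [← map_prodMk_of_indep hm hX hT hind hlaw]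
    exact (integrable_map_measure hH.aestronglyMeasurable (hX'.prodMk hT).aemeasurable).mpr hint
  have hJ : StronglyMeasurable fun x => ∫ s, H (x, s) ∂P :=
    hH.stronglyMeasurable.integral_prod_right'
  have hJi : Integrable (fun ω => ∫ s, H (X ω, s) ∂P) Pr :=
    (integrable_map_measure hJ.aestronglyMeasurable hX'.aemeasurable).mp hHi.integral_prod_left
  symm
  refine ae_eq_condExp_of_forall_setIntegral_eq hm hint (fun _ _ _ => hJi.integrableOn) ?_
    (hJ.comp_measurable hX).aestronglyMeasurable
  intro A hA _
  have hA0 : MeasurableSet A := hm _ hA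
  -- Adjoining the indicator of the test set `A` keeps the pair measurable for `m'`, hence
  -- independent of `T`, so Fubini computes the integral over `A` as well.
  set Y : Ω → E × ℝ := fun ω => (X ω, A.indicator 1 ω) with hY
  have hind1 : Measurable[m'] (A.indicator (1 : Ω → ℝ)) := (stronglyMeasurable_one.indicator hA).measurable
  have hYm : Measurable[m'] Y := hX.prodMk hind1
  have hY' : Measurable Y := hYm.mono hm le_rfl
  set H' : (E × ℝ) × S → ℝ := fun p => p.1.2 * H (p.1.1, p.2) with hH'
  have hH'm : Measurable H' :=
    (measurable_snd.comp measurable_fst).mul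
      (hH.comp ((measurable_fst.comp measurable_fst).prodMk measurable_snd))
  have hcomp : ∀ F : Ω → ℝ, ∫ ω in A, F ω ∂Pr = ∫ ω, A.indicator 1 ω * F ω ∂Pr := by
    intro F
    rw [← integral_indicator hA0]
    refine integral_congr_ae (Eventually.of_forall fun ω => ?_)
    by_cases h : ω ∈ A <;> simp [h]
  have hint' : Integrable (fun ω => H' (Y ω, T ω)) Pr := by
    refine (hint.indicator hA0).congr (Eventually.of_forall fun ω => ?_)
    by_cases h : ω ∈ A <;> simp [h, H', Y]
  have hH'i : Integrable H' ((Pr.map Y).prod P) := by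
    rw [← map_prodMk_of_indep hm hYm hT hind hlaw]
    exact (integrable_map_measure hH'm.aestronglyMeasurable (hY'.prodMk hT).aemeasurable).mpr
      hint'
  have e1 : ∫ ω, H' (Y ω, T ω) ∂Pr = ∫ p, H' p ∂((Pr.map Y).prod P) := by
    rw [← map_prodMk_of_indep hm hYm hT hind hlaw]
    exact (integral_map (hY'.prodMk hT).aemeasurable hH'm.aestronglyMeasurable).symm
  have e2 : ∫ p, H' p ∂((Pr.map Y).prod P) = ∫ ω, ∫ s, H' (Y ω, s) ∂P ∂Pr := by
    rw [integral_prod _ hH'i]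
    exact integral_map hY'.aemeasurable
      hH'm.stronglyMeasurable.integral_prod_right'.aestronglyMeasurable
  rw [hcomp, hcomp]
  simp only [← integral_const_mul]
  exact (e1.trans e2).symm

end Freezing

/-! ### The filtration of the minibatches and its independence of the next one -/

section Filtration

variable {Ω S : Type*} [MeasurableSpace S] [m0 : MeasurableSpace Ω] {P : Measure S}
  {Pr : Measure Ω} {m : ℕ} {samp : ℕ → Fin m → Ω → S}

lemma IIDSampling.sampleSigma_le (h : IIDSampling P Pr samp) (k : ℕ) :
    sampleSigma samp k ≤ m0 := by
  refine iSup₂_le fun j hj => iSup_le fun i => ?_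
  exact (h.measurable j (Finset.mem_Icc.mp hj).1 i).comap_le

/-- The filtration generated by the minibatches. -/
def IIDSampling.filtration (h : IIDSampling P Pr samp) : Filtration ℕ m0 where
  seq := sampleSigma samp
  mono' := fun _ _ hkl => biSup_mono fun _ hj =>
    Finset.mem_Icc.mpr ⟨(Finset.mem_Icc.mp hj).1, (Finset.mem_Icc.mp hj).2.trans hkl⟩
  le' := h.sampleSigma_le

lemma IIDSampling.indep_succ (h : IIDSampling P Pr samp) (n : ℕ) (i : Fin m) :
    Indep (MeasurableSpace.comap (samp (n + 1) i) inferInstance) (sampleSigma samp n) Pr := by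
  have h1 : ∀ p : ℕ × Fin m, MeasurableSpace.comap (samp (p.1 + 1) p.2) inferInstance ≤ m0 :=
    fun p => (h.measurable (p.1 + 1) (Nat.le_add_left 1 _) p.2).comap_le
  -- The independent family is shifted by one: index `(j, i)` stands for a sample of minibatch `j +
  -- 1`, so minibatches `1, …, n` are the indices below `n`.
  have h2 := indep_iSup_of_disjoint h1 h.indep (S := {(n, i)}) (T := {p | p.1 < n})
    (by
      rw [Set.disjoint_left]
      rintro p hp hp'
      rw [Set.mem_singleton_iff.mp hp] at hp'
      exact lt_irrefl n hp')
  refine indep_of_indep_of_le_left (indep_of_indep_of_le_right h2 ?_) ?_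
  · refine iSup₂_le fun j hj => iSup_le fun i' => ?_
    obtain ⟨hj1, hj2⟩ := Finset.mem_Icc.mp hj
    obtain ⟨j, rfl⟩ : ∃ j', j = j' + 1 := ⟨j - 1, by omega⟩
    exact le_iSup₂_of_le (f := fun (p : ℕ × Fin m) (_ : p ∈ {p : ℕ × Fin m | p.1 < n}) =>
      MeasurableSpace.comap (samp (p.1 + 1) p.2) inferInstance) (j, i')
      (show j < n by omega) le_rfl
  · exact le_iSup₂_of_le (f := fun (p : ℕ × Fin m) (_ : p ∈ ({(n, i)} : Set (ℕ × Fin m))) =>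
      MeasurableSpace.comap (samp (p.1 + 1) p.2) inferInstance) (n, i) rfl le_rfl

end Filtration

/-! ### Random quadratic forms -/

section Quadratic

variable {Ω : Type*} {m' m0 : MeasurableSpace Ω} {Pr : Measure Ω} [IsProbabilityMeasure Pr] {d : ℕ}

/-- The entries of a linear map. -/
noncomputable def entry (A : Vec d →L[ℝ] Vec d) (i j : Fin d) : ℝ :=
  ⟪EuclideanSpace.basisFun (Fin d) ℝ i, A (EuclideanSpace.basisFun (Fin d) ℝ j)⟫

/-- Coordinates separate the random matrix from the vector, so measurability and conditional
expectations reduce to scalar entries. -/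
lemma inner_apply_eq_sum (A : Vec d →L[ℝ] Vec d) (v : Vec d) :
    ⟪v, A v⟫ = ∑ i, ∑ j, v i * v j * entry A i j := by
  have hv : v = ∑ i, v i • EuclideanSpace.basisFun (Fin d) ℝ i :=
    ((EuclideanSpace.basisFun (Fin d) ℝ).sum_repr v).symm
  conv_lhs => rw [hv]
  rw [map_sum, sum_inner]
  refine Finset.sum_congr rfl fun i _ => ?_
  rw [inner_sum]
  refine Finset.sum_congr rfl fun j _ => ?_
  rw [map_smul, inner_smul_left, inner_smul_right, entry]
  simp only [conj_trivial]
  ring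

lemma measurable_entry {A : Ω → Vec d →L[ℝ] Vec d} (hA : ∀ v, Measurable[m'] fun ω => A ω v)
    (i j : Fin d) : Measurable[m'] fun ω => entry (A ω) i j :=
  measurable_const.inner (hA _)

lemma measurable_coord {v : Ω → Vec d} (hv : Measurable[m'] v) (i : Fin d) :
    Measurable[m'] fun ω => v ω i :=
  (EuclideanSpace.proj (𝕜 := ℝ) i).measurable.comp hv

lemma measurable_inner_apply {A : Ω → Vec d →L[ℝ] Vec d}
    (hA : ∀ v, Measurable[m'] fun ω => A ω v) {v : Ω → Vec d} (hv : Measurable[m'] v) :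
    Measurable[m'] fun ω => ⟪v ω, A ω (v ω)⟫ := by
  simp only [inner_apply_eq_sum]
  exact Finset.measurable_fun_sum _ fun i _ => Finset.measurable_fun_sum _ fun j _ =>
    ((measurable_coord hv i).mul (measurable_coord hv j)).mul (measurable_entry hA i j)

lemma abs_coord_le (v : Vec d) (i : Fin d) : |v i| ≤ ‖v‖ := by
  rw [← Real.norm_eq_abs]
  exact PiLp.norm_apply_le v i

variable {A : Ω → Vec d →L[ℝ] Vec d} {C : ℝ}

lemma integrable_coord_mul_entry (hm : m' ≤ m0) (hA : ∀ v, Measurable fun ω => A ω v)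
    (hC : ∀ᵐ ω ∂Pr, ∀ i j, |entry (A ω) i j| ≤ C) {v : Ω → Vec d} (hv : Measurable[m'] v)
    (hvi : Integrable (fun ω => ‖v ω‖ ^ 2) Pr) (i j : Fin d) :
    Integrable (fun ω => v ω i * v ω j * entry (A ω) i j) Pr := by
  have hv' := hv.mono hm le_rfl
  refine (hvi.mul_const C).mono' (((measurable_coord hv' i).mul
    (measurable_coord hv' j)).mul (measurable_entry hA i j)).aestronglyMeasurable ?_
  filter_upwards [hC] with ω hω
  rw [norm_mul, norm_mul, Real.norm_eq_abs, Real.norm_eq_abs, Real.norm_eq_abs, pow_two]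
  have h1 := abs_coord_le (v ω) i
  have h2 := abs_coord_le (v ω) j
  have := hω i j
  gcongr

lemma integrable_inner_apply (hm : m' ≤ m0) (hA : ∀ v, Measurable fun ω => A ω v)
    (hC : ∀ᵐ ω ∂Pr, ∀ i j, |entry (A ω) i j| ≤ C) {v : Ω → Vec d} (hv : Measurable[m'] v)
    (hvi : Integrable (fun ω => ‖v ω‖ ^ 2) Pr) :
    Integrable (fun ω => ⟪v ω, A ω (v ω)⟫) Pr := by
  simp only [inner_apply_eq_sum]
  exact integrable_finsetSum _ fun i _ => integrable_finsetSum _ fun j _ =>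
    integrable_coord_mul_entry hm hA hC hv hvi i j

/-- Conditional expectation of a random quadratic form at a known random vector. -/
lemma condExp_inner_apply (hm : m' ≤ m0) (hA : ∀ v, Measurable fun ω => A ω v)
    (hC : ∀ᵐ ω ∂Pr, ∀ i j, |entry (A ω) i j| ≤ C) {v : Ω → Vec d} (hv : Measurable[m'] v)
    (hvi : Integrable (fun ω => ‖v ω‖ ^ 2) Pr) :
    Pr[fun ω => ⟪v ω, A ω (v ω)⟫ | m'] =ᵐ[Pr]
      fun ω => ∑ i, ∑ j, v ω i * v ω j * (Pr[fun ω' => entry (A ω') i j | m']) ω := by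
  have hei : ∀ i j, Integrable (fun ω => entry (A ω) i j) Pr := fun i j =>
    Integrable.of_bound (measurable_entry hA i j).aestronglyMeasurable C
      (hC.mono fun ω hω => hω i j)
  have h1 : (fun ω => ⟪v ω, A ω (v ω)⟫) =
      ∑ i, ∑ j, fun ω => v ω i * v ω j * entry (A ω) i j := by
    ext ω
    simp only [Finset.sum_apply, inner_apply_eq_sum]
  rw [h1]
  have h2 := condExp_finsetSum (μ := Pr) (s := Finset.univ)
    (f := fun i => ∑ j, fun ω => v ω i * v ω j * entry (A ω) i j)
    (fun i _ => integrable_finsetSum' _ fun j _ =>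
      integrable_coord_mul_entry hm hA hC hv hvi i j) m'
  have h3 : ∀ i, _ := fun i => condExp_finsetSum (μ := Pr) (s := Finset.univ)
    (f := fun j ω => v ω i * v ω j * entry (A ω) i j)
    (fun j _ => integrable_coord_mul_entry hm hA hC hv hvi i j) m'
  have h4 : ∀ i j, Pr[fun ω => v ω i * v ω j * entry (A ω) i j | m'] =ᵐ[Pr]
      fun ω => v ω i * v ω j * (Pr[fun ω' => entry (A ω') i j | m']) ω := fun i j =>
    condExp_mul_of_stronglyMeasurable_left
      ((measurable_coord hv i).mul (measurable_coord hv j)).stronglyMeasurable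
      (integrable_coord_mul_entry hm hA hC hv hvi i j) (hei i j)
  filter_upwards [h2, ae_all_iff.mpr h3, ae_all_iff.mpr fun i => ae_all_iff.mpr (h4 i)]
    with ω h2 h3 h4
  rw [h2, Finset.sum_apply]
  refine Finset.sum_congr rfl fun i _ => ?_
  rw [h3, Finset.sum_apply]
  exact Finset.sum_congr rfl fun j _ => h4 i j

/-- A conditional comparison of two random quadratic forms at every fixed vector extends to known
random vectors. -/
theorem condExp_inner_apply_le (hm : m' ≤ m0) (hA : ∀ v, Measurable fun ω => A ω v)
    (hC : ∀ᵐ ω ∂Pr, ∀ i j, |entry (A ω) i j| ≤ C) {B : Ω → Vec d →L[ℝ] Vec d} {c : ℝ}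
    (hfix : ∀ v : Vec d, ∀ᵐ ω ∂Pr, (Pr[fun ω' => ⟪v, A ω' v⟫ | m']) ω ≤ c * ⟪v, B ω v⟫)
    {v : Ω → Vec d} (hv : Measurable[m'] v) (hvi : Integrable (fun ω => ‖v ω‖ ^ 2) Pr) :
    ∀ᵐ ω ∂Pr, (Pr[fun ω' => ⟪v ω', A ω' (v ω')⟫ | m']) ω ≤ c * ⟪v ω, B ω (v ω)⟫ := by
  -- A countable dense set leaves one null set. Off it both sides are continuous in the vector for
  -- fixed outcome, so the inequality holds for every vector, in particular for the random one.
  obtain ⟨D, hDc, hD⟩ := TopologicalSpace.exists_countable_dense (Vec d)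
  have h1 : ∀ᵐ ω ∂Pr, ∀ u ∈ D,
      ∑ i, ∑ j, u i * u j * (Pr[fun ω' => entry (A ω') i j | m']) ω ≤ c * ⟪u, B ω u⟫ := by
    rw [ae_ball_iff hDc]
    intro u _
    filter_upwards [hfix u, condExp_inner_apply hm hA hC (v := fun _ => u)
      measurable_const (integrable_const _)] with ω h1 h2
    rwa [← h2]
  filter_upwards [h1, condExp_inner_apply hm hA hC hv hvi] with ω h1 h2
  rw [h2]
  have hcl : IsClosed {u : Vec d |
      ∑ i, ∑ j, u i * u j * (Pr[fun ω' => entry (A ω') i j | m']) ω ≤ c * ⟪u, B ω u⟫} := by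
    refine isClosed_le ?_ ?_
    · fun_prop
    · fun_prop
  exact hcl.closure_subset_iff.mpr h1 (hD (v ω))

end Quadratic

/-! ### The standing assumptions and their constants -/

/-- All assumptions of the convergence theorem, in positive dimension. -/
structure Run {d m : ℕ} {S : Type*} [MeasurableSpace S] (P : Measure S)
    {Ω : Type*} [MeasurableSpace Ω] (Pr : Measure Ω)
    (f : S → Vec d → EReal) (r : Vec d → EReal) (g : Vec d → Vec d → S → ℝ) (V : Set (Vec d))
    (ηbar τbar μinf Linf Lφ γ ρbar : ℝ) (G : ℝ≥0 → ℝ≥0) (L : S → ℝ≥0)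
    (samp : ℕ → Fin m → Ω → S) (M : ℕ → Ω → Vec d →L[ℝ] Vec d) (ρ : ℕ → ℝ)
    (x : ℕ → Ω → Vec d) (α ε : ℕ → Ω → ℝ) (αbar : ℕ → ℝ) : Prop where
  dim_pos : 0 < d
  batch_pos : 0 < m
  setting : Setting P f r g V ηbar τbar Lφ G L
  sampling : IIDSampling P Pr samp
  precond : PrecondAssumption Pr samp M ρ μinf Linf
  alg : IsIspPPA Pr samp g r V M (Linf ^ 2 * τbar) α ε x
  γ_nonneg : 0 ≤ γ
  ρbar_gt : (⨆ k : ℕ, (ρ (k + 1)) ^ 2) * (Linf ^ 2 * ηbar + 2 * (Linf ^ 2 * τbar)) < ρbar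
  α_eq : ∀ k, 1 ≤ k → ∀ ω, α k ω = αbar k / max 1 (G ‖x k ω‖₊ : ℝ)
  ε_eq : ∀ k, 1 ≤ k → ∀ ω, ε k ω = γ * (α k ω) ^ 2
  αbar_pos : ∀ k, 1 ≤ k → 0 < αbar k
  αbar_sup : (⨆ k : ℕ, αbar (k + 1)) < (2 * ρbar)⁻¹
  αbar_sq : Summable fun k : ℕ => (αbar (k + 1)) ^ 2

/-! ### Step sizes as functions of the current point -/

section Steps

variable {d : ℕ}

/-- The step size at the point `y` in iteration `k`. -/
noncomputable def stepSize (G : ℝ≥0 → ℝ≥0) (αbar : ℕ → ℝ) (k : ℕ) (y : Vec d) : ℝ :=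
  αbar k / max 1 (G ‖y‖₊ : ℝ)

/-- The factor `1 / (1 - τ α)`. -/
noncomputable def stepFactor (Linf τbar : ℝ) (G : ℝ≥0 → ℝ≥0) (αbar : ℕ → ℝ) (k : ℕ)
    (y : Vec d) : ℝ :=
  (1 - Linf ^ 2 * τbar * stepSize G αbar k y)⁻¹

/-- The weighted increment of the sampled model between `y` and `z`. -/
noncomputable def increment {S : Type*} (Linf τbar : ℝ) (G : ℝ≥0 → ℝ≥0) (αbar : ℕ → ℝ)
    (g : Vec d → Vec d → S → ℝ) (r : Vec d → EReal) (V : Set (Vec d)) (k : ℕ) (z : Vec d) :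
    Vec d × S → ℝ :=
  {p : Vec d × S | p.1 ∈ V}.indicator fun p =>
    2 * (stepSize G αbar k p.1 * stepFactor Linf τbar G αbar k p.1) *
      (g p.1 z p.2 + (r z).toReal - (g p.1 p.1 p.2 + (r p.1).toReal))

end Steps

/-! ### Numerical consequences of the assumptions and the pathwise step estimate -/

namespace Run

variable {d m : ℕ} {S : Type*} [MeasurableSpace S] {P : Measure S} [IsProbabilityMeasure P]
  {Ω : Type*} [m0 : MeasurableSpace Ω] {Pr : Measure Ω} [IsProbabilityMeasure Pr]
  {f : S → Vec d → EReal} {r : Vec d → EReal} {g : Vec d → Vec d → S → ℝ} {V : Set (Vec d)}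
  {ηbar τbar μinf Linf Lφ γ ρbar : ℝ} {G : ℝ≥0 → ℝ≥0} {L : S → ℝ≥0}
  {samp : ℕ → Fin m → Ω → S} {M : ℕ → Ω → Vec d →L[ℝ] Vec d} {ρ : ℕ → ℝ}
  {x : ℕ → Ω → Vec d} {α ε : ℕ → Ω → ℝ} {αbar : ℕ → ℝ}
  (hR : Run P Pr f r g V ηbar τbar μinf Linf Lφ γ ρbar G L samp M ρ x α ε αbar)
include hR

lemma ηbar_nonneg : 0 ≤ ηbar := hR.setting.ηbar_nonneg hR.dim_pos

lemma τbar_nonneg : 0 ≤ τbar := hR.setting.comp.τbar_nonneg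

lemma exists_prod_le : ∃ B, ∀ n, ∏ i ∈ Finset.range n, ρ i ≤ B := by
  obtain ⟨ν, hν⟩ := hR.precond.prod_tendsto
  obtain ⟨B, hB⟩ := hν.bddAbove_range
  exact ⟨B, fun n => hB ⟨n, rfl⟩⟩

lemma exists_ρ_le : ∃ B, ∀ n, ρ n ≤ B := by
  obtain ⟨B, hB⟩ := hR.exists_prod_le
  refine ⟨B, fun n => le_trans ?_ (hB (n + 1))⟩
  rw [Finset.prod_range_succ]
  exact le_mul_of_one_le_left (by linarith [hR.precond.ρ_ge n])
    (Finset.one_le_prod fun i _ => hR.precond.ρ_ge i)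

/-- For factors at least `1` the product dominates one plus the sum of the excesses. -/
lemma summable_ρ_sub_one : Summable fun n => ρ n - 1 := by
  obtain ⟨B, hB⟩ := hR.exists_prod_le
  refine summable_of_sum_range_le (c := B) (fun n => by linarith [hR.precond.ρ_ge n]) fun n => ?_
  refine le_trans ?_ (hB n)
  have h : ∀ n, ∑ i ∈ Finset.range n, (ρ i - 1) + 1 ≤ ∏ i ∈ Finset.range n, ρ i := by
    intro n
    induction n with
    | zero => simp
    | succ n ih =>
      rw [Finset.sum_range_succ, Finset.prod_range_succ]
      have h1 := hR.precond.ρ_ge n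
      have h2 : (1 : ℝ) ≤ ∏ i ∈ Finset.range n, ρ i :=
        Finset.one_le_prod fun i _ => hR.precond.ρ_ge i
      nlinarith
  linarith [h n]

lemma summable_ρ_sq : Summable fun n => ρ (n + 1) ^ 2 - 1 := by
  obtain ⟨B, hB⟩ := hR.exists_ρ_le
  have h1 : Summable fun n => (B + 1) * (ρ (n + 1) - 1) :=
    ((summable_nat_add_iff 1).mpr hR.summable_ρ_sub_one).mul_left _
  refine Summable.of_nonneg_of_le (fun n => ?_) (fun n => ?_) h1
  · nlinarith [hR.precond.ρ_ge (n + 1)]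
  · nlinarith [hR.precond.ρ_ge (n + 1), hB (n + 1)]

lemma ρ_sq_le (n : ℕ) : ρ (n + 1) ^ 2 ≤ ⨆ k : ℕ, ρ (k + 1) ^ 2 := by
  obtain ⟨B, hB⟩ := hR.exists_ρ_le
  refine le_ciSup (f := fun k : ℕ => ρ (k + 1) ^ 2) ⟨B ^ 2, ?_⟩ n
  rintro _ ⟨k, rfl⟩
  exact pow_le_pow_left₀ (by linarith [hR.precond.ρ_ge (k + 1)]) (hB _) 2

lemma one_le_ρ_sq (n : ℕ) : 1 ≤ ρ n ^ 2 := one_le_pow₀ (hR.precond.ρ_ge n)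

/-- Since `ηbar ≥ 0` and `B_ρ ≥ ρ ^ 2 ≥ 1`, the factor can be dropped from the first term and
lowered in the second. -/
lemma constants_le (n : ℕ) :
    Linf ^ 2 * ηbar + ρ (n + 1) ^ 2 * (2 * (Linf ^ 2 * τbar)) < ρbar := by
  have h1 := hR.ρ_sq_le n
  have h2 := hR.one_le_ρ_sq (n + 1)
  have h3 : 0 ≤ Linf ^ 2 * ηbar := mul_nonneg (sq_nonneg _) hR.ηbar_nonneg
  have h4 : 0 ≤ Linf ^ 2 * τbar := mul_nonneg (sq_nonneg _) hR.τbar_nonneg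
  have h5 := hR.ρbar_gt
  nlinarith

lemma ρbar_pos : 0 < ρbar := by
  have h1 := hR.constants_le 0
  have h3 : 0 ≤ Linf ^ 2 * ηbar := mul_nonneg (sq_nonneg _) hR.ηbar_nonneg
  have h4 : 0 ≤ Linf ^ 2 * τbar := mul_nonneg (sq_nonneg _) hR.τbar_nonneg
  have := mul_nonneg (sq_nonneg (ρ (0 + 1))) (mul_nonneg zero_le_two h4)
  linarith

lemma curvature_pos : 0 < ρbar - Linf ^ 2 * (ηbar + τbar) := by
  have h1 := hR.constants_le 0
  have h2 := hR.one_le_ρ_sq (0 + 1)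
  have h4 : 0 ≤ Linf ^ 2 * τbar := mul_nonneg (sq_nonneg _) hR.τbar_nonneg
  nlinarith

lemma two_τ_le : 2 * (Linf ^ 2 * τbar) ≤ ρbar := by
  have h1 := hR.constants_le 0
  have h2 := hR.one_le_ρ_sq (0 + 1)
  have h3 : 0 ≤ Linf ^ 2 * ηbar := mul_nonneg (sq_nonneg _) hR.ηbar_nonneg
  have h4 : 0 ≤ Linf ^ 2 * τbar := mul_nonneg (sq_nonneg _) hR.τbar_nonneg
  nlinarith

lemma αbar_succ_pos (n : ℕ) : 0 < αbar (n + 1) := hR.αbar_pos _ (Nat.le_add_left 1 n)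

lemma αbar_le (n : ℕ) : αbar (n + 1) ≤ (2 * ρbar)⁻¹ := by
  refine le_trans (le_ciSup (f := fun k : ℕ => αbar (k + 1)) ?_ n) hR.αbar_sup.le
  -- A real supremum bounds its terms only when the range is bounded; this follows from `t ≤ 1 + t ^
  -- 2` and square summability.
  refine ⟨1 + ∑' k : ℕ, αbar (k + 1) ^ 2, ?_⟩
  rintro _ ⟨k, rfl⟩
  have := hR.αbar_sq.le_tsum k fun _ _ => sq_nonneg _
  beta_reduce
  nlinarith [sq_nonneg (αbar (k + 1) - 1)]

/-- From `2 τ ≤ ρbar` and `αbar ≤ (2 ρbar)⁻¹`. The constant keeps `1 - τ α` away from zero and the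
step factor below `2`. -/
lemma τ_αbar_le (n : ℕ) : Linf ^ 2 * τbar * αbar (n + 1) ≤ 1 / 4 := by
  have h1 := hR.αbar_le n
  have h2 := hR.two_τ_le
  have h4 : 0 ≤ Linf ^ 2 * τbar := mul_nonneg (sq_nonneg _) hR.τbar_nonneg
  have h5 := hR.ρbar_pos
  calc Linf ^ 2 * τbar * αbar (n + 1) ≤ Linf ^ 2 * τbar * (2 * ρbar)⁻¹ := by gcongr
    _ ≤ (ρbar / 2) * (2 * ρbar)⁻¹ := by gcongr; linarith
    _ = 1 / 4 := by field_simp; norm_num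

lemma Linf_pos : 0 < Linf := by linarith [hR.precond.Linf_ge]

/-- The index `0` is included, where `M` is the identity; this is where `μinf ≤ 1 ≤ Linf` is used.
-/
lemma ae_precond (n : ℕ) : ∀ᵐ ω ∂Pr, IsPrecond (M n ω) ∧
    ∀ v, μinf * normM (M n ω) v ≤ ‖v‖ ∧ ‖v‖ ≤ Linf * normM (M n ω) v := by
  rcases Nat.eq_zero_or_pos n with rfl | hn
  · refine Eventually.of_forall fun ω => ?_
    rw [hR.precond.M_zero]
    refine ⟨isPrecond_id, fun v => ?_⟩
    rw [normM_id]
    have := hR.precond.μinf_mem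
    exact ⟨mul_le_of_le_one_left (norm_nonneg _) this.2,
      le_mul_of_one_le_left (norm_nonneg _) hR.precond.Linf_ge⟩
  · obtain ⟨μ, L', h⟩ := hR.precond.norm_equiv
    obtain ⟨h1, h2, h3, h4⟩ := h n hn
    filter_upwards [hR.precond.precond n hn, h4] with ω hω1 hω2
    refine ⟨hω1, fun v => ⟨?_, ?_⟩⟩
    · exact (mul_le_mul_of_nonneg_right h1 (normM_nonneg _ _)).trans (hω2 v).1
    · exact (hω2 v).2.trans (mul_le_mul_of_nonneg_right h3 (normM_nonneg _ _))

lemma measurable_M (n : ℕ) (v : Vec d) : Measurable[sampleSigma samp n] fun ω => M n ω v := by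
  rcases Nat.eq_zero_or_pos n with rfl | hn
  · simp only [hR.precond.M_zero]
    exact measurable_const
  · exact hR.precond.adapted n hn v

lemma measurable_M' (n : ℕ) (v : Vec d) : Measurable fun ω => M n ω v :=
  (hR.measurable_M n v).mono (hR.sampling.sampleSigma_le n) le_rfl

lemma measurable_x (n : ℕ) : Measurable[sampleSigma samp n] (x (n + 1)) := by
  rcases Nat.eq_zero_or_pos n with rfl | hn
  · obtain ⟨x₁, hx⟩ := hR.alg.init
    have : x (0 + 1) = fun _ => x₁ := funext hx
    rw [this]
    exact measurable_const
  · exact hR.alg.adapted n hn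

lemma ae_mem (n : ℕ) : ∀ᵐ ω ∂Pr, x (n + 1) ω ∈ V := hR.alg.mem _ (Nat.le_add_left 1 n)

lemma ae_entry_le (n : ℕ) : ∀ᵐ ω ∂Pr, ∀ i j, |entry (M n ω) i j| ≤ μinf⁻¹ * μinf⁻¹ := by
  have hμ := hR.precond.μinf_mem.1
  filter_upwards [hR.ae_precond n] with ω ⟨h1, h2⟩ i j
  have h3 : ‖M n ω (EuclideanSpace.basisFun (Fin d) ℝ j)‖ ≤ μinf⁻¹ * μinf⁻¹ := by
    refine (h1.norm_apply_le hμ (fun v => (h2 v).1) _).trans ?_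
    gcongr
    rw [← mul_one μinf⁻¹, le_inv_mul_iff₀ hμ]
    refine (h2 _).1.trans ?_
    simp
  refine (abs_real_inner_le_norm _ _).trans ?_
  simpa using h3

lemma normM_sq_measurable (n : ℕ) {v : Ω → Vec d} (hv : Measurable[sampleSigma samp n] v) :
    Measurable[sampleSigma samp n] fun ω => normM (M n ω) (v ω) ^ 2 := by
  have h := measurable_inner_apply (hR.measurable_M n) hv
  exact (Real.continuous_sqrt.measurable.comp h).pow_const 2

/-- The ratio condition as a comparison of quadratic forms at a fixed vector. -/
lemma condExp_inner_fixed_le (n : ℕ) (v : Vec d) :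
    ∀ᵐ ω ∂Pr, (Pr[fun ω' => ⟪v, M (n + 1) ω' v⟫ | sampleSigma samp n]) ω ≤
      ρ (n + 1) ^ 2 * ⟪v, M n ω v⟫ := by
  by_cases hv : v = 0
  · subst hv
    simp only [inner_zero_left, mul_zero]
    rw [show (fun _ : Ω => (0 : ℝ)) = 0 from rfl, condExp_zero]
    exact Eventually.of_forall fun _ => le_rfl
  have hμ := hR.precond.μinf_mem.1
  have hv0 : 0 < ‖v‖ := norm_pos_iff.mpr hv
  set q : Ω → ℝ := fun ω => normM (M (n + 1) ω) v ^ 2 / normM (M n ω) v ^ 2 with hq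
  have hm1 : Measurable[sampleSigma samp n] fun ω => normM (M n ω) v ^ 2 :=
    hR.normM_sq_measurable n measurable_const
  have hle := hR.sampling.sampleSigma_le
  have hm2 : Measurable fun ω => normM (M (n + 1) ω) v ^ 2 :=
    (hR.normM_sq_measurable (n + 1) measurable_const).mono (hle _) le_rfl
  have hm1' : Measurable fun ω => normM (M n ω) v ^ 2 := hm1.mono (hle _) le_rfl
  have hup : ∀ k, ∀ᵐ ω ∂Pr, normM (M k ω) v ^ 2 ≤ (μinf⁻¹ * ‖v‖) ^ 2 := by
    intro k
    filter_upwards [hR.ae_precond k] with ω ⟨_, h2⟩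
    refine pow_le_pow_left₀ (normM_nonneg _ _) ?_ 2
    rw [le_inv_mul_iff₀ hμ]
    exact (h2 v).1
  have hlow : ∀ᵐ ω ∂Pr, ‖v‖ ^ 2 / Linf ^ 2 ≤ normM (M n ω) v ^ 2 := by
    filter_upwards [hR.ae_precond n] with ω ⟨_, h2⟩
    rw [div_le_iff₀ (pow_pos hR.Linf_pos 2), mul_comm, ← mul_pow]
    exact pow_le_pow_left₀ (norm_nonneg _) (h2 v).2 2
  have hlow0 : 0 < ‖v‖ ^ 2 / Linf ^ 2 := div_pos (pow_pos hv0 2) (pow_pos hR.Linf_pos 2)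
  have hqi : Integrable q Pr := by
    refine Integrable.of_bound (hm2.div hm1').aestronglyMeasurable
      ((μinf⁻¹ * ‖v‖) ^ 2 / (‖v‖ ^ 2 / Linf ^ 2)) ?_
    filter_upwards [hup (n + 1), hlow] with ω h1 h2
    rw [Real.norm_eq_abs, abs_of_nonneg (div_nonneg (sq_nonneg _) (sq_nonneg _))]
    exact div_le_div₀ (sq_nonneg _) h1 hlow0 h2
  -- The ratio condition concerns the quotient `q`; its denominator is known after `n` minibatches
  -- and can be pulled out. Norm equivalence bounds both and supplies integrability.
  have heq : (fun ω => ⟪v, M (n + 1) ω v⟫) =ᵐ[Pr] (fun ω => normM (M n ω) v ^ 2) * q := by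
    filter_upwards [hR.ae_precond (n + 1), hlow] with ω ⟨h1, _⟩ h2
    have h3 : normM (M n ω) v ^ 2 ≠ 0 := (hlow0.trans_le h2).ne'
    rw [Pi.mul_apply, hq, ← h1.normM_sq]
    beta_reduce
    generalize normM (M n ω) v ^ 2 = t at h3 ⊢
    field_simp
  have hprod : Integrable ((fun ω => normM (M n ω) v ^ 2) * q) Pr := by
    refine hqi.bdd_mul (c := (μinf⁻¹ * ‖v‖) ^ 2) hm1'.aestronglyMeasurable ?_
    filter_upwards [hup n] with ω h1
    rwa [Real.norm_eq_abs, abs_of_nonneg (by positivity)]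
  have h1 := condExp_congr_ae (m := sampleSigma samp n) heq
  have h2 := condExp_mul_of_stronglyMeasurable_left (m := sampleSigma samp n)
    hm1.stronglyMeasurable hprod hqi
  filter_upwards [h1, h2, hR.precond.ratio n v hv, hR.ae_precond n] with ω h1 h2 h3 ⟨h4, _⟩
  rw [h1, h2, Pi.mul_apply, ← h4.normM_sq, mul_comm]
  exact mul_le_mul_of_nonneg_right h3.2 (sq_nonneg _)

/-! ### Step sizes -/

lemma stepSize_pos (n : ℕ) (y : Vec d) : 0 < stepSize G αbar (n + 1) y :=
  div_pos (hR.αbar_succ_pos n) (lt_max_of_lt_left one_pos)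

lemma stepSize_le (n : ℕ) (y : Vec d) : stepSize G αbar (n + 1) y ≤ αbar (n + 1) :=
  div_le_self (hR.αbar_succ_pos n).le (le_max_left _ _)

/-- The purpose of the normalization by `max 1 G`: step size times slope is bounded uniformly in the
point. -/
lemma stepSize_mul_le (n : ℕ) (y : Vec d) :
    stepSize G αbar (n + 1) y * G ‖y‖₊ ≤ αbar (n + 1) := by
  unfold stepSize
  rw [div_mul_eq_mul_div, div_le_iff₀ (lt_max_of_lt_left one_pos)]
  exact mul_le_mul_of_nonneg_left (le_max_right _ _) (hR.αbar_succ_pos n).le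

lemma τ_stepSize_le (n : ℕ) (y : Vec d) :
    Linf ^ 2 * τbar * stepSize G αbar (n + 1) y ≤ 1 / 4 :=
  (mul_le_mul_of_nonneg_left (hR.stepSize_le n y)
    (mul_nonneg (sq_nonneg _) hR.τbar_nonneg)).trans (hR.τ_αbar_le n)

lemma measurable_stepSize (k : ℕ) : Measurable (stepSize (d := d) G αbar k) := by
  have := hR.setting.growth.continuous
  have h : Continuous fun y : Vec d => max 1 (G ‖y‖₊ : ℝ) := by fun_prop
  exact measurable_const.div h.measurable

lemma one_le_stepFactor (n : ℕ) (y : Vec d) : 1 ≤ stepFactor Linf τbar G αbar (n + 1) y := by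
  have h1 := hR.τ_stepSize_le n y
  have h2 := mul_nonneg (mul_nonneg (sq_nonneg Linf) hR.τbar_nonneg) (hR.stepSize_pos n y).le
  exact (one_le_inv₀ (by linarith)).mpr (by linarith)

lemma stepFactor_le (n : ℕ) (y : Vec d) : stepFactor Linf τbar G αbar (n + 1) y ≤ 2 := by
  have h1 := hR.τ_stepSize_le n y
  unfold stepFactor
  rw [inv_le_comm₀ (by linarith) two_pos]
  linarith

lemma measurable_stepFactor (k : ℕ) :
    Measurable (stepFactor (d := d) Linf τbar G αbar k) := by
  have := hR.measurable_stepSize k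
  unfold stepFactor
  fun_prop

/-! ### The pathwise estimate for one step -/

lemma ae_goodSample (n : ℕ) :
    ∀ᵐ ω ∂Pr, ∀ i, GoodSample r g V τbar G L (samp (n + 1) i ω) := by
  have h : ∀ᵐ s ∂P, GoodSample r g V τbar G L s := by
    filter_upwards [hR.setting.weakOn_model, hR.setting.model_ge] with s h1 h2
    exact ⟨h1, h2⟩
  rw [ae_all_iff]
  intro i
  have hn : 1 ≤ n + 1 := Nat.le_add_left 1 n
  rw [← hR.sampling.law (n + 1) hn i] at h
  exact ae_of_ae_map (hR.sampling.measurable (n + 1) hn i).aemeasurable h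

/-- The error term of one step that comes from inexact minimization. -/
lemma error_le (n : ℕ) (y : Vec d) :
    (1 + (αbar (n + 1) ^ 2)⁻¹) * (γ * stepSize G αbar (n + 1) y ^ 2) ^ 2 ≤
      γ ^ 2 * (αbar (n + 1) ^ 2 + 1) * αbar (n + 1) ^ 2 := by
  have h0 := hR.αbar_succ_pos n
  have h1 : stepSize G αbar (n + 1) y ^ 2 ≤ αbar (n + 1) ^ 2 :=
    pow_le_pow_left₀ (hR.stepSize_pos n y).le (hR.stepSize_le n y) 2
  have hγ := hR.γ_nonneg
  calc (1 + (αbar (n + 1) ^ 2)⁻¹) * (γ * stepSize G αbar (n + 1) y ^ 2) ^ 2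
      ≤ (1 + (αbar (n + 1) ^ 2)⁻¹) * (γ * αbar (n + 1) ^ 2) ^ 2 := by gcongr
    _ = γ ^ 2 * (αbar (n + 1) ^ 2 + 1) * αbar (n + 1) ^ 2 := by field_simp

/-- Cauchy–Schwarz for the minibatch average; the normalized step size removes `G`, and the squared
step factor is at most `4`. -/
lemma slope_le (n : ℕ) (y : Vec d) (s : Fin m → S) :
    (stepSize G αbar (n + 1) y * stepFactor Linf τbar G αbar (n + 1) y) ^ 2 *
      (Linf * (((1 / (m : ℝ)) * ∑ i, (L (s i) : ℝ)) * G ‖y‖₊)) ^ 2 ≤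
    4 * αbar (n + 1) ^ 2 * Linf ^ 2 * ((1 / (m : ℝ)) * ∑ i, (L (s i) : ℝ) ^ 2) := by
  have hm : (0 : ℝ) < m := by exact_mod_cast hR.batch_pos
  have h1 := hR.stepSize_mul_le n y
  have h0 := (hR.stepSize_pos n y).le
  have h2 := hR.stepFactor_le n y
  have h3 : 0 ≤ stepFactor Linf τbar G αbar (n + 1) y :=
    zero_le_one.trans (hR.one_le_stepFactor n y)
  have h4 : ((1 / (m : ℝ)) * ∑ i, (L (s i) : ℝ)) ^ 2 ≤
      (1 / (m : ℝ)) * ∑ i, (L (s i) : ℝ) ^ 2 := by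
    have := sq_sum_le_card_mul_sum_sq (s := Finset.univ) (f := fun i => (L (s i) : ℝ))
    rw [Finset.card_univ, Fintype.card_fin] at this
    rw [mul_pow]
    calc (1 / (m : ℝ)) ^ 2 * (∑ i, (L (s i) : ℝ)) ^ 2
        ≤ (1 / (m : ℝ)) ^ 2 * (m * ∑ i, (L (s i) : ℝ) ^ 2) := by gcongr
      _ = _ := by field_simp
  calc _ = (stepSize G αbar (n + 1) y * G ‖y‖₊) ^ 2 * stepFactor Linf τbar G αbar (n + 1) y ^ 2
        * Linf ^ 2 * ((1 / (m : ℝ)) * ∑ i, (L (s i) : ℝ)) ^ 2 := by ring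
    _ ≤ αbar (n + 1) ^ 2 * 2 ^ 2 * Linf ^ 2 * ((1 / (m : ℝ)) * ∑ i, (L (s i) : ℝ) ^ 2) := by
        gcongr
    _ = _ := by ring

theorem ae_step_le (n : ℕ) {z : Vec d} (hz : z ∈ V) :
    ∀ᵐ ω ∂Pr, normM (M (n + 1) ω) (z - x (n + 2) ω) ^ 2 ≤
      (1 + αbar (n + 1) ^ 2) *
        (stepFactor Linf τbar G αbar (n + 1) (x (n + 1) ω) *
            ⟪z - x (n + 1) ω, M (n + 1) ω (z - x (n + 1) ω)⟫
          + (1 / (m : ℝ)) * ∑ i, increment Linf τbar G αbar g r V (n + 1) z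
              (x (n + 1) ω, samp (n + 1) i ω)
          + 4 * αbar (n + 1) ^ 2 * Linf ^ 2
            * ((1 / (m : ℝ)) * ∑ i, (L (samp (n + 1) i ω) : ℝ) ^ 2))
        + γ ^ 2 * (αbar (n + 1) ^ 2 + 1) * αbar (n + 1) ^ 2 := by
  have hn : 1 ≤ n + 1 := Nat.le_add_left 1 n
  have hm : (m : ℝ) ≠ 0 := by
    have := hR.batch_pos
    positivity
  -- With Young's parameter `αbar ^ 2`, the factor `1 + θ` stays summably close to `1`, and `1 +
  -- θ⁻¹` is harmless because `ε` is of order `αbar ^ 2`.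
  have hθ : 0 < αbar (n + 1) ^ 2 := pow_pos (hR.αbar_succ_pos n) 2
  filter_upwards [hR.ae_goodSample n, hR.ae_mem n, hR.ae_precond (n + 1), hR.alg.step (n + 1) hn]
    with ω hs hx ⟨hM, hMv⟩ hstep
  have hα : α (n + 1) ω = stepSize G αbar (n + 1) (x (n + 1) ω) := hR.α_eq _ hn ω
  have hε : ε (n + 1) ω = γ * stepSize G αbar (n + 1) (x (n + 1) ω) ^ 2 := by
    rw [← hα]
    exact hR.ε_eq _ hn ω
  simp only [hα, hε] at hstep
  set a := stepSize G αbar (n + 1) (x (n + 1) ω) with ha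
  have h := one_step hR.setting hR.batch_pos hs hM (fun v => (hMv v).2) (hR.stepSize_pos n _)
    (by linarith [hR.τ_stepSize_le n (x (n + 1) ω)])
    (mul_nonneg hR.γ_nonneg (sq_nonneg a)) hθ hx hz hstep
  have hσ : a / (1 - Linf ^ 2 * τbar * a) = a * stepFactor Linf τbar G αbar (n + 1)
      (x (n + 1) ω) := div_eq_mul_inv _ _
  have hσ' : (1 - Linf ^ 2 * τbar * a)⁻¹ = stepFactor Linf τbar G αbar (n + 1) (x (n + 1) ω) := rfl
  have hinc : (1 / (m : ℝ)) * ∑ i, increment Linf τbar G αbar g r V (n + 1) z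
      (x (n + 1) ω, samp (n + 1) i ω) = 2 * (a * stepFactor Linf τbar G αbar (n + 1) (x (n + 1) ω))
        * (batchR g r (x (n + 1) ω) (fun i => samp (n + 1) i ω) z
          - batchR g r (x (n + 1) ω) (fun i => samp (n + 1) i ω) (x (n + 1) ω)) := by
    rw [batchR_eq hR.batch_pos, batchR_eq hR.batch_pos, ← mul_sub, ← Finset.sum_sub_distrib,
      Finset.mul_sum, Finset.mul_sum, Finset.mul_sum]
    refine Finset.sum_congr rfl fun i _ => ?_
    unfold increment
    rw [Set.indicator_of_mem (by exact hx)]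
    simp only [← ha]
    ring
  rw [hinc, ← hM.normM_sq]
  refine h.trans ?_
  rw [hσ, hσ']
  have h1 := hR.slope_le n (x (n + 1) ω) fun i => samp (n + 1) i ω
  have h2 := hR.error_le n (x (n + 1) ω)
  rw [← ha] at h1 h2
  gcongr

end Run

/-! ### Conditional expectation of one step -/

section CondExp

variable {Ω : Type*} {m' m0 : MeasurableSpace Ω} {Pr : Measure Ω} [IsProbabilityMeasure Pr]

lemma condExp_average_le {m : ℕ} (hm : 0 < m) {B : Fin m → Ω → ℝ}
    (hB : ∀ i, Integrable (B i) Pr) {b : Ω → ℝ} (h : ∀ i, Pr[B i | m'] ≤ᵐ[Pr] b) :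
    Pr[fun ω => (1 / (m : ℝ)) * ∑ i, B i ω | m'] ≤ᵐ[Pr] b := by
  have hm' : (0 : ℝ) < m := by exact_mod_cast hm
  have e : (fun ω => (1 / (m : ℝ)) * ∑ i, B i ω) = (1 / (m : ℝ)) • ∑ i, B i := by
    ext ω
    simp
  rw [e]
  have h1 := condExp_smul (μ := Pr) (1 / (m : ℝ)) (∑ i, B i) m'
  have h2 := condExp_finsetSum (s := Finset.univ) (fun i _ => hB i) m'
  filter_upwards [h1, h2, ae_all_iff.mpr h] with ω h1 h2 h3
  rw [h1, Pi.smul_apply, h2, Finset.sum_apply, smul_eq_mul]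
  calc (1 / (m : ℝ)) * ∑ i, (Pr[B i | m']) ω ≤ (1 / (m : ℝ)) * ∑ _i : Fin m, b ω := by
        gcongr with i
        exact h3 i
    _ = b ω := by
        rw [Finset.sum_const, Finset.card_univ, Fintype.card_fin, nsmul_eq_mul]
        field_simp

lemma condExp_affine_le (hm : m' ≤ m0) {Y A₁ A₂ A₃ a₁ a₂ a₃ : Ω → ℝ} {k c : ℝ} (hk : 0 ≤ k)
    (hY : Integrable Y Pr) (h₁ : Integrable A₁ Pr) (h₂ : Integrable A₂ Pr) (h₃ : Integrable A₃ Pr)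
    (h : ∀ᵐ ω ∂Pr, Y ω ≤ k * (A₁ ω + A₂ ω + A₃ ω) + c) (ha₁ : Pr[A₁ | m'] ≤ᵐ[Pr] a₁)
    (ha₂ : Pr[A₂ | m'] ≤ᵐ[Pr] a₂) (ha₃ : Pr[A₃ | m'] ≤ᵐ[Pr] a₃) :
    ∀ᵐ ω ∂Pr, (Pr[Y | m']) ω ≤ k * (a₁ ω + a₂ ω + a₃ ω) + c := by
  have hi : Integrable (k • (A₁ + A₂ + A₃)) Pr := ((h₁.add h₂).add h₃).smul k
  have e1 : Pr[Y | m'] ≤ᵐ[Pr] Pr[k • (A₁ + A₂ + A₃) + fun _ => c | m'] :=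
    condExp_mono hY (hi.add (integrable_const c)) h
  filter_upwards [e1, condExp_add (m := m') hi (integrable_const c),
    condExp_smul (μ := Pr) k (A₁ + A₂ + A₃) m', condExp_add (m := m') (h₁.add h₂) h₃,
    condExp_add (m := m') h₁ h₂, ha₁, ha₂, ha₃] with ω e1 e2 e3 e4 e5 ha₁ ha₂ ha₃
  rw [e2, Pi.add_apply, e3, Pi.smul_apply, e4, Pi.add_apply, e5, Pi.add_apply, smul_eq_mul,
    condExp_const hm] at e1
  refine e1.trans ?_
  gcongr

end CondExp

/-! ### Integrability and conditional expectations of the terms of one step -/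

namespace Run

variable {d m : ℕ} {S : Type*} [MeasurableSpace S] {P : Measure S} [IsProbabilityMeasure P]
  {Ω : Type*} [m0 : MeasurableSpace Ω] {Pr : Measure Ω} [IsProbabilityMeasure Pr]
  {f : S → Vec d → EReal} {r : Vec d → EReal} {g : Vec d → Vec d → S → ℝ} {V : Set (Vec d)}
  {ηbar τbar μinf Linf Lφ γ ρbar : ℝ} {G : ℝ≥0 → ℝ≥0} {L : S → ℝ≥0}
  {samp : ℕ → Fin m → Ω → S} {M : ℕ → Ω → Vec d →L[ℝ] Vec d} {ρ : ℕ → ℝ}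
  {x : ℕ → Ω → Vec d} {α ε : ℕ → Ω → ℝ} {αbar : ℕ → ℝ}
  (hR : Run P Pr f r g V ηbar τbar μinf Linf Lφ γ ρbar G L samp M ρ x α ε αbar)
include hR

lemma integrable_L : Integrable (fun s => (L s : ℝ)) P := by
  refine (hR.setting.growth.integrable.add (integrable_const (1 : ℝ))).mono'
    (measurable_coe_nnreal_real.comp hR.setting.growth.measurable).aestronglyMeasurable
    (Eventually.of_forall fun s => ?_)
  rw [Real.norm_eq_abs, NNReal.abs_eq, Pi.add_apply]
  nlinarith [sq_nonneg ((L s : ℝ) - 1)]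

/-- Measurability of the model is assumed only on `V × V × S`; off `V` the increment is zero by
definition, so the two pieces are treated apart. -/
lemma measurable_increment (k : ℕ) {z : Vec d} (hz : z ∈ V) :
    Measurable (increment Linf τbar G αbar g r V k z) := by
  have hs : MeasurableSet {p : Vec d × S | p.1 ∈ V} :=
    measurable_fst hR.setting.model.isOpen.measurableSet
  have h1 := hR.measurable_stepSize k
  have h2 := hR.measurable_stepFactor k
  have h3 := hR.setting.measurable_r
  refine measurable_of_restrict_of_restrict_compl hs ?_ ?_
  · have hfst : Measurable fun t : {p : Vec d × S | p.1 ∈ V} => t.1.1 :=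
      measurable_fst.comp measurable_subtype_coe
    have hsnd : Measurable fun t : {p : Vec d × S | p.1 ∈ V} => t.1.2 :=
      measurable_snd.comp measurable_subtype_coe
    have e : {p : Vec d × S | p.1 ∈ V}.domRestrict (increment Linf τbar G αbar g r V k z) =
        fun t => 2 * (stepSize G αbar k t.1.1 * stepFactor Linf τbar G αbar k t.1.1) *
      (g t.1.1 z t.1.2 + (r z).toReal - (g t.1.1 t.1.1 t.1.2 + (r t.1.1).toReal)) := by
      ext t
      rw [Set.domRestrict_apply, increment, Set.indicator_of_mem t.2]
    rw [e]
    have g1 := hR.setting.measurable_model hfst (measurable_const (a := z)) hsnd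
      (fun t => t.2) fun _ => hz
    have g2 := hR.setting.measurable_model hfst hfst hsnd (fun t => t.2) fun t => t.2
    exact (((h1.comp hfst).mul (h2.comp hfst)).const_mul 2).mul
      ((g1.add_const _).sub (g2.add (h3.comp hfst)))
  · have e : {p : Vec d × S | p.1 ∈ V}ᶜ.domRestrict (increment Linf τbar G αbar g r V k z) =
        fun _ => 0 := by
      ext t
      rw [Set.domRestrict_apply, increment, Set.indicator_of_notMem t.2]
    rw [e]
    exact measurable_const

lemma increment_eq (k : ℕ) (z : Vec d) {y : Vec d} (hy : y ∈ V) (s : S) :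
    increment Linf τbar G αbar g r V k z (y, s) =
      2 * (stepSize G αbar k y * stepFactor Linf τbar G αbar k y) *
      (g y z s + (r z).toReal - (g y y s + (r y).toReal)) :=
  Set.indicator_of_mem (by exact hy) _

lemma increment_eq_zero (k : ℕ) (z : Vec d) {y : Vec d} (hy : y ∉ V) (s : S) :
    increment Linf τbar G αbar g r V k z (y, s) = 0 :=
  Set.indicator_of_notMem (by exact hy) _

lemma integrable_increment (k : ℕ) {z : Vec d} (hz : z ∈ V) (y : Vec d) :
    Integrable (fun s => increment Linf τbar G αbar g r V k z (y, s)) P := by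
  by_cases hy : y ∈ V
  · simp only [hR.increment_eq k z hy]
    exact (((hR.setting.integrable_model hy hz).add (integrable_const _)).sub
      ((hR.setting.integrable_model hy hy).add (integrable_const _))).const_mul _
  · simp only [hR.increment_eq_zero k z hy]
    exact integrable_zero _ _ _

lemma integral_increment_le (n : ℕ) {z : Vec d} (hz : z ∈ V) {y : Vec d} (hy : y ∈ V) :
    ∫ s, increment Linf τbar G αbar g r V (n + 1) z (y, s) ∂P ≤
      2 * (stepSize G αbar (n + 1) y * stepFactor Linf τbar G αbar (n + 1) y) *
        (objR P f r z - objR P f r y + ηbar / 2 * ‖z - y‖ ^ 2) := by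
  simp only [hR.increment_eq (n + 1) z hy]
  rw [integral_const_mul]
  have h1 := hR.setting.integrable_model hy hz
  have h2 := hR.setting.integrable_model hy hy
  have h1' : Integrable (fun s => g y z s + (r z).toReal) P := h1.add (integrable_const _)
  have h2' : Integrable (fun s => g y y s + (r y).toReal) P := h2.add (integrable_const _)
  rw [integral_sub h1' h2', integral_add h1 (integrable_const _), integral_add h2 (integrable_const _),
    hR.setting.integral_model_self hy]
  have h3 := hR.setting.integral_model_le hy hz
  have h4 := (hR.stepSize_pos n y).le
  have h5 := zero_le_one.trans (hR.one_le_stepFactor n y)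
  refine mul_le_mul_of_nonneg_left ?_ (by positivity)
  simp only [integral_const, probReal_univ, smul_eq_mul, one_mul, objR]
  linarith

/-- If `t ≥ -N` and `N ≥ 0`, then `|t| ≤ t + 2 N`. The linear minorant of the model provides `N`,
with `G` absorbed by the step size, and the expectation of `t` is bounded above because `φ` is
bounded below. -/
lemma integral_abs_increment_le (n : ℕ) {z : Vec d} (hz : z ∈ V) :
    ∃ C, ∀ y, ∫ s, ‖increment Linf τbar G αbar g r V (n + 1) z (y, s)‖ ∂P ≤
      C * (1 + ‖z - y‖ ^ 2) := by
  obtain ⟨c, hc⟩ := hR.setting.exists_le_objR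
  set ℓ := ∫ s, (L s : ℝ) ∂P with hℓ
  have hℓ0 : 0 ≤ ℓ := integral_nonneg fun s => NNReal.coe_nonneg _
  have hα := (hR.αbar_succ_pos n).le
  have hη := hR.ηbar_nonneg
  have hτ := hR.τbar_nonneg
  have hzc : 0 ≤ objR P f r z - c := by linarith [hc z hz]
  refine ⟨4 * αbar (n + 1) * (objR P f r z - c + ηbar / 2)
    + 8 * αbar (n + 1) * τbar / 2 + 8 * αbar (n + 1) * ℓ, fun y => ?_⟩
  by_cases hy : y ∈ V
  swap
  · simp only [hR.increment_eq_zero (n + 1) z hy, norm_zero, integral_zero]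
    positivity
  set a := stepSize G αbar (n + 1) y with ha
  set σ := stepFactor Linf τbar G αbar (n + 1) y with hσ
  have ha0 : 0 ≤ a := (hR.stepSize_pos n y).le
  have ha1 : a ≤ αbar (n + 1) := hR.stepSize_le n y
  have haG : a * G ‖y‖₊ ≤ αbar (n + 1) := hR.stepSize_mul_le n y
  have hσ0 : 0 ≤ σ := zero_le_one.trans (hR.one_le_stepFactor n y)
  have hσ2 : σ ≤ 2 := hR.stepFactor_le n y
  set N : S → ℝ := fun s => 2 * (a * σ) *
    (L s * G ‖y‖₊ * ‖z - y‖ + τbar / 2 * ‖z - y‖ ^ 2) with hN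
  have hNi : Integrable N P :=
    (((hR.integrable_L.mul_const _).mul_const _).add (integrable_const _)).const_mul _
  have hinc := hR.integrable_increment (n + 1) hz y
  have h1 : ∫ s, ‖increment Linf τbar G αbar g r V (n + 1) z (y, s)‖ ∂P ≤
      ∫ s, (increment Linf τbar G αbar g r V (n + 1) z (y, s) + 2 * N s) ∂P := by
    refine integral_mono_ae hinc.norm (hinc.add (hNi.const_mul 2)) ?_
    filter_upwards [hR.setting.model_ge] with s hs
    have h2 := hs y hy z hz
    have h3 : -N s ≤ increment Linf τbar G αbar g r V (n + 1) z (y, s) := by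
      rw [hR.increment_eq (n + 1) z hy, ← ha, ← hσ]
      simp only [hN]
      rw [← mul_neg]
      exact mul_le_mul_of_nonneg_left (by linarith) (by positivity)
    have h4 : 0 ≤ N s := by simp only [hN]; positivity
    rw [Real.norm_eq_abs, abs_le]
    constructor <;> linarith
  rw [integral_add hinc (hNi.const_mul 2), integral_const_mul] at h1
  have h2 := hR.integral_increment_le n hz hy
  rw [← ha, ← hσ] at h2
  have hNint : ∫ s, N s ∂P = 2 * (a * σ) * (ℓ * G ‖y‖₊ * ‖z - y‖ + τbar / 2 * ‖z - y‖ ^ 2) := by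
    simp only [hN]
    rw [integral_const_mul, integral_add ((hR.integrable_L.mul_const _).mul_const _)
      (integrable_const _), integral_mul_const, integral_mul_const, integral_const,
      probReal_univ, one_smul]
  have h3 : 2 * (a * σ) * (objR P f r z - objR P f r y + ηbar / 2 * ‖z - y‖ ^ 2) ≤
      4 * αbar (n + 1) * (objR P f r z - c + ηbar / 2) * (1 + ‖z - y‖ ^ 2) := by
    have hyc := hc y hy
    calc 2 * (a * σ) * (objR P f r z - objR P f r y + ηbar / 2 * ‖z - y‖ ^ 2)
        ≤ 2 * (a * σ) * (objR P f r z - c + ηbar / 2 * ‖z - y‖ ^ 2) := by gcongr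
      _ ≤ 2 * (αbar (n + 1) * 2) * ((objR P f r z - c + ηbar / 2) * (1 + ‖z - y‖ ^ 2)) := by
          gcongr
          nlinarith [sq_nonneg ‖z - y‖, mul_nonneg hzc (sq_nonneg ‖z - y‖)]
      _ = _ := by ring
  have h4 : 2 * (a * σ) * (ℓ * G ‖y‖₊ * ‖z - y‖) ≤
      4 * αbar (n + 1) * ℓ * (1 + ‖z - y‖ ^ 2) := by
    calc 2 * (a * σ) * (ℓ * G ‖y‖₊ * ‖z - y‖) = 2 * (a * G ‖y‖₊) * σ * ℓ * ‖z - y‖ := by ring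
      _ ≤ 2 * αbar (n + 1) * 2 * ℓ * (1 + ‖z - y‖ ^ 2) := by
          gcongr
          nlinarith [sq_nonneg (‖z - y‖ - 1)]
      _ = _ := by ring
  have h5 : 2 * (a * σ) * (τbar / 2 * ‖z - y‖ ^ 2) ≤
      4 * αbar (n + 1) * τbar / 2 * (1 + ‖z - y‖ ^ 2) := by
    calc 2 * (a * σ) * (τbar / 2 * ‖z - y‖ ^ 2)
        ≤ 2 * (αbar (n + 1) * 2) * (τbar / 2 * (1 + ‖z - y‖ ^ 2)) := by
          gcongr
          linarith
      _ = _ := by ring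
  rw [hNint] at h1
  linarith

lemma integrable_sub_sq {n : ℕ} (hx : Integrable (fun ω => ‖x (n + 1) ω‖ ^ 2) Pr) (z : Vec d) :
    Integrable (fun ω => ‖z - x (n + 1) ω‖ ^ 2) Pr := by
  have hm : Measurable (x (n + 1)) :=
    (hR.measurable_x n).mono (hR.sampling.sampleSigma_le n) le_rfl
  refine ((integrable_const (2 * ‖z‖ ^ 2)).add (hx.const_mul 2)).mono'
    ((measurable_const.sub hm).norm.pow_const 2).aestronglyMeasurable
    (Eventually.of_forall fun ω => ?_)
  rw [Real.norm_eq_abs, abs_of_nonneg (by positivity), Pi.add_apply]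
  have h1 := norm_sub_le z (x (n + 1) ω)
  nlinarith [norm_nonneg (z - x (n + 1) ω), sq_nonneg (‖z‖ - ‖x (n + 1) ω‖)]

/-- The three random terms in the pathwise estimate and their conditional expectations. -/
lemma quadratic_term {n : ℕ} (hx : Integrable (fun ω => ‖x (n + 1) ω‖ ^ 2) Pr) (z : Vec d) :
    Integrable (fun ω => stepFactor Linf τbar G αbar (n + 1) (x (n + 1) ω) *
      ⟪z - x (n + 1) ω, M (n + 1) ω (z - x (n + 1) ω)⟫) Pr ∧
    Pr[fun ω => stepFactor Linf τbar G αbar (n + 1) (x (n + 1) ω) *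
      ⟪z - x (n + 1) ω, M (n + 1) ω (z - x (n + 1) ω)⟫ | sampleSigma samp n] ≤ᵐ[Pr]
      fun ω => stepFactor Linf τbar G αbar (n + 1) (x (n + 1) ω) *
        (ρ (n + 1) ^ 2 * normM (M n ω) (z - x (n + 1) ω) ^ 2) := by
  have hle := hR.sampling.sampleSigma_le n
  have hv : Measurable[sampleSigma samp n] fun ω => z - x (n + 1) ω :=
    measurable_const.sub (hR.measurable_x n)
  have hvi := hR.integrable_sub_sq hx z
  have hσ : Measurable[sampleSigma samp n]
      fun ω => stepFactor Linf τbar G αbar (n + 1) (x (n + 1) ω) :=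
    (hR.measurable_stepFactor (n + 1)).comp (hR.measurable_x n)
  have hqi := integrable_inner_apply hle (hR.measurable_M' (n + 1)) (hR.ae_entry_le (n + 1)) hv hvi
  have hi : Integrable (fun ω => stepFactor Linf τbar G αbar (n + 1) (x (n + 1) ω) *
      ⟪z - x (n + 1) ω, M (n + 1) ω (z - x (n + 1) ω)⟫) Pr := by
    refine hqi.bdd_mul (c := 2) (hσ.mono hle le_rfl).aestronglyMeasurable
      (Eventually.of_forall fun ω => ?_)
    rw [Real.norm_eq_abs, abs_of_nonneg (zero_le_one.trans (hR.one_le_stepFactor n _))]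
    exact hR.stepFactor_le n _
  refine ⟨hi, ?_⟩
  have h1 := condExp_mul_of_stronglyMeasurable_left (m := sampleSigma samp n)
    hσ.stronglyMeasurable hi hqi
  have h2 := condExp_inner_apply_le hle (hR.measurable_M' (n + 1)) (hR.ae_entry_le (n + 1))
    (hR.condExp_inner_fixed_le n) hv hvi
  filter_upwards [h1, h2, hR.ae_precond n] with ω h1 h2 ⟨h3, _⟩
  refine (le_of_eq h1).trans ?_
  rw [Pi.mul_apply, h3.normM_sq]
  exact mul_le_mul_of_nonneg_left h2 (zero_le_one.trans (hR.one_le_stepFactor n _))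

lemma increment_term {n : ℕ} (hx : Integrable (fun ω => ‖x (n + 1) ω‖ ^ 2) Pr) {z : Vec d}
    (hz : z ∈ V) :
    Integrable (fun ω => (1 / (m : ℝ)) * ∑ i, increment Linf τbar G αbar g r V (n + 1) z
      (x (n + 1) ω, samp (n + 1) i ω)) Pr ∧
    Pr[fun ω => (1 / (m : ℝ)) * ∑ i, increment Linf τbar G αbar g r V (n + 1) z
      (x (n + 1) ω, samp (n + 1) i ω) | sampleSigma samp n] ≤ᵐ[Pr]
      fun ω => 2 * (stepSize G αbar (n + 1) (x (n + 1) ω)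
        * stepFactor Linf τbar G αbar (n + 1) (x (n + 1) ω)) *
        (objR P f r z - objR P f r (x (n + 1) ω) + ηbar / 2 * ‖z - x (n + 1) ω‖ ^ 2) := by
  have hle := hR.sampling.sampleSigma_le n
  have hn : 1 ≤ n + 1 := Nat.le_add_left 1 n
  have hH := hR.measurable_increment (n + 1) hz
  have hxm := hR.measurable_x n
  obtain ⟨C, hC⟩ := hR.integral_abs_increment_le n hz
  have hb : Integrable (fun ω => ∫ s, ‖increment Linf τbar G αbar g r V (n + 1) z
      (x (n + 1) ω, s)‖ ∂P) Pr := by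
    refine (((integrable_const (1 : ℝ)).add (hR.integrable_sub_sq hx z)).const_mul C).mono'
      ((hH.norm.stronglyMeasurable.integral_prod_right').comp_measurable
        (hxm.mono hle le_rfl)).aestronglyMeasurable (Eventually.of_forall fun ω => ?_)
    rw [Real.norm_eq_abs, abs_of_nonneg (integral_nonneg fun _ => norm_nonneg _)]
    exact hC _
  have hi : ∀ i, Integrable (fun ω => increment Linf τbar G αbar g r V (n + 1) z
      (x (n + 1) ω, samp (n + 1) i ω)) Pr := fun i =>
    integrable_comp_of_indep hle hxm (hR.sampling.measurable _ hn i) (hR.sampling.indep_succ n i)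
      (hR.sampling.law _ hn i) hH (hR.integrable_increment (n + 1) hz) hb
  refine ⟨(integrable_finsetSum _ fun i _ => hi i).const_mul _,
    condExp_average_le hR.batch_pos hi fun i => ?_⟩
  have h1 := condExp_comp_of_indep hle hxm (hR.sampling.measurable _ hn i)
    (hR.sampling.indep_succ n i) (hR.sampling.law _ hn i) hH (hi i)
  filter_upwards [h1, hR.ae_mem n] with ω h1 h2
  rw [h1]
  exact hR.integral_increment_le n hz h2

lemma slope_term (n : ℕ) (c : ℝ) (hc : 0 ≤ c) :
    Integrable (fun ω => c * ((1 / (m : ℝ)) * ∑ i, (L (samp (n + 1) i ω) : ℝ) ^ 2)) Pr ∧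
    Pr[fun ω => c * ((1 / (m : ℝ)) * ∑ i, (L (samp (n + 1) i ω) : ℝ) ^ 2) | sampleSigma samp n]
      ≤ᵐ[Pr] fun _ => c * ∫ s, (L s : ℝ) ^ 2 ∂P := by
  have hle := hR.sampling.sampleSigma_le n
  have hn : 1 ≤ n + 1 := Nat.le_add_left 1 n
  have hH : Measurable fun p : Vec d × S => (L p.2 : ℝ) ^ 2 :=
    ((measurable_coe_nnreal_real.comp hR.setting.growth.measurable).pow_const 2).comp measurable_snd
  have hxm := hR.measurable_x n
  have hi : ∀ i, Integrable (fun ω => (L (samp (n + 1) i ω) : ℝ) ^ 2) Pr := fun i =>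
    integrable_comp_of_indep (H := fun p : Vec d × S => (L p.2 : ℝ) ^ 2) hle hxm
      (hR.sampling.measurable _ hn i) (hR.sampling.indep_succ n i)
      (hR.sampling.law _ hn i) hH (fun _ => hR.setting.growth.integrable)
      (integrable_const (∫ s, ‖(L s : ℝ) ^ 2‖ ∂P))
  have hav : Integrable (fun ω => (1 / (m : ℝ)) * ∑ i, (L (samp (n + 1) i ω) : ℝ) ^ 2) Pr :=
    (integrable_finsetSum _ fun i _ => hi i).const_mul _
  refine ⟨hav.const_mul c, ?_⟩
  have h1 : Pr[fun ω => (1 / (m : ℝ)) * ∑ i, (L (samp (n + 1) i ω) : ℝ) ^ 2 | sampleSigma samp n]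
      ≤ᵐ[Pr] fun _ => ∫ s, (L s : ℝ) ^ 2 ∂P := by
    refine condExp_average_le hR.batch_pos hi fun i => ?_
    exact (condExp_comp_of_indep (H := fun p : Vec d × S => (L p.2 : ℝ) ^ 2) hle hxm
      (hR.sampling.measurable _ hn i) (hR.sampling.indep_succ n i) (hR.sampling.law _ hn i) hH
      (hi i)).le
  have h2 := condExp_smul (μ := Pr) c
    (fun ω => (1 / (m : ℝ)) * ∑ i, (L (samp (n + 1) i ω) : ℝ) ^ 2) (sampleSigma samp n)
  filter_upwards [h1, h2] with ω h1 h2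
  refine (le_of_eq h2).trans ?_
  rw [Pi.smul_apply, smul_eq_mul]
  exact mul_le_mul_of_nonneg_left h1 hc

/-- The matrix `M (n + 1)` may depend on the current minibatch, so its quadratic form at the known
vector `z - x (n + 1)` is compared with that of `M n` through the ratio condition; the sampled
increments are averaged by independence. -/
theorem condExp_step {n : ℕ} (hx : Integrable (fun ω => ‖x (n + 1) ω‖ ^ 2) Pr) {z : Vec d}
    (hz : z ∈ V) :
    Integrable (fun ω => normM (M (n + 1) ω) (z - x (n + 2) ω) ^ 2) Pr ∧
    ∀ᵐ ω ∂Pr, (Pr[fun ω => normM (M (n + 1) ω) (z - x (n + 2) ω) ^ 2 | sampleSigma samp n]) ω ≤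
      (1 + αbar (n + 1) ^ 2) *
        (stepFactor Linf τbar G αbar (n + 1) (x (n + 1) ω) *
            (ρ (n + 1) ^ 2 * normM (M n ω) (z - x (n + 1) ω) ^ 2)
          + 2 * (stepSize G αbar (n + 1) (x (n + 1) ω)
            * stepFactor Linf τbar G αbar (n + 1) (x (n + 1) ω)) *
            (objR P f r z - objR P f r (x (n + 1) ω) + ηbar / 2 * ‖z - x (n + 1) ω‖ ^ 2)
          + 4 * αbar (n + 1) ^ 2 * Linf ^ 2 * ∫ s, (L s : ℝ) ^ 2 ∂P)
        + γ ^ 2 * (αbar (n + 1) ^ 2 + 1) * αbar (n + 1) ^ 2 := by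
  obtain ⟨h1, h1'⟩ := hR.quadratic_term hx z
  obtain ⟨h2, h2'⟩ := hR.increment_term hx hz
  obtain ⟨h3, h3'⟩ := hR.slope_term n (4 * αbar (n + 1) ^ 2 * Linf ^ 2) (by positivity)
  have hstep := hR.ae_step_le n hz
  have hk : 0 ≤ 1 + αbar (n + 1) ^ 2 := by positivity
  have hv : Measurable[sampleSigma samp (n + 1)] fun ω => z - x (n + 2) ω :=
    measurable_const.sub (hR.measurable_x (n + 1))
  have hY : Integrable (fun ω => normM (M (n + 1) ω) (z - x (n + 2) ω) ^ 2) Pr := by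
    refine ((((h1.add h2).add h3).const_mul (1 + αbar (n + 1) ^ 2)).add (integrable_const
      (γ ^ 2 * (αbar (n + 1) ^ 2 + 1) * αbar (n + 1) ^ 2))).mono'
      ((hR.normM_sq_measurable (n + 1) hv).mono
        (hR.sampling.sampleSigma_le _) le_rfl).aestronglyMeasurable ?_
    filter_upwards [hstep] with ω h
    rw [Real.norm_eq_abs, abs_of_nonneg (sq_nonneg _)]
    exact h
  exact ⟨hY, condExp_affine_le (hR.sampling.sampleSigma_le n) hk hY h1 h2 h3 hstep h1' h2' h3'⟩

/-- Second moments propagate: the step estimate at one fixed `z ∈ V` bounds the new squared distance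
by integrable terms. -/
theorem integrable_norm_sq (n : ℕ) : Integrable (fun ω => ‖x (n + 1) ω‖ ^ 2) Pr := by
  induction n with
  | zero =>
    obtain ⟨x₁, hx⟩ := hR.alg.init
    simp only [zero_add, hx]
    exact integrable_const _
  | succ n ih =>
    obtain ⟨z, hz⟩ := hR.setting.nonempty
    have h1 := (hR.condExp_step ih hz).1
    have hm : Measurable (x (n + 1 + 1)) :=
      (hR.measurable_x (n + 1)).mono (hR.sampling.sampleSigma_le _) le_rfl
    refine ((integrable_const (2 * ‖z‖ ^ 2)).add (h1.const_mul (2 * Linf ^ 2))).mono'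
      (hm.norm.pow_const 2).aestronglyMeasurable ?_
    filter_upwards [hR.ae_precond (n + 1)] with ω ⟨_, h2⟩
    rw [Real.norm_eq_abs, abs_of_nonneg (sq_nonneg _), Pi.add_apply]
    have h3 : ‖z - x (n + 2) ω‖ ^ 2 ≤ Linf ^ 2 * normM (M (n + 1) ω) (z - x (n + 2) ω) ^ 2 := by
      rw [← mul_pow]
      exact pow_le_pow_left₀ (norm_nonneg _) (h2 _).2 2
    have h4 : ‖x (n + 2) ω‖ ≤ ‖z‖ + ‖z - x (n + 2) ω‖ := by
      have := norm_sub_le z (z - x (n + 2) ω)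
      rwa [sub_sub_cancel] at this
    nlinarith [norm_nonneg (x (n + 2) ω), sq_nonneg (‖z‖ - ‖z - x (n + 2) ω‖)]

end Run

/-! ### Descent of the Moreau envelope -/

section Envelope

variable {d : ℕ} {V Q : Set (Vec d)} {h : Vec d → ℝ}

/-- By continuity of `h` on `V` a dense subset suffices. A countable one gives measurability of the
envelope along the iterates and lets near-minimizers be taken from countably many points. -/
lemma envOn_eq_iInf (hne : V.Nonempty) (hh : ContinuousOn h V) (hQ : Q ⊆ V)
    (hVQ : V ⊆ closure Q) (hb : ∃ c, ∀ y ∈ V, c ≤ h y) {β : ℝ} (hβ : 0 < β)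
    (M : Vec d →L[ℝ] Vec d) (z : Vec d) :
    envOn V M β h z = ⨅ q : Q, (h q + β / 2 * normM M (q - z) ^ 2) := by
  have hQne : Q.Nonempty := closure_nonempty_iff.mp (hne.mono hVQ)
  have : Nonempty Q := hQne.to_subtype
  have hbdd : BddBelow (Set.range fun q : Q => h q + β / 2 * normM M (q - z) ^ 2) := by
    obtain ⟨c, hc⟩ := bddBelow_envOn (M := M) hb hβ z
    refine ⟨c, ?_⟩
    rintro _ ⟨q, rfl⟩
    exact hc ⟨q, hQ q.2, rfl⟩
  apply le_antisymm
  · exact le_ciInf fun q => envOn_le hb hβ (hQ q.2) z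
  · refine le_csInf (hne.image _) ?_
    rintro _ ⟨y, hy, rfl⟩
    have hc : ContinuousOn (fun y => h y + β / 2 * normM M (y - z) ^ 2) V := by
      have := continuous_normM M
      have h2 : Continuous fun y => β / 2 * normM M (y - z) ^ 2 := by fun_prop
      exact hh.add h2.continuousOn
    have ht := (hc y hy).mono hQ
    have : (𝓝[Q] y).NeBot := mem_closure_iff_nhdsWithin_neBot.mp (hVQ hy)
    refine ge_of_tendsto ht ?_
    filter_upwards [self_mem_nhdsWithin] with q hq
    exact ciInf_le hbdd ⟨q, hq⟩

/-- The elementary inequality behind the descent of the envelope. -/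
lemma descent_algebra {e φz φx D ξ c a αb σ ρ2 β τ η θ c₃ c₄ : ℝ} (hβ : 0 < β) (hD : 0 ≤ D)
    (hξ : φz + β / 2 * D = e + ξ) (hξ0 : 0 ≤ ξ) (hc : c ≤ φz) (hU : e ≤ φx) (ha : 0 ≤ a)
    (haα : a ≤ αb) (hσ1 : 1 ≤ σ) (hσ2 : σ ≤ 2) (hσ : σ * (1 - τ * a) = 1)
    (hρ : η + ρ2 * τ ≤ β) (hρ1 : 1 ≤ ρ2) (hθ : 0 ≤ θ) :
    φz + β / 2 * ((1 + θ) * (σ * (ρ2 * D) + 2 * (a * σ) * (φz - φx + η / 2 * D) + c₃) + c₄) ≤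
      e + ((1 + θ) * ρ2 - 1) * (e - c) - β * (a * (φx - e)) + β / 2 * ((1 + θ) * c₃ + c₄)
        + (1 + ((1 + θ) * ρ2 - 1) + 2 * β * (1 + θ) * αb) * ξ := by
  have h1 : σ * (ρ2 * D) + 2 * (a * σ) * (φz - φx + η / 2 * D) =
      σ * (ρ2 - a * β + a * η) * D - 2 * a * σ * (φx - e) + 2 * a * σ * ξ := by
    have : φz = e + ξ - β / 2 * D := by linarith
    rw [this]
    ring
  -- Writing `ρ2 = σ * (1 - τ * a) * ρ2`, the claim is `η + ρ2 * τ ≤ β` times the nonnegative `σ *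
  -- a`.
  have h2 : σ * (ρ2 - a * β + a * η) ≤ ρ2 := by
    have h3 : ρ2 = σ * (1 - τ * a) * ρ2 := by rw [hσ, one_mul]
    have h4 : 0 ≤ σ * a * (β - η - ρ2 * τ) :=
      mul_nonneg (mul_nonneg (by linarith) ha) (by linarith)
    nlinarith
  have h3 : σ * (ρ2 - a * β + a * η) * D ≤ ρ2 * D := mul_le_mul_of_nonneg_right h2 hD
  have h4 : a * (φx - e) ≤ a * σ * (φx - e) := by
    refine mul_le_mul_of_nonneg_right ?_ (by linarith)
    exact le_mul_of_one_le_right ha hσ1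
  have hαb : 0 ≤ αb := ha.trans haα
  have h5 : a * σ * ξ ≤ αb * 2 * ξ := by gcongr
  have h6 : 0 ≤ a * (φx - e) := mul_nonneg ha (by linarith)
  have h7 : σ * (ρ2 * D) + 2 * (a * σ) * (φz - φx + η / 2 * D) + c₃ ≤
      ρ2 * D - 2 * (a * (φx - e)) + 4 * αb * ξ + c₃ := by
    rw [h1]
    linarith
  have h8 := mul_le_mul_of_nonneg_left h7 (by positivity : 0 ≤ β / 2 * (1 + θ))
  have h9 : 0 ≤ (1 + θ) * ρ2 - 1 := by nlinarith
  -- This turns relative growth of the squared distance into relative growth of `e - c`.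
  have h10 : β / 2 * D ≤ e - c + ξ := by linarith
  have h11 := mul_le_mul_of_nonneg_left h10 h9
  have h12 : 0 ≤ θ * (β * (a * (φx - e))) := by positivity
  nlinarith

/-- The relative growth of the envelope in one step. -/
noncomputable def growthRate (αbar ρ : ℕ → ℝ) (n : ℕ) : ℝ :=
  (1 + αbar (n + 1) ^ 2) * ρ (n + 1) ^ 2 - 1

/-- The absolute growth of the envelope in one step. -/
noncomputable def growthConst {S : Type*} [MeasurableSpace S] (P : Measure S)
    (L : S → ℝ≥0) (Linf γ ρbar : ℝ) (αbar : ℕ → ℝ) (n : ℕ) : ℝ :=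
  ρbar / 2 * ((1 + αbar (n + 1) ^ 2) * (4 * αbar (n + 1) ^ 2 * Linf ^ 2 * ∫ s, (L s : ℝ) ^ 2 ∂P)
    + γ ^ 2 * (αbar (n + 1) ^ 2 + 1) * αbar (n + 1) ^ 2)

end Envelope

namespace Run

variable {d m : ℕ} {S : Type*} [MeasurableSpace S] {P : Measure S} [IsProbabilityMeasure P]
  {Ω : Type*} [m0 : MeasurableSpace Ω] {Pr : Measure Ω} [IsProbabilityMeasure Pr]
  {f : S → Vec d → EReal} {r : Vec d → EReal} {g : Vec d → Vec d → S → ℝ} {V : Set (Vec d)}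
  {ηbar τbar μinf Linf Lφ γ ρbar : ℝ} {G : ℝ≥0 → ℝ≥0} {L : S → ℝ≥0}
  {samp : ℕ → Fin m → Ω → S} {M : ℕ → Ω → Vec d →L[ℝ] Vec d} {ρ : ℕ → ℝ}
  {x : ℕ → Ω → Vec d} {α ε : ℕ → Ω → ℝ} {αbar : ℕ → ℝ}
  (hR : Run P Pr f r g V ηbar τbar μinf Linf Lφ γ ρbar G L samp M ρ x α ε αbar)
include hR

lemma exists_countable_dense :
    ∃ Q : Set (Vec d), Q.Countable ∧ Q ⊆ V ∧ V ⊆ closure Q := by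
  obtain ⟨D, hDc, hD⟩ := TopologicalSpace.exists_countable_dense (Vec d)
  exact ⟨V ∩ D, hDc.mono Set.inter_subset_right, Set.inter_subset_left,
    hD.open_subset_closure_inter hR.setting.model.isOpen⟩

lemma measurable_env (n : ℕ) : Measurable[sampleSigma samp n]
    fun ω => envOn V (M n ω) ρbar (objR P f r) (x (n + 1) ω) := by
  obtain ⟨Q, hQc, hQV, hVQ⟩ := hR.exists_countable_dense
  have : Countable Q := hQc.to_subtype
  have e : (fun ω => envOn V (M n ω) ρbar (objR P f r) (x (n + 1) ω)) = fun ω =>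
      ⨅ q : Q, (objR P f r q + ρbar / 2 * normM (M n ω) (q - x (n + 1) ω) ^ 2) := by
    ext ω
    exact envOn_eq_iInf hR.setting.nonempty hR.setting.continuousOn_objR hQV hVQ
      hR.setting.exists_le_objR hR.ρbar_pos _ _
  rw [e]
  refine Measurable.iInf fun q => ?_
  exact ((hR.normM_sq_measurable n (measurable_const.sub (hR.measurable_x n))).const_mul _).const_add _

lemma integrable_normM_sub (n : ℕ) (z : Vec d) :
    Integrable (fun ω => normM (M n ω) (z - x (n + 1) ω) ^ 2) Pr := by
  have h := integrable_inner_apply (hR.sampling.sampleSigma_le n) (hR.measurable_M' n)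
    (hR.ae_entry_le n) (measurable_const.sub (hR.measurable_x n))
    (hR.integrable_sub_sq (hR.integrable_norm_sq n) z)
  refine h.congr ?_
  filter_upwards [hR.ae_precond n] with ω ⟨h1, _⟩
  rw [h1.normM_sq]
  rfl

lemma integrable_env (n : ℕ) :
    Integrable (fun ω => envOn V (M n ω) ρbar (objR P f r) (x (n + 1) ω)) Pr := by
  obtain ⟨c, hc⟩ := hR.setting.exists_le_objR
  obtain ⟨z, hz⟩ := hR.setting.nonempty
  have hm := (hR.measurable_env n).mono (hR.sampling.sampleSigma_le n) le_rfl
  refine (((hR.integrable_normM_sub n z).const_mul (ρbar / 2)).add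
    (integrable_const (|objR P f r z| + |c|))).mono' hm.aestronglyMeasurable
    (Eventually.of_forall fun ω => ?_)
  have h1 := le_envOn (M := M n ω) hR.setting.nonempty hc hR.ρbar_pos (x (n + 1) ω)
  have h2 := envOn_le (M := M n ω) ⟨c, hc⟩ hR.ρbar_pos hz (x (n + 1) ω)
  have h3 : 0 ≤ ρbar / 2 * normM (M n ω) (z - x (n + 1) ω) ^ 2 := by
    have := hR.ρbar_pos
    positivity
  rw [Real.norm_eq_abs, abs_le, Pi.add_apply]
  have := neg_abs_le c
  have := le_abs_self (objR P f r z)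
  have := abs_nonneg c
  have := abs_nonneg (objR P f r z)
  constructor <;> linarith

lemma growthRate_nonneg (n : ℕ) : 0 ≤ growthRate αbar ρ n := by
  unfold growthRate
  nlinarith [hR.one_le_ρ_sq (n + 1), sq_nonneg (αbar (n + 1))]

lemma summable_growthRate : Summable (growthRate αbar ρ) := by
  obtain ⟨B, hB⟩ := hR.exists_ρ_le
  have h := hR.summable_ρ_sq.add (hR.αbar_sq.mul_right (B ^ 2))
  refine Summable.of_nonneg_of_le hR.growthRate_nonneg (fun n => ?_) h
  have h1 : ρ (n + 1) ^ 2 ≤ B ^ 2 :=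
    pow_le_pow_left₀ (by linarith [hR.precond.ρ_ge (n + 1)]) (hB _) 2
  unfold growthRate
  nlinarith [mul_le_mul_of_nonneg_left h1 (sq_nonneg (αbar (n + 1)))]

lemma growthConst_nonneg (n : ℕ) : 0 ≤ growthConst P L Linf γ ρbar αbar n := by
  have h1 := hR.ρbar_pos
  have h2 : 0 ≤ ∫ s, (L s : ℝ) ^ 2 ∂P := integral_nonneg fun s => sq_nonneg _
  unfold growthConst
  positivity

lemma summable_growthConst : Summable (growthConst P L Linf γ ρbar αbar) := by
  have h1 := hR.ρbar_pos
  have h2 : 0 ≤ ∫ s, (L s : ℝ) ^ 2 ∂P := integral_nonneg fun s => sq_nonneg _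
  refine Summable.of_nonneg_of_le hR.growthConst_nonneg (fun n => ?_)
    (hR.αbar_sq.mul_left (ρbar / 2 * (1 + (2 * ρbar)⁻¹ ^ 2) *
      (4 * Linf ^ 2 * ∫ s, (L s : ℝ) ^ 2 ∂P + γ ^ 2)))
  have h3 : αbar (n + 1) ^ 2 ≤ (2 * ρbar)⁻¹ ^ 2 :=
    pow_le_pow_left₀ (hR.αbar_succ_pos n).le (hR.αbar_le n) 2
  unfold growthConst
  calc _ = ρbar / 2 * (1 + αbar (n + 1) ^ 2) *
      (4 * Linf ^ 2 * ∫ s, (L s : ℝ) ^ 2 ∂P + γ ^ 2) * αbar (n + 1) ^ 2 := by ring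
    _ ≤ _ := by gcongr

/-- One step of the algorithm decreases the Moreau envelope in conditional expectation. -/
theorem condExp_env_le (n : ℕ) {c : ℝ} (hc : ∀ y ∈ V, c ≤ objR P f r y) :
    ∀ᵐ ω ∂Pr, (Pr[fun ω => envOn V (M (n + 1) ω) ρbar (objR P f r) (x (n + 2) ω)
        | sampleSigma samp n]) ω ≤
      envOn V (M n ω) ρbar (objR P f r) (x (n + 1) ω)
        + growthRate αbar ρ n * (envOn V (M n ω) ρbar (objR P f r) (x (n + 1) ω) - c)
        - ρbar * (stepSize G αbar (n + 1) (x (n + 1) ω) * (objR P f r (x (n + 1) ω)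
          - envOn V (M n ω) ρbar (objR P f r) (x (n + 1) ω)))
        + growthConst P L Linf γ ρbar αbar n := by
  obtain ⟨Q, hQc, hQV, hVQ⟩ := hR.exists_countable_dense
  have hle := hR.sampling.sampleSigma_le n
  have hρ0 := hR.ρbar_pos
  -- One null set serves all `z ∈ Q`, so `z` may afterwards be chosen depending on `ω`.
  have hz : ∀ᵐ ω ∂Pr, ∀ z ∈ Q,
      (Pr[fun ω => envOn V (M (n + 1) ω) ρbar (objR P f r) (x (n + 2) ω)
        | sampleSigma samp n]) ω ≤ objR P f r z + ρbar / 2 * ((1 + αbar (n + 1) ^ 2) *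
        (stepFactor Linf τbar G αbar (n + 1) (x (n + 1) ω) *
            (ρ (n + 1) ^ 2 * normM (M n ω) (z - x (n + 1) ω) ^ 2)
          + 2 * (stepSize G αbar (n + 1) (x (n + 1) ω)
            * stepFactor Linf τbar G αbar (n + 1) (x (n + 1) ω)) *
            (objR P f r z - objR P f r (x (n + 1) ω) + ηbar / 2 * ‖z - x (n + 1) ω‖ ^ 2)
          + 4 * αbar (n + 1) ^ 2 * Linf ^ 2 * ∫ s, (L s : ℝ) ^ 2 ∂P)
        + γ ^ 2 * (αbar (n + 1) ^ 2 + 1) * αbar (n + 1) ^ 2) := by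
    rw [ae_ball_iff hQc]
    intro z hz
    obtain ⟨hi, hstep⟩ := hR.condExp_step (hR.integrable_norm_sq n) (hQV hz)
    have hi' := hi.smul (ρbar / 2)
    have h1 : Pr[fun ω => envOn V (M (n + 1) ω) ρbar (objR P f r) (x (n + 2) ω)
        | sampleSigma samp n] ≤ᵐ[Pr] Pr[(fun _ => objR P f r z) + (ρbar / 2) •
          fun ω => normM (M (n + 1) ω) (z - x (n + 2) ω) ^ 2 | sampleSigma samp n] := by
      refine condExp_mono (hR.integrable_env (n + 1)) ((integrable_const _).add hi') ?_
      exact Eventually.of_forall fun ω => envOn_le ⟨c, hc⟩ hρ0 (hQV hz) _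
    filter_upwards [h1, condExp_add (m := sampleSigma samp n) (integrable_const (objR P f r z)) hi',
      condExp_smul (μ := Pr) (ρbar / 2) (fun ω => normM (M (n + 1) ω) (z - x (n + 2) ω) ^ 2)
        (sampleSigma samp n), hstep] with ω h1 h2 h3 h4
    rw [h2, Pi.add_apply, h3, Pi.smul_apply, smul_eq_mul, condExp_const hle] at h1
    exact h1.trans (by gcongr)
  filter_upwards [hz, hR.ae_mem n, hR.ae_precond n] with ω hz hx ⟨hM, hMv⟩
  set e := envOn V (M n ω) ρbar (objR P f r) (x (n + 1) ω) with he
  -- `K` is the coefficient of the suboptimality of `z` in `descent_algebra`; a suboptimality below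
  -- `δ / K` costs at most `δ`.
  set K := 1 + growthRate αbar ρ n + 2 * ρbar * (1 + αbar (n + 1) ^ 2) * αbar (n + 1) with hK
  have hK0 : 0 < K := by
    have := hR.growthRate_nonneg n
    have := (hR.αbar_succ_pos n).le
    positivity
  refine le_of_forall_pos_le_add fun δ hδ => ?_
  have hlt : e < e + δ / K := lt_add_of_pos_right _ (div_pos hδ hK0)
  have hinf := envOn_eq_iInf hR.setting.nonempty hR.setting.continuousOn_objR hQV hVQ
      hR.setting.exists_le_objR hR.ρbar_pos (M n ω) (x (n + 1) ω)
  have : Nonempty Q := (closure_nonempty_iff.mp (hR.setting.nonempty.mono hVQ)).to_subtype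
  nth_rewrite 1 [he] at hlt
  rw [hinf] at hlt
  obtain ⟨⟨z, hzQ⟩, hzlt⟩ := exists_lt_of_ciInf_lt hlt
  have hzV := hQV hzQ
  have hσ : stepFactor Linf τbar G αbar (n + 1) (x (n + 1) ω) *
      (1 - Linf ^ 2 * τbar * stepSize G αbar (n + 1) (x (n + 1) ω)) = 1 :=
    inv_mul_cancel₀ (by linarith [hR.τ_stepSize_le n (x (n + 1) ω)])
  have hUx : e ≤ objR P f r (x (n + 1) ω) := by
    have := envOn_le (M := M n ω) ⟨c, hc⟩ hρ0 hx (x (n + 1) ω)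
    simpa [normM] using this
  have hηD : ηbar / 2 * ‖z - x (n + 1) ω‖ ^ 2 ≤
      Linf ^ 2 * ηbar / 2 * normM (M n ω) (z - x (n + 1) ω) ^ 2 := by
    have h1 : ‖z - x (n + 1) ω‖ ^ 2 ≤ Linf ^ 2 * normM (M n ω) (z - x (n + 1) ω) ^ 2 := by
      rw [← mul_pow]
      exact pow_le_pow_left₀ (norm_nonneg _) (hMv _).2 2
    have := mul_le_mul_of_nonneg_left h1 (half_pos_of hR.ηbar_nonneg)
    linarith
  have hρc : Linf ^ 2 * ηbar + ρ (n + 1) ^ 2 * (Linf ^ 2 * τbar) ≤ ρbar := by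
    have h1 := hR.constants_le n
    have h4 : 0 ≤ Linf ^ 2 * τbar := mul_nonneg (sq_nonneg _) hR.τbar_nonneg
    nlinarith [mul_nonneg (sq_nonneg (ρ (n + 1))) h4]
  have hezle : e ≤ objR P f r z + ρbar / 2 * normM (M n ω) (z - x (n + 1) ω) ^ 2 :=
    envOn_le ⟨c, hc⟩ hρ0 hzV _
  have halg := descent_algebra (e := e) (φz := objR P f r z) (φx := objR P f r (x (n + 1) ω))
    (D := normM (M n ω) (z - x (n + 1) ω) ^ 2)
    (ξ := objR P f r z + ρbar / 2 * normM (M n ω) (z - x (n + 1) ω) ^ 2 - e)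
    (c₃ := 4 * αbar (n + 1) ^ 2 * Linf ^ 2 * ∫ s, (L s : ℝ) ^ 2 ∂P)
    (c₄ := γ ^ 2 * (αbar (n + 1) ^ 2 + 1) * αbar (n + 1) ^ 2)
    hρ0 (sq_nonneg _) (by ring) (by linarith) (hc z hzV) hUx
    (hR.stepSize_pos n (x (n + 1) ω)).le (hR.stepSize_le n (x (n + 1) ω))
    (hR.one_le_stepFactor n (x (n + 1) ω)) (hR.stepFactor_le n (x (n + 1) ω)) hσ hρc
    (hR.one_le_ρ_sq (n + 1)) (sq_nonneg (αbar (n + 1)))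
  have hKξ : K * (objR P f r z + ρbar / 2 * normM (M n ω) (z - x (n + 1) ω) ^ 2 - e) ≤ δ := by
    have : objR P f r z + ρbar / 2 * normM (M n ω) (z - x (n + 1) ω) ^ 2 - e ≤ δ / K := by
      linarith
    calc _ ≤ K * (δ / K) := mul_le_mul_of_nonneg_left this hK0.le
      _ = δ := by field_simp
  have hzω := hz z hzQ
  refine hzω.trans (le_trans ?_ (halg.trans ?_))
  · have h1 := (hR.stepSize_pos n (x (n + 1) ω)).le
    have h2 := zero_le_one.trans (hR.one_le_stepFactor n (x (n + 1) ω))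
    gcongr
  · unfold growthRate at hK ⊢
    unfold growthConst
    rw [← hK]
    linarith
where
  half_pos_of {t : ℝ} (ht : 0 ≤ t) : 0 ≤ t / 2 := by linarith

/-- Almost surely the Moreau envelopes along the iterates are bounded, and the weighted gaps to the
objective are summable. -/
theorem ae_bounded_summable :
    ∀ᵐ ω ∂Pr, (∃ C, ∀ n, envOn V (M n ω) ρbar (objR P f r) (x (n + 1) ω) ≤ C) ∧
      Summable fun n => ρbar * (stepSize G αbar (n + 1) (x (n + 1) ω) *
        (objR P f r (x (n + 1) ω) - envOn V (M n ω) ρbar (objR P f r) (x (n + 1) ω))) := by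
  obtain ⟨c, hc⟩ := hR.setting.exists_le_objR
  have hρ0 := hR.ρbar_pos
  set A : ℕ → Ω → ℝ := fun n ω => envOn V (M n ω) ρbar (objR P f r) (x (n + 1) ω) - c with hA
  set u : ℕ → Ω → ℝ := fun n ω => ρbar * (stepSize G αbar (n + 1) (x (n + 1) ω) *
        (objR P f r (x (n + 1) ω) - envOn V (M n ω) ρbar (objR P f r) (x (n + 1) ω))) with hu
  have hAm : ∀ n, Measurable[sampleSigma samp n] (A n) := fun n =>
    (hR.measurable_env n).sub_const c
  have hum : ∀ n, Measurable[sampleSigma samp n] (u n) := fun n =>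
    (((hR.measurable_stepSize (n + 1)).comp (hR.measurable_x n)).mul
      ((hR.setting.measurable_objR.comp (hR.measurable_x n)).sub
        (hR.measurable_env n))).const_mul _
  have hAi : ∀ n, Integrable (A n) Pr := fun n => (hR.integrable_env n).sub (integrable_const c)
  have hA0 : ∀ n, ∀ᵐ ω ∂Pr, 0 ≤ A n ω := fun n => Eventually.of_forall fun ω =>
    sub_nonneg.mpr (le_envOn hR.setting.nonempty hc hρ0 _)
  have hu0 : ∀ n, ∀ᵐ ω ∂Pr, 0 ≤ u n ω := by
    intro n
    filter_upwards [hR.ae_mem n] with ω hx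
    have h1 := envOn_le (M := M n ω) ⟨c, hc⟩ hρ0 hx (x (n + 1) ω)
    have h2 : normM (M n ω) (x (n + 1) ω - x (n + 1) ω) = 0 := by simp [normM]
    rw [h2] at h1
    exact mul_nonneg hρ0.le (mul_nonneg (hR.stepSize_pos n _).le (by linarith))
  have hrec : ∀ n, ∀ᵐ ω ∂Pr, (Pr[A (n + 1) | hR.sampling.filtration n]) ω ≤
      (1 + growthRate αbar ρ n) * A n ω - u n ω + growthConst P L Linf γ ρbar αbar n := by
    intro n
    have h1 := condExp_sub (m := sampleSigma samp n) (hR.integrable_env (n + 1))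
      (integrable_const c)
    filter_upwards [h1, hR.condExp_env_le n hc] with ω h1 h2
    refine (le_of_eq h1).trans ?_
    rw [Pi.sub_apply, condExp_const (hR.sampling.sampleSigma_le n)]
    simp only [hA, hu]
    linarith
  -- The recursion itself gives integrability: the conditional expectation of `A (n + 1)` is
  -- nonnegative, so `u n` lies between `0` and an integrable function.
  have hui : ∀ n, Integrable (u n) Pr := by
    intro n
    refine (((hAi n).const_mul (1 + growthRate αbar ρ n)).add
      (integrable_const (growthConst P L Linf γ ρbar αbar n))).mono'
      ((hum n).mono (hR.sampling.sampleSigma_le n) le_rfl).aestronglyMeasurable ?_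
    filter_upwards [hu0 n, hrec n,
      condExp_nonneg (m := hR.sampling.filtration n) (hA0 (n + 1))] with ω h1 h2 h3
    rw [Real.norm_eq_abs, abs_of_nonneg h1, Pi.add_apply]
    rw [Pi.zero_apply] at h3
    linarith
  have hRS := robbins_siegmund (ℱ := hR.sampling.filtration) (A := A) (u := u)
    (fun n => (hAm n).stronglyMeasurable) (fun n => (hum n).stronglyMeasurable) hAi hui hA0 hu0
    hR.growthRate_nonneg hR.summable_growthRate hR.growthConst_nonneg hR.summable_growthConst hrec
  filter_upwards [hRS] with ω ⟨⟨C, hC⟩, h2⟩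
  refine ⟨⟨C + c, fun n => ?_⟩, h2⟩
  have := hC n
  simp only [hA] at this
  linarith

end Run

/-! ### Boundedness and stationarity -/

lemma not_summable_of_tendsto_sum_Icc {a : ℕ → ℝ} (ha : ∀ k, 1 ≤ k → 0 ≤ a k)
    (h : Tendsto (fun n => ∑ k ∈ Finset.Icc 1 n, a k) atTop atTop) :
    ¬ Summable fun k => a (k + 1) := by
  intro hs
  have e : ∀ n, ∑ k ∈ Finset.Icc 1 n, a k = ∑ k ∈ Finset.range n, a (k + 1) := by
    intro n
    induction n with
    | zero => simp
    | succ n ih => rw [Finset.sum_Icc_succ_top (Nat.le_add_left 1 n), ih, Finset.sum_range_succ]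
  obtain ⟨n, hn⟩ := (h.eventually_gt_atTop (∑' k, a (k + 1))).exists
  rw [e] at hn
  exact absurd (hs.sum_le_tsum _ fun k _ => ha _ (Nat.le_add_left 1 k)) (not_le.mpr hn)

namespace Run

variable {d m : ℕ} {S : Type*} [MeasurableSpace S] {P : Measure S} [IsProbabilityMeasure P]
  {Ω : Type*} [m0 : MeasurableSpace Ω] {Pr : Measure Ω} [IsProbabilityMeasure Pr]
  {f : S → Vec d → EReal} {r : Vec d → EReal} {g : Vec d → Vec d → S → ℝ} {V : Set (Vec d)}
  {ηbar τbar μinf Linf Lφ γ ρbar : ℝ} {G : ℝ≥0 → ℝ≥0} {L : S → ℝ≥0}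
  {samp : ℕ → Fin m → Ω → S} {M : ℕ → Ω → Vec d →L[ℝ] Vec d} {ρ : ℕ → ℝ}
  {x : ℕ → Ω → Vec d} {α ε : ℕ → Ω → ℝ} {αbar : ℕ → ℝ}
  (hR : Run P Pr f r g V ηbar τbar μinf Linf Lφ γ ρbar G L samp M ρ x α ε αbar)
include hR

/-- A near-minimizer `z` in the envelope at `x (n + 1)` lies in the bounded sublevel set of height
`C + 1`, and the quadratic term, at most `C + 1 - c`, bounds its distance to `x (n + 1)`. -/
theorem norm_bounded {ω : Ω}
    (hM : ∀ n, IsPrecond (M n ω) ∧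
      ∀ v, μinf * normM (M n ω) v ≤ ‖v‖ ∧ ‖v‖ ≤ Linf * normM (M n ω) v)
    (hC : ∃ C, ∀ n, envOn V (M n ω) ρbar (objR P f r) (x (n + 1) ω) ≤ C) :
    ∃ C, ∀ n, ‖x (n + 1) ω‖ ≤ C := by
  obtain ⟨C, hC⟩ := hC
  obtain ⟨c, hc⟩ := hR.setting.exists_le_objR
  obtain ⟨R, hRb⟩ := hR.setting.objR_bounded (C + 1)
  have hρ0 := hR.ρbar_pos
  set B := Linf ^ 2 * (2 / ρbar * (C + 1 - c)) with hB
  refine ⟨R + (1 + B), fun n => ?_⟩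
  obtain ⟨_, ⟨z, hz, rfl⟩, hzlt⟩ := exists_lt_of_csInf_lt (hR.setting.nonempty.image _)
    (lt_of_le_of_lt (hC n) (lt_add_one C))
  beta_reduce at hzlt
  have hD : 0 ≤ ρbar / 2 * normM (M n ω) (z - x (n + 1) ω) ^ 2 := by positivity
  have h1 : ‖z‖ ≤ R := hRb z hz (by linarith)
  have h2 : normM (M n ω) (z - x (n + 1) ω) ^ 2 ≤ 2 / ρbar * (C + 1 - c) := by
    have h3 : ρbar / 2 * normM (M n ω) (z - x (n + 1) ω) ^ 2 ≤ C + 1 - c := by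
      linarith [hc z hz]
    calc _ = 2 / ρbar * (ρbar / 2 * normM (M n ω) (z - x (n + 1) ω) ^ 2) := by field_simp
      _ ≤ _ := mul_le_mul_of_nonneg_left h3 (by positivity)
  have h3 : ‖z - x (n + 1) ω‖ ^ 2 ≤ B := by
    refine le_trans (pow_le_pow_left₀ (norm_nonneg _) ((hM n).2 _).2 2) ?_
    rw [mul_pow]
    exact mul_le_mul_of_nonneg_left h2 (sq_nonneg _)
  have h4 : ‖x (n + 1) ω‖ ≤ ‖z‖ + ‖z - x (n + 1) ω‖ := by
    have := norm_sub_le z (z - x (n + 1) ω)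
    rwa [sub_sub_cancel] at this
  nlinarith [sq_nonneg (‖z - x (n + 1) ω‖ - 1)]

/-- The gradient of the envelope is controlled by the gap between objective and envelope. -/
lemma gradient_sq_le {A : Vec d →L[ℝ] Vec d} (hA : IsPrecond A)
    (hAv : ∀ v, μinf * normM A v ≤ ‖v‖ ∧ ‖v‖ ≤ Linf * normM A v) {y : Vec d} (hy : y ∈ V) :
    ‖gradient (envOn V A ρbar (objR P f r)) y‖ ^ 2 ≤
      (ρbar * μinf⁻¹) ^ 2 * (2 / (ρbar - Linf ^ 2 * (ηbar + τbar))) *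
        (objR P f r y - envOn V A ρbar (objR P f r) y) := by
  have hκ := hR.curvature_pos
  have hρ0 := hR.ρbar_pos
  have hμ := hR.precond.μinf_mem.1
  have hc0 : 0 ≤ ηbar + τbar := add_nonneg hR.ηbar_nonneg hR.τbar_nonneg
  obtain ⟨w, q, hq⟩ := exists_minLimit_envOn hR.setting.model.convex hR.setting.nonempty hA
    (fun v => (hAv v).2) hR.setting.weakOn_objR hc0 hρ0 hκ hR.setting.exists_le_objR y
  have hg := hasGradientAt_envOn hR.setting.model.convex hR.setting.nonempty hA
    (fun v => (hAv v).2) hμ (fun v => (hAv v).1) hR.setting.weakOn_objR hc0 hρ0 hκ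
    hR.setting.exists_le_objR hq
  rw [hg.gradient, norm_smul, Real.norm_eq_abs, abs_of_pos hρ0]
  have h1 := hA.norm_apply_le hμ (fun v => (hAv v).1) (y - q)
  -- Growth evaluated at the centre `y`, where the quadratic vanishes: the gap is at least `κ / 2 *
  -- ‖y - q‖_M²`, and the gradient is `ρbar • A (y - q)`.
  have h2 := hq.growth y hy
  have h3 : normM A (y - y) = 0 := by simp [normM]
  beta_reduce at h2
  rw [h3] at h2
  set κ := ρbar - Linf ^ 2 * (ηbar + τbar) with hκdef
  have h4 : normM A (y - q) ^ 2 ≤ 2 / κ * (objR P f r y - envOn V A ρbar (objR P f r) y) := by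
    calc normM A (y - q) ^ 2 = 2 / κ * (κ / 2 * normM A (y - q) ^ 2) := by field_simp
      _ ≤ _ := mul_le_mul_of_nonneg_left (by linarith) (by positivity)
  calc (ρbar * ‖A (y - q)‖) ^ 2 ≤ (ρbar * (μinf⁻¹ * normM A (y - q))) ^ 2 := by gcongr
    _ = (ρbar * μinf⁻¹) ^ 2 * normM A (y - q) ^ 2 := by ring
    _ ≤ _ := by
      rw [mul_assoc]
      gcongr

theorem differentiable_envOn {A : Vec d →L[ℝ] Vec d} (hA : IsPrecond A)
    (hAv : ∀ v, μinf * normM A v ≤ ‖v‖ ∧ ‖v‖ ≤ Linf * normM A v) :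
    Differentiable ℝ (envOn V A ρbar (objR P f r)) := by
  intro y
  have hκ := hR.curvature_pos
  have hρ0 := hR.ρbar_pos
  have hc0 : 0 ≤ ηbar + τbar := add_nonneg hR.ηbar_nonneg hR.τbar_nonneg
  obtain ⟨w, q, hq⟩ := exists_minLimit_envOn hR.setting.model.convex hR.setting.nonempty hA
    (fun v => (hAv v).2) hR.setting.weakOn_objR hc0 hρ0 hκ hR.setting.exists_le_objR y
  exact (hasGradientAt_envOn hR.setting.model.convex hR.setting.nonempty hA
    (fun v => (hAv v).2) hR.precond.μinf_mem.1 (fun v => (hAv v).1) hR.setting.weakOn_objR hc0 hρ0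
    hκ hR.setting.exists_le_objR hq).differentiableAt

/-- A positive lower limit bounds the gaps away from zero, while bounded iterates keep the step
sizes above a multiple of `αbar`; summability of the weighted gaps would then make `αbar` summable.
-/
theorem liminf_gradient_eq_zero {ω : Ω} (hx : ∀ n, x (n + 1) ω ∈ V)
    (hM : ∀ n, IsPrecond (M n ω) ∧
      ∀ v, μinf * normM (M n ω) v ≤ ‖v‖ ∧ ‖v‖ ≤ Linf * normM (M n ω) v)
    (hC : ∃ C, ∀ n, envOn V (M n ω) ρbar (objR P f r) (x (n + 1) ω) ≤ C)
    (hsum : Summable fun n => ρbar * (stepSize G αbar (n + 1) (x (n + 1) ω) *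
        (objR P f r (x (n + 1) ω) - envOn V (M n ω) ρbar (objR P f r) (x (n + 1) ω))))
    (hα : Tendsto (fun n => ∑ k ∈ Finset.Icc 1 n, αbar k) atTop atTop) :
    liminf (fun n => ‖gradient (envOn V (M n ω) ρbar (objR P f r)) (x (n + 1) ω)‖ₑ) atTop = 0 := by
  by_contra hne
  obtain ⟨δ, hδ0, hδ⟩ := exists_between (pos_iff_ne_zero.mpr hne)
  have hev := eventually_lt_of_lt_liminf hδ
  have hδtop : δ ≠ ⊤ := hδ.ne_top
  have hδ' : 0 < δ.toReal := ENNReal.toReal_pos hδ0.ne' hδtop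
  obtain ⟨C, hC'⟩ := hR.norm_bounded hM hC
  have hκ := hR.curvature_pos
  have hρ0 := hR.ρbar_pos
  have hμ := hR.precond.μinf_mem.1
  set K := (ρbar * μinf⁻¹) ^ 2 * (2 / (ρbar - Linf ^ 2 * (ηbar + τbar))) with hK
  have hK0 : 0 < K := by positivity
  set N : ℝ := max 1 (G C.toNNReal : ℝ) with hN
  have hN0 : 0 < N := lt_max_of_lt_left one_pos
  -- Chosen so that the weighted gap is eventually at least `q * αbar (n + 1)`: `N⁻¹` comes from the
  -- step size and `δ ^ 2 / K` from the gradient bound.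
  set q := ρbar * (N⁻¹ * (δ.toReal ^ 2 / K)) with hq
  have hq0 : 0 < q := by positivity
  refine not_summable_of_tendsto_sum_Icc (fun k hk => (hR.αbar_pos k hk).le) hα ?_
  have hle : ∀ᶠ n in atTop, ‖αbar (n + 1)‖ ≤ q⁻¹ * (ρbar * (stepSize G αbar (n + 1) (x (n + 1) ω) *
        (objR P f r (x (n + 1) ω) - envOn V (M n ω) ρbar (objR P f r) (x (n + 1) ω)))) := by
    filter_upwards [hev] with n hn
    have h1 : δ.toReal < ‖gradient (envOn V (M n ω) ρbar (objR P f r)) (x (n + 1) ω)‖ := by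
      rw [← toReal_enorm]
      exact ENNReal.toReal_strict_mono enorm_ne_top hn
    have h2 := hR.gradient_sq_le (hM n).1 (hM n).2 (hx n)
    have h3 : δ.toReal ^ 2 ≤ _ := (pow_le_pow_left₀ hδ'.le h1.le 2).trans h2
    rw [← hK, ← div_le_iff₀' hK0] at h3
    have h4 : αbar (n + 1) * N⁻¹ ≤ stepSize G αbar (n + 1) (x (n + 1) ω) := by
      rw [← div_eq_mul_inv]
      refine div_le_div_of_nonneg_left (hR.αbar_succ_pos n).le (lt_max_of_lt_left one_pos) ?_
      refine max_le_max le_rfl ?_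
      have : ‖x (n + 1) ω‖₊ ≤ C.toNNReal := NNReal.le_toNNReal_of_coe_le (hC' n)
      exact_mod_cast hR.setting.growth.monotone this
    rw [Real.norm_eq_abs, abs_of_pos (hR.αbar_succ_pos n), le_inv_mul_iff₀ hq0]
    have hα0 := (hR.αbar_succ_pos n).le
    have hs0 := (hR.stepSize_pos n (x (n + 1) ω)).le
    calc q * αbar (n + 1) = ρbar * ((αbar (n + 1) * N⁻¹) * (δ.toReal ^ 2 / K)) := by
          rw [hq]
          ring
      _ ≤ _ := by gcongr
  exact Summable.of_norm_bounded_eventually_nat (hsum.mul_left q⁻¹) hle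

theorem conclusion :
    (∀ᵐ ω ∂Pr, ∃ C : ℝ, ∀ k, 1 ≤ k → ‖x k ω‖ ≤ C) ∧
    (Tendsto (fun n => ∑ k ∈ Finset.Icc 1 n, αbar k) atTop atTop →
      ∀ᵐ ω ∂Pr,
        (∀ k : ℕ,
          (∀ z, moreauEnv (M k ω) ρbar⁻¹ (objective P f r) z ≠ ⊤ ∧
            moreauEnv (M k ω) ρbar⁻¹ (objective P f r) z ≠ ⊥) ∧
          Differentiable ℝ fun z => (moreauEnv (M k ω) ρbar⁻¹ (objective P f r) z).toReal) ∧
        liminf (fun k : ℕ =>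
          ‖gradient (fun z => (moreauEnv (M k ω) ρbar⁻¹ (objective P f r) z).toReal)
            (x (k + 1) ω)‖ₑ) atTop = 0) := by
  have hM := ae_all_iff.mpr hR.ae_precond
  have hx := ae_all_iff.mpr hR.ae_mem
  constructor
  · filter_upwards [hM, hR.ae_bounded_summable] with ω hM ⟨hC, _⟩
    obtain ⟨C, hC⟩ := hR.norm_bounded hM hC
    refine ⟨C, fun k hk => ?_⟩
    obtain ⟨n, rfl⟩ := Nat.exists_eq_add_of_le' hk
    exact hC n
  · intro hα
    filter_upwards [hM, hx, hR.ae_bounded_summable] with ω hM hx ⟨hC, hsum⟩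
    have henv : ∀ k z, moreauEnv (M k ω) ρbar⁻¹ (objective P f r) z =
        (envOn V (M k ω) ρbar (objR P f r) z : EReal) := fun k z =>
      moreauEnv_eq_envOn hR.setting.represents_objective hR.setting.nonempty
        hR.setting.exists_le_objR hR.ρbar_pos z
    simp only [henv, EReal.toReal_coe]
    exact ⟨fun k => ⟨fun z => ⟨EReal.coe_ne_top _, EReal.coe_ne_bot _⟩,
      hR.differentiable_envOn (hM k).1 (hM k).2⟩,
      hR.liminf_gradient_eq_zero hx hM hC hsum hα⟩

end Run

/-- In dimension zero the Moreau envelope is finite. -/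
lemma moreauEnv_finite_of_subsingleton [Subsingleton (Vec d)] {p : Vec d → EReal} {c : ℝ}
    (hc : ∀ y, (c : EReal) ≤ p y) (hp : ∃ y, p y ≠ ⊤) (M : Vec d →L[ℝ] Vec d) (β : ℝ)
    (z : Vec d) : moreauEnv M β p z ≠ ⊤ ∧ moreauEnv M β p z ≠ ⊥ := by
  obtain ⟨y₀, hy₀⟩ := hp
  have h : moreauEnv M β p z = p y₀ := by
    have e : ∀ y, p y + ((1 / (2 * β) * normM M (y - z) ^ 2 : ℝ) : EReal) = p y₀ := by
      intro y
      rw [Subsingleton.elim y y₀, Subsingleton.elim (y₀ - z) 0]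
      simp [normM]
    unfold moreauEnv
    simp only [e, ciInf_const]
  rw [h]
  refine ⟨hy₀, fun hbot => ?_⟩
  have := hc y₀
  rw [hbot, le_bot_iff] at this
  exact EReal.coe_ne_bot _ this

end IspPPA

/-! ### The theorem -/

theorem mainTheorem2 {d m : ℕ} (hm : 0 < m)
    {S : Type*} [MeasurableSpace S] (P : Measure S) [IsProbabilityMeasure P]
    {Ω : Type*} [MeasurableSpace Ω] (Pr : Measure Ω) [IsProbabilityMeasure Pr]
    (f : S → IspPPA.Vec d → EReal) (r : IspPPA.Vec d → EReal)
    (g : IspPPA.Vec d → IspPPA.Vec d → S → ℝ) (V : Set (IspPPA.Vec d))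
    (ηbar τbar μinf Linf Lφ γ ρbar : ℝ) (G : ℝ≥0 → ℝ≥0) (L : S → ℝ≥0)
    (samp : ℕ → Fin m → Ω → S) (M : ℕ → Ω → IspPPA.Vec d →L[ℝ] IspPPA.Vec d) (ρ : ℕ → ℝ)
    (x : ℕ → Ω → IspPPA.Vec d) (α ε : ℕ → Ω → ℝ) (αbar : ℕ → ℝ)
    (hmodel : IspPPA.ModelAssumption P f r g V ηbar)
    (hsamp : IspPPA.IIDSampling P Pr samp)
    (hprecond : IspPPA.PrecondAssumption Pr samp M ρ μinf Linf)
    (hcomp : IspPPA.CompositeAssumption P f r g V τbar)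
    (hsub : IspPPA.SublevelAssumption (IspPPA.objective P f r))
    (hgrowth : IspPPA.GrowthAssumption P r g V G L Lφ)
    (halg : IspPPA.IsIspPPA Pr samp g r V M (Linf ^ 2 * τbar) α ε x)
    (hγ : 0 ≤ γ)
    (hρbar : (⨆ k : ℕ, (ρ (k + 1)) ^ 2) * (Linf ^ 2 * ηbar + 2 * (Linf ^ 2 * τbar)) < ρbar)
    (hα : ∀ k, 1 ≤ k → ∀ ω, α k ω = αbar k / max 1 (G ‖x k ω‖₊ : ℝ))
    (hε : ∀ k, 1 ≤ k → ∀ ω, ε k ω = γ * (α k ω) ^ 2)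
    (hαbar_pos : ∀ k, 1 ≤ k → 0 < αbar k)
    (hαbar_sup : (⨆ k : ℕ, αbar (k + 1)) < (2 * ρbar)⁻¹)
    (hαbar_sq : Summable fun k : ℕ => (αbar (k + 1)) ^ 2) :
    (∀ᵐ ω ∂Pr, ∃ C : ℝ, ∀ k, 1 ≤ k → ‖x k ω‖ ≤ C) ∧
    (Tendsto (fun n => ∑ k ∈ Finset.Icc 1 n, αbar k) atTop atTop →
      ∀ᵐ ω ∂Pr,
        (∀ k : ℕ,
          (∀ z, IspPPA.moreauEnv (M k ω) ρbar⁻¹ (IspPPA.objective P f r) z ≠ ⊤ ∧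
            IspPPA.moreauEnv (M k ω) ρbar⁻¹ (IspPPA.objective P f r) z ≠ ⊥) ∧
          Differentiable ℝ fun z =>
            (IspPPA.moreauEnv (M k ω) ρbar⁻¹ (IspPPA.objective P f r) z).toReal) ∧
        liminf (fun k : ℕ =>
          ‖gradient (fun z =>
              (IspPPA.moreauEnv (M k ω) ρbar⁻¹ (IspPPA.objective P f r) z).toReal)
            (x (k + 1) ω)‖ₑ) atTop = 0) := by
  -- Dimension zero is separate because `ηbar` may be negative there; on a one-point space both
  -- conclusions are immediate.
  rcases Nat.eq_zero_or_pos d with rfl | hd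
  · constructor
    · refine Eventually.of_forall fun ω => ⟨0, fun k _ => ?_⟩
      rw [Subsingleton.elim (x k ω) 0, norm_zero]
    · intro _
      obtain ⟨c, hc⟩ := hsub.bddBelow
      obtain ⟨y₀, hy₀⟩ := hcomp.r_proper.2
      have hfin : ∃ y, IspPPA.objective P f r y ≠ ⊤ :=
        ⟨y₀, EReal.add_ne_top (EReal.coe_ne_top _) hy₀⟩
      refine Eventually.of_forall fun ω => ⟨fun k => ⟨fun z =>
        IspPPA.moreauEnv_finite_of_subsingleton hc hfin _ _ z, fun z =>
          (hasFDerivAt_of_subsingleton _ z).differentiableAt⟩, ?_⟩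
      simp only [Subsingleton.elim (gradient _ _) (0 : IspPPA.Vec 0), enorm_zero, liminf_const]
  · exact IspPPA.Run.conclusion
      { dim_pos := hd
        batch_pos := hm
        setting := ⟨hmodel, hcomp, hgrowth, hsub⟩
        sampling := hsamp
        precond := hprecond
        alg := halg
        γ_nonneg := hγ
        ρbar_gt := hρbar
        α_eq := hα
        ε_eq := hε
        αbar_pos := hαbar_pos
        αbar_sup := hαbar_sup
        αbar_sq := hαbar_sq }
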